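/- **Setting.** Let $v:\mathbb R^3\to[0,\infty)$ be spherically symmetric and integrable, with $v(x)=0$ for $|x|>R$, where $R>0$. Let $a=a(v)$ be its scattering length, defined by $$\frac{4\pi a}{1-a/\widetilde R}=\inf\Big\{\int_{|x|\le\widetilde R}|\nabla\phi|^2+\tfrac12 v|\phi|^2\,dx\ :\ \phi\in H^1(B(0,\widetilde R)),\ \phi|_{|x|=\widetilde R}=1\Big\}$$ ($\widetilde R>R$ arbitrary), and assume $a>0$. Let $\omega$ be the scattering solution: $(-\Delta+\frac12 v)(1-\omega)=0$ in the sense of distributions on $\mathbb R^3$, $\omega(x)\to0$ as $|x|\to\infty$. Put $g=v(1-\omega)$. For $\rho_\mu>0$ and $\Lambda=[-L/2,L/2]^3$ let $\mathcal H_{\rho_\mu}$ be the particle-number preserving Hamiltonian on the symmetric Fock space over $L^2(\Lambda)$ that on $N$ particles, with Dirichlet boundary conditions, is $$\sum_{i=1}^N\Big(-\Delta_i-\rho_\mu\int_{\mathbb R^3} g(x_i-y)\,dy\Big)+\sum_{i<j}v(x_i-x_j),$$ and let $$e_0(\rho_\mu)=\lim_{L\to\infty}L^{-3}\inf_{\Psi\neq0}\frac{\langle\Psi,\mathcal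 H_{\rho_\mu}\Psi\rangle}{\|\Psi\|^2}\in[-\infty,0]$$ (read as a lower limit, so that the existence of the limit need not be known). Let $\chi\in C_c^\infty(\mathbb R^3)$ be even and non-negative with $\int\chi^2=1$ and $\operatorname{supp}\chi\subset[-\frac12,\frac12]^3$, and let $D>0$ be such that $|\chi*\chi(x)-1|\le\frac12$ for all $|x|\le D$. For $K>0$ let $$\ell=K(\rho_\mu a)^{-1/2},\qquad B=[-\tfrac\ell2,\tfrac\ell2]^3,\qquad \theta=\mathbf 1_B,\qquad \chi_B(x)=\chi(x/\ell),$$ let $Q\varphi=\theta\varphi-\ell^{-3}\langle\theta,\varphi\rangle\theta$ on $L^2(\mathbb R^3)$, and $$W(x)=\frac{v(x)}{\chi*\chi(x/\ell)},\qquad w(x,y)=\chi_B(x)W(x-y)\chi_B(y),\qquad w_1(x,y)=w(x,y)\,(1-\omega(x-y)).$$ For constants $b,C_{\rm kin}>0$ let $$\mathcal T=Q\big[\chi_B(-\Delta-C_{\rm kin}\ell^{-2})_+\chi_B+b\ell^{-2}\big]Q$$ and let $\mathcal H_B(\rho_\mu)$ be the particle-number preserving operator on the symmetric Fock space over $L^2(\mathbb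 R^3)$ that on $N$ particles is the self-adjoint operator defined by the quadratic form of $$\sum_{i=1}^N\Big(\mathcal T_i-\rho_\mu\int w_1(x_i,y)\,dy\Big)+\sum_{i<j}w(x_i,x_j).$$ The box energy density is $e_B(\rho_\mu)=\ell^{-3}\inf\operatorname{Spec}\mathcal H_B(\rho_\mu)\in[-\infty,0]$. **Theorem.** There is a universal constant $b_0>0$, and for every $\chi$ as above there is a constant $C_0>0$ depending only on $\chi$, such that for all constants $0<b\le b_0$ and $C_{\rm kin}\ge C_0$ in the definition of $\mathcal T$ the following holds. For all $K$, $D$, $v$, $R$ and $\rho_\mu$ as above with $$\rho_\mu aR^2\le(KD)^2$$ one has $$e_0(\rho_\mu)\ \ge\ e_B(\rho_\mu).$$ -/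

import Mathlib

open MeasureTheory Filter Topology
open scoped ENNReal FourierTransform Laplacian

namespace BoseGas

noncomputable section

/-! ### Configuration spaces -/

/-- The physical space `ℝ³` with the Euclidean norm and Lebesgue measure. -/
abbrev Space : Type := EuclideanSpace ℝ (Fin 3)

/-- The configuration space `(ℝ³)^N = ℝ^{3N}` of `N` particles. -/
abbrev Config (N : ℕ) : Type := EuclideanSpace ℝ (Fin N × Fin 3)

/-- The position `xᵢ ∈ ℝ³` of the `i`-th particle. -/
def pos {N : ℕ} (i : Fin N) (x : Config N) : Space :=
  WithLp.toLp 2 (fun k => x (i, k))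

/-- The configuration `x` with the position of the `i`-th particle replaced by `y`. -/
def replace {N : ℕ} (i : Fin N) (x : Config N) (y : Space) : Config N :=
  WithLp.toLp 2 (fun p => if p.1 = i then y p.2 else x p)

/-- Permuting the particles, as an isometry of the configuration space. -/
def permute {N : ℕ} (σ : Equiv.Perm (Fin N)) : Config N ≃ₗᵢ[ℝ] Config N :=
  LinearIsometryEquiv.piLpCongrLeft 2 ℝ ℝ (σ.prodCongr (Equiv.refl (Fin 3)))

/-- The sum of a pair interaction over all pairs `i < j`. -/
def pairSum {N : ℕ} (V : Space → Space → ℝ) (x : Config N) : ℝ :=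
  ∑ i : Fin N, ∑ j ∈ Finset.Ioi i, V (pos i x) (pos j x)

/-- A one-particle transformation `A` of functions on `ℝ³`, acting in the variable of the
`i`-th particle of an `N`-particle function. -/
def actOn {N : ℕ} (i : Fin N) (A : (Space → ℂ) → (Space → ℂ)) (Ψ : Config N → ℂ) :
    Config N → ℂ :=
  fun x => A (fun y => Ψ (replace i x y)) (pos i x)

/-! ### The symmetric Fock space over `L²(ℝ³)` -/

/-- The bosonic `N`-particle space: the elements of `L²(ℝ^{3N})` that are invariant under all
permutations of the particles. -/
def bosonic (N : ℕ) : Submodule ℂ (Lp ℂ 2 (volume : Measure (Config N))) :=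
  ⨅ σ : Equiv.Perm (Fin N),
    LinearMap.eqLocus
      (Lp.compMeasurePreservingₗ ℂ (permute σ) (permute σ).measurePreserving) LinearMap.id

/-- The symmetric Fock space: the Hilbert sum over `N` of the bosonic `N`-particle spaces. -/
abbrev Fock : Type := lp (fun N : ℕ => bosonic N) 2

/-- The function on `ℝ^{3N}` (up to null sets) of a bosonic `N`-particle vector. -/
def wave {N : ℕ} (Ψ : bosonic N) : Config N → ℂ :=
  ((Ψ : Lp ℂ 2 (volume : Measure (Config N))) : Config N → ℂ)

/-! ### `H¹₀` and the Dirichlet energy -/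

/-- `f ∈ H¹₀(Ω)` (extended by zero) with gradient `G`: there are test functions supported in `Ω`
that converge to `f` in `L²` and whose gradients converge to `G` in `L²`. -/
def IsH10 {ι : Type} [Fintype ι] [DecidableEq ι] (Ω : Set (EuclideanSpace ℝ ι))
    (f : EuclideanSpace ℝ ι → ℂ) (G : ι → EuclideanSpace ℝ ι → ℂ) : Prop :=
  MemLp f 2 volume ∧ (∀ k, MemLp (G k) 2 volume) ∧
    ∀ ε : ℝ≥0∞, 0 < ε → ∃ φ : EuclideanSpace ℝ ι → ℂ,
      ContDiff ℝ (⊤ : ℕ∞) φ ∧ HasCompactSupport φ ∧ tsupport φ ⊆ Ω ∧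
      eLpNorm (fun x => f x - φ x) 2 volume < ε ∧
      ∀ k, eLpNorm (fun x => G k x - fderiv ℝ φ x (EuclideanSpace.single k 1)) 2 volume < ε

/-- The Dirichlet energy `∫ |∇f|²` of `f ∈ H¹₀(Ω)`, and `∞` if `f` is not in `H¹₀(Ω)`.
(The gradient is unique up to null sets, so that the infimum is over one value.) -/
def dirichletEnergy {ι : Type} [Fintype ι] [DecidableEq ι] (Ω : Set (EuclideanSpace ℝ ι))
    (f : EuclideanSpace ℝ ι → ℂ) : ℝ≥0∞ :=
  ⨅ (G : ι → EuclideanSpace ℝ ι → ℂ) (_ : IsH10 Ω f G), ∑ k, ∫⁻ x, ‖G k x‖ₑ ^ 2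

/-! ### The potential, its scattering length and its scattering solution -/

/-- `v` is non-negative, spherically symmetric and integrable, and vanishes outside the ball of
radius `R > 0`. -/
structure IsPotential (v : Space → ℝ) (R : ℝ) : Prop where
  nonneg : ∀ x, 0 ≤ v x
  radial : ∀ x y, ‖x‖ = ‖y‖ → v x = v y
  integrable : Integrable v
  radius_pos : 0 < R
  range : ∀ x, R < ‖x‖ → v x = 0

/-- The infimum of `∫_{|x| ≤ R'} |∇φ|² + ½ v |φ|²` over the `φ ∈ H¹(B(0,R'))` that are equal to `1`
on the sphere `|x| = R'`, that is, `φ = 1 + ψ` with `ψ ∈ H¹₀(B(0,R'))`. -/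
def scatteringEnergy (v : Space → ℝ) (R' : ℝ) : ℝ :=
  (⨅ ψ : Space → ℂ, dirichletEnergy (Metric.ball (0 : Space) R') ψ +
    ∫⁻ x in Metric.closedBall (0 : Space) R', ENNReal.ofReal (v x / 2) * ‖1 + ψ x‖ₑ ^ 2).toReal

/-- The scattering length, computed in the ball of radius `R'` (any `R'` larger than the range of
`v`): the solution `a` of `4πa / (1 - a/R') = scatteringEnergy v R'`. -/
def scatteringLength (v : Space → ℝ) (R' : ℝ) : ℝ :=
  scatteringEnergy v R' / (4 * Real.pi + scatteringEnergy v R' / R')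

/-- The defining equation of the scattering length. -/
theorem scatteringLength_spec (v : Space → ℝ) (R' : ℝ) (hR : 0 < R') :
    4 * Real.pi * scatteringLength v R' / (1 - scatteringLength v R' / R') =
      scatteringEnergy v R' := by
  have hE : 0 ≤ scatteringEnergy v R' := ENNReal.toReal_nonneg
  unfold scatteringLength
  generalize scatteringEnergy v R' = E at hE
  have hpi := Real.pi_pos
  have h1 : 0 < 4 * Real.pi + E / R' := by positivity
  have h2 : 1 - E / (4 * Real.pi + E / R') / R' = 4 * Real.pi / (4 * Real.pi + E / R') := by
    have h3 : 4 * Real.pi * R' + E ≠ 0 := by positivity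
    field_simp
    ring
  rw [h2]
  field_simp

/-- `ω` is the scattering solution of `v`: `(-Δ + ½v)(1 - ω) = 0` in the sense of distributions
on `ℝ³`, and `ω(x) → 0` as `|x| → ∞`. -/
structure IsScatteringSolution (v ω : Space → ℝ) : Prop where
  locallyIntegrable : LocallyIntegrable ω
  locallyIntegrable_mul : LocallyIntegrable (fun x => v x * (1 - ω x))
  equation : ∀ φ : Space → ℝ, ContDiff ℝ (⊤ : ℕ∞) φ → HasCompactSupport φ →
    ∫ x, (1 - ω x) * (-(Δ φ x) + v x / 2 * φ x) = 0
  decay : Tendsto ω (cocompact Space) (𝓝 0)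

/-- The function `g = v (1 - ω)`. -/
def scatteringG (v ω : Space → ℝ) (x : Space) : ℝ := v x * (1 - ω x)

/-! ### The grand-canonical background Hamiltonian and its energy density -/

/-- The interior of `Λ^N`, where `Λ = [-L/2, L/2]³`. -/
def openBox (N : ℕ) (L : ℝ) : Set (Config N) := {x | ∀ p, |x p| < L / 2}

/-- The expectation in `Ψ` of the kinetic energy with Dirichlet boundary conditions on `Λ` plus the
pair interaction energy; it is `∞` if `Ψ` is not in the form domain. -/
def kineticPotential (v : Space → ℝ) (L : ℝ) (Ψ : Fock) : ℝ≥0∞ :=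
  ∑' N : ℕ, (dirichletEnergy (openBox N L) (wave (Ψ N)) +
    ∫⁻ x : Config N, ENNReal.ofReal (pairSum (fun y z => v (y - z)) x) * ‖wave (Ψ N) x‖ₑ ^ 2)

/-- The expectation in `Ψ` of the particle number. -/
def particleNumber (Ψ : Fock) : ℝ≥0∞ := ∑' N : ℕ, (N : ℝ≥0∞) * ‖Ψ N‖ₑ ^ 2

/-- The infimum of `⟨Ψ, ℋ Ψ⟩ / ‖Ψ‖²` over the non-zero Fock space vectors of finite energy, where
on `N` particles in `Λ = [-L/2, L/2]³`
`ℋ = ∑ᵢ (-Δᵢ - ρ ∫ g(xᵢ - y) dy) + ∑_{i<j} v(xᵢ - xⱼ)`. -/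
def backgroundEnergy (v ω : Space → ℝ) (ρ L : ℝ) : EReal :=
  ⨅ (Ψ : Fock) (_ : Ψ ≠ 0) (_ : kineticPotential v L Ψ ≠ ⊤) (_ : particleNumber Ψ ≠ ⊤),
    ((((kineticPotential v L Ψ).toReal
      - ρ * (∫ y, scatteringG v ω y) * (particleNumber Ψ).toReal) / ‖Ψ‖ ^ 2 : ℝ) : EReal)

/-- The thermodynamic ground state energy density: the (lower) limit as `L → ∞` of the ground state
energy divided by the volume `L³`. -/
def backgroundEnergyDensity (v ω : Space → ℝ) (ρ : ℝ) : EReal :=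
  liminf (fun L : ℝ => (((L ^ 3)⁻¹ : ℝ) : EReal) * backgroundEnergy v ω ρ L) atTop

/-! ### The localized Hamiltonian -/

/-- The cube `[-s/2, s/2]³`. -/
def cube (s : ℝ) : Set Space := {x | ∀ k, |x k| ≤ s / 2}

/-- `χ` is a localization function: smooth, even, non-negative, supported in `[-1/2, 1/2]³`, and
normalized in `L²`. -/
structure IsLocalization (χ : Space → ℝ) : Prop where
  smooth : ContDiff ℝ (⊤ : ℕ∞) χ
  even : ∀ x, χ (-x) = χ x
  nonneg : ∀ x, 0 ≤ χ x
  integral_sq : ∫ x, χ x ^ 2 = 1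
  supp : tsupport χ ⊆ cube 1

/-- The convolution `χ * χ`. -/
def selfConv (χ : Space → ℝ) (x : Space) : ℝ := ∫ y, χ y * χ (x - y)

/-- The data that enter the localized Hamiltonian: the localization function `χ`, the potential
`v`, its scattering solution `ω`, the side length `ℓ` of the box, the constants `b` and `c = C_kin`
of the localized kinetic energy, and the density parameter `ρ`. -/
structure BoxData where
  χ : Space → ℝ
  v : Space → ℝ
  ω : Space → ℝ
  ℓ : ℝ
  b : ℝ
  c : ℝ
  ρ : ℝ

namespace BoxData

variable (S : BoxData)

/-- The localization function `χ_B(x) = χ(x/ℓ)` of the box `B = [-ℓ/2, ℓ/2]³`. -/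
def chiB (x : Space) : ℝ := S.χ (S.ℓ⁻¹ • x)

/-- The indicator function `θ` of the box `B`. -/
def theta (x : Space) : ℂ := (cube S.ℓ).indicator (fun _ => 1) x

/-- The projection `Q φ = θ φ - ℓ⁻³ ⟨θ, φ⟩ θ`. -/
def projQ (φ : Space → ℂ) : Space → ℂ :=
  fun x => S.theta x * φ x - ((S.ℓ ^ 3)⁻¹ : ℝ) * (∫ y, S.theta y * φ y) * S.theta x

/-- The function `φ ↦ 𝓕 (χ_B Q φ)`. -/
def fourierChiQ (φ : Space → ℂ) : Space → ℂ :=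
  𝓕 (fun x => (S.chiB x : ℂ) * S.projQ φ x)

/-- The Fourier multiplier of `(-Δ - C_kin ℓ⁻²)₊`; with the kernel `exp (-2πi⟨x, ξ⟩)` of the Fourier
transform, `-Δ` has the multiplier `4π²|ξ|²`. -/
def multiplier (ξ : Space) : ℝ := max (4 * Real.pi ^ 2 * ‖ξ‖ ^ 2 - S.c * (S.ℓ ^ 2)⁻¹) 0

/-- `W(x) = v(x) / (χ * χ)(x/ℓ)`. -/
def W (x : Space) : ℝ := S.v x / selfConv S.χ (S.ℓ⁻¹ • x)

/-- `w(x,y) = χ_B(x) W(x-y) χ_B(y)`. -/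
def w (x y : Space) : ℝ := S.chiB x * S.W (x - y) * S.chiB y

/-- `w₁(x,y) = w(x,y) (1 - ω(x-y))`. -/
def w₁ (x y : Space) : ℝ := S.w x y * (1 - S.ω (x - y))

/-- The potential energy `𝒲(x) = ∑ᵢ -ρ ∫ w₁(xᵢ,y) dy + ∑_{i<j} w(xᵢ,xⱼ)`. -/
def potential {N : ℕ} (x : Config N) : ℝ :=
  (∑ i : Fin N, -S.ρ * ∫ y, S.w₁ (pos i x) y) + pairSum S.w x

/-- The form domain of the `N`-particle box Hamiltonian: `(-Δ - C_kin ℓ⁻²)₊^{1/2} χ_B Q` may be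
applied in each variable, and the interaction energy is finite. -/
def formDomain (N : ℕ) : Set (bosonic N) :=
  {Ψ | (∀ i : Fin N, ∫⁻ x : Config N, ENNReal.ofReal (S.multiplier (pos i x)) *
          ‖actOn i S.fourierChiQ (wave Ψ) x‖ₑ ^ 2 < ⊤) ∧
      ∫⁻ x : Config N, ENNReal.ofReal (pairSum S.w x) * ‖wave Ψ x‖ₑ ^ 2 < ⊤}

/-- The sesquilinear form `⟨Φ, (∑ᵢ 𝒯ᵢ + 𝒲) Ψ⟩` of the `N`-particle box Hamiltonian, where
`𝒯 = Q [χ_B (-Δ - C_kin ℓ⁻²)₊ χ_B + b ℓ⁻²] Q`. -/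
def form {N : ℕ} (Φ Ψ : bosonic N) : ℂ :=
  (∑ i : Fin N,
    ((∫ x : Config N, (S.multiplier (pos i x) : ℂ) *
        starRingEnd ℂ (actOn i S.fourierChiQ (wave Φ) x) * actOn i S.fourierChiQ (wave Ψ) x) +
      ((S.b * (S.ℓ ^ 2)⁻¹ : ℝ) : ℂ) * ∫ x : Config N,
        starRingEnd ℂ (actOn i S.projQ (wave Φ) x) * actOn i S.projQ (wave Ψ) x)) +
  ∫ x : Config N, (S.potential x : ℂ) * starRingEnd ℂ (wave Φ x) * wave Ψ x

/-- The graph of the self-adjoint operator of the form on `N` particles: `Ψ` is in its domain and is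
mapped to `f` iff `Ψ` is in the form domain and the form is `Φ ↦ ⟨Φ, f⟩` at `Ψ`. -/
def sectorGraph (N : ℕ) : Set (bosonic N × bosonic N) :=
  {p | p.1 ∈ S.formDomain N ∧ ∀ Φ ∈ S.formDomain N, S.form Φ p.1 = inner ℂ Φ p.2}

/-- The graph of the box Hamiltonian on the Fock space, which preserves the particle number. -/
def hamiltonianGraph : Set (Fock × Fock) :=
  {p | ∀ N : ℕ, (p.1 N, p.2 N) ∈ S.sectorGraph N}

end BoxData

/-- The spectrum of the operator with graph `T`: the complex `z` such that `T - z` has no bounded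
everywhere defined inverse. -/
def graphSpectrum {H : Type} [NormedAddCommGroup H] [InnerProductSpace ℂ H] (T : Set (H × H)) :
    Set ℂ :=
  {z | ¬ ∃ A : H →L[ℂ] H,
    (∀ f, (A f, f + z • A f) ∈ T) ∧ ∀ p ∈ T, A (p.2 - z • p.1) = p.1}

/-- The box energy: the bottom of the spectrum of the box Hamiltonian. -/
def boxEnergy (S : BoxData) : EReal :=
  ⨅ (t : ℝ) (_ : (t : ℂ) ∈ graphSpectrum S.hamiltonianGraph), (t : EReal)

/-- The box energy density. -/
def boxEnergyDensity (S : BoxData) : EReal := (((S.ℓ ^ 3)⁻¹ : ℝ) : EReal) * boxEnergy S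

/-- The side length `ℓ = K (ρ a)^{-1/2}` of the box. -/
def boxLength (K ρ a : ℝ) : ℝ := K * (ρ * a) ^ (-(1 / 2) : ℝ)

end

end BoseGas

/-!
The proof is a sliding localization: the large box `Λ = [-L/2, L/2]³` is covered by all the
translates `u + B`, `u ∈ ℝ³`, of the small box `B`, and the Hamiltonian in `Λ` is compared with
the average over `u` of the box Hamiltonians in `u + B`.

* Averaging the pair interaction `w` replaces `χ_B(x) χ_B(y)` by `ℓ³ (χ * χ)((x - y)/ℓ)`, which
  the denominator of `W` cancels, so that `ℓ³ v` remains (`BoxData.lintegral_w_translate`). This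
  is where `ρ a R² ≤ (K D)²` enters: it says `R ≤ D ℓ`, so that `χ * χ ≥ 1/2` on the support of
  `v`. In the same way, averaging the one-body potential `∫ w₁(x, y) dy` gives `ℓ³ ∫ g`
  (`BoxData.integral_background`).

* The average of the localized kinetic energy `𝒯` is translation invariant, hence a Fourier
  multiplier. By Plancherel's theorem in the translation parameter it is, with `X` and `T` the
  Fourier transforms of `χ` and of the indicator function of the unit cube, `ℓ³` times the
  multiplier `ℓ⁻² (∫ (4π²|q|² - C_kin)₊ |X(q - ℓp) - X(q) T(-ℓp)|² dq + b (1 - |T(-ℓp)|²))`, and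
  it has to be shown that this is at most `ℓ³ 4π²|p|²` (`multiplier_unit_le`). If `16π²|ℓp|² ≤
  C_kin`, the integrand lives at momenta where `X` and its gradient are small, and the difference
  provides the factor `|ℓp|²`. If `16π²|ℓp|² ≥ C_kin`, the integral is at most `4π²|ℓp|² + A -
  C_kin/8` with `A` depending on `χ` only: the cutoff gains a multiple of `C_kin` and pays for all
  errors. The bound passes from test functions to `H¹₀` by Fatou's lemma
  (`BoxData.lintegral_kineticDensity_le`).

On the operator side, if no `t < t₀` is in the spectrum of the box Hamiltonian, then its quadratic
form is at least `t₀` in every sector (`form_ge_of_resolvent`). The form is bounded from below on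
a fixed number of particles because `w ≥ 0` and the one-body potential is bounded, so that the
existence of a bounded resolvent at the infimum of the form contradicts minimality directly, and
no spectral theorem is needed.

An `N`-particle function supported in `Λ` only meets boxes with `u ∈ [-(L+ℓ)/2, (L+ℓ)/2]³`.
Integrating the box inequality over these `u` bounds the energy in `Λ` from below by `ℓ⁻³ (L + ℓ)³
t₀` (`BoxData.mul_le_backgroundEnergy`). Division by `L³` and `L → ∞` give the theorem.
-/

namespace BoseGas
open SchwartzMap Real

/-! ### Plancherel's theorem -/

theorem lintegral_enorm_sq_eq_ofReal {α E : Type*} [MeasurableSpace α] {μ : Measure α}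
    [NormedAddCommGroup E] {f : α → E} (hf : Integrable (fun x => ‖f x‖ ^ 2) μ) :
    ∫⁻ x, ‖f x‖ₑ ^ 2 ∂μ = ENNReal.ofReal (∫ x, ‖f x‖ ^ 2 ∂μ) := by
  rw [ofReal_integral_eq_lintegral_ofReal hf (Eventually.of_forall fun x => by positivity)]
  refine lintegral_congr fun x => ?_
  rw [ENNReal.ofReal_pow (norm_nonneg _), ofReal_norm]

theorem eLpNorm_two_sq {α E : Type*} [MeasurableSpace α] [NormedAddCommGroup E] (μ : Measure α)
    (f : α → E) : eLpNorm f 2 μ ^ 2 = ∫⁻ x, ‖f x‖ₑ ^ 2 ∂μ := by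
  rw [eLpNorm_eq_lintegral_rpow_enorm_toReal (by norm_num) (by norm_num)]
  simp only [ENNReal.toReal_ofNat, ENNReal.rpow_ofNat]
  rw [← ENNReal.rpow_natCast, ← ENNReal.rpow_mul]
  norm_num

theorem integrable_norm_sq_schwartz (f : 𝓢(Space, ℂ)) (k : ℕ) :
    Integrable (fun x => ‖x‖ ^ k * ‖f x‖ ^ 2) := by
  obtain ⟨M, hM⟩ : ∃ M : ℝ, ∀ x, ‖f x‖ ≤ M := by
    obtain ⟨M, -, hM⟩ := f.decay 0 0
    exact ⟨M, fun x => by simpa using hM x⟩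
  refine ((f.integrable_pow_mul volume k).const_mul M).mono' (by fun_prop) ?_
  refine Eventually.of_forall fun x => ?_
  rw [Real.norm_of_nonneg (by positivity)]
  nlinarith [mul_le_mul_of_nonneg_left (hM x) (show 0 ≤ ‖x‖ ^ k * ‖f x‖ by positivity)]

/-- Plancherel's theorem for Schwartz functions, with values in `[0, ∞]`. -/
theorem lintegral_fourier_schwartz (f : 𝓢(Space, ℂ)) :
    ∫⁻ p, ‖𝓕 (f : Space → ℂ) p‖ₑ ^ 2 = ∫⁻ x, ‖f x‖ₑ ^ 2 := by
  have h1 : Integrable fun x => ‖f x‖ ^ 2 := by simpa using integrable_norm_sq_schwartz f 0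
  have h2 : Integrable fun x => ‖(𝓕 f) x‖ ^ 2 := by
    simpa using integrable_norm_sq_schwartz (𝓕 f) 0
  rw [← SchwartzMap.fourier_coe, lintegral_enorm_sq_eq_ofReal h1, lintegral_enorm_sq_eq_ofReal h2,
    integral_norm_sq_fourier]

/-- The Fourier transform turns the correlation with a compactly supported kernel into a product, so
that its square norm is computed by Plancherel's theorem. -/
theorem lintegral_correlation {f κ : Space → ℂ} (hf : ContDiff ℝ (⊤ : ℕ∞) f)
    (hfc : HasCompactSupport f) (hκ : Integrable κ) (hκc : HasCompactSupport κ) :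
    ∫⁻ u, ‖∫ x, κ x * f (x + u)‖ₑ ^ 2 = ∫⁻ p, ‖𝓕 κ (-p)‖ₑ ^ 2 * ‖𝓕 f p‖ₑ ^ 2 := by
  set κ' : Space → ℂ := fun x => κ (-x) with hκ'
  have hκ'i : Integrable κ' := hκ.comp_neg
  have hκ'c : HasCompactSupport κ' := hκc.comp_homeomorph (Homeomorph.neg Space)
  set h : Space → ℂ := MeasureTheory.convolution κ' f (ContinuousLinearMap.mul ℂ ℂ) volume with hh
  have hval : ∀ u, ∫ x, κ x * f (x + u) = h u := by
    intro u
    rw [hh, MeasureTheory.convolution, ← integral_neg_eq_self]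
    refine integral_congr_ae (Eventually.of_forall fun x => ?_)
    simp [hκ', sub_eq_add_neg, add_comm]
  have hsm : ContDiff ℝ (⊤ : ℕ∞) h :=
    hfc.contDiff_convolution_right (ContinuousLinearMap.mul ℝ ℂ) hκ'i.locallyIntegrable hf
  have hcs : HasCompactSupport h := hκ'c.convolution _ hfc
  have hfi : Integrable f := hf.continuous.integrable_of_hasCompactSupport hfc
  have hF : ∀ p, 𝓕 h p = 𝓕 κ (-p) * 𝓕 f p := by
    intro p
    rw [hh, Real.fourier_mul_convolution_eq hκ'i hfi]
    congr 1
    rw [Real.fourier_eq, Real.fourier_eq, ← integral_neg_eq_self]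
    simp [hκ']
  calc ∫⁻ u, ‖∫ x, κ x * f (x + u)‖ₑ ^ 2 = ∫⁻ u, ‖(hcs.toSchwartzMap hsm) u‖ₑ ^ 2 := by
        simp only [hval]; rfl
    _ = ∫⁻ p, ‖𝓕 h p‖ₑ ^ 2 := (lintegral_fourier_schwartz _).symm
    _ = _ := by simp only [hF, enorm_mul, mul_pow]

/-- The Dirichlet energy of a test function in Fourier space. -/
theorem lintegral_gradient {f : Space → ℂ} (hf : ContDiff ℝ (⊤ : ℕ∞) f)
    (hfc : HasCompactSupport f) :
    ∑ k, ∫⁻ x, ‖fderiv ℝ f x (EuclideanSpace.single k 1)‖ₑ ^ 2 =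
      ∫⁻ p, ENNReal.ofReal (4 * π ^ 2 * ‖p‖ ^ 2) * ‖𝓕 f p‖ₑ ^ 2 := by
  set F := hfc.toSchwartzMap hf with hF
  have hFc : (F : Space → ℂ) = f := rfl
  have key : ∀ k : Fin 3, ∫⁻ x, ‖fderiv ℝ f x (EuclideanSpace.single k 1)‖ₑ ^ 2 =
      ∫⁻ p, ENNReal.ofReal (4 * π ^ 2 * p k ^ 2) * ‖𝓕 f p‖ₑ ^ 2 := by
    intro k
    set m : Space := EuclideanSpace.single k 1 with hm
    have h1 : ∀ x, fderiv ℝ f x m = (LineDeriv.lineDerivOp m F) x := by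
      intro x
      rw [SchwartzMap.lineDerivOp_apply_eq_fderiv]; rfl
    simp only [h1]
    rw [← lintegral_fourier_schwartz, ← SchwartzMap.fourier_coe, SchwartzMap.fourier_lineDerivOp_eq]
    refine lintegral_congr fun p => ?_
    have : (inner ℝ · m).HasTemperateGrowth := ((innerSL ℝ).flip m).hasTemperateGrowth
    have h2 : ((2 * π * Complex.I) • smulLeftCLM ℂ (inner ℝ · m) (𝓕 F)) p
        = (2 * π * Complex.I) * ((p k : ℂ) * 𝓕 f p) := by
      rw [smul_apply, SchwartzMap.smulLeftCLM_apply_apply this,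
        SchwartzMap.fourier_coe, hFc]
      simp [hm, EuclideanSpace.inner_single_right]
    rw [h2, ← mul_assoc, enorm_mul, mul_pow]
    congr 1
    rw [← ofReal_norm, ← ENNReal.ofReal_pow (norm_nonneg _)]
    congr 1
    simp only [norm_mul, Complex.norm_ofNat, Complex.norm_real, Complex.norm_I, Real.norm_eq_abs,
      mul_pow, sq_abs]
    norm_num
  simp only [key]
  rw [← lintegral_finsetSum']
  · refine lintegral_congr fun p => ?_
    rw [← Finset.sum_mul]
    congr 1
    rw [EuclideanSpace.real_norm_sq_eq, Finset.mul_sum,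
      ENNReal.ofReal_sum_of_nonneg fun _ _ => by positivity]
  · intro k _
    have : Continuous (𝓕 f) := by
      have : 𝓕 f = ((𝓕 F : 𝓢(Space, ℂ)) : Space → ℂ) := by rw [SchwartzMap.fourier_coe, hFc]
      rw [this]; exact (𝓕 F).continuous
    have h3 : Continuous fun p : Space => 4 * π ^ 2 * p k ^ 2 := by fun_prop
    exact (h3.measurable.ennreal_ofReal.mul (this.enorm.measurable.pow_const 2)).aemeasurable

/-! ### The Fourier multiplier estimate -/

/-- If `‖p‖²` is at least comparable to the cutoff `c`, subtracting `c` gains a multiple of `c`,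
which pays for all the errors of the localization. -/
theorem lintegral_multiplier_high (X : 𝓢(Space, ℂ)) (hX : ∫ q, ‖X q‖ ^ 2 = 1)
    (heven : ∀ q, ‖X (-q)‖ = ‖X q‖) :
    ∃ A : ℝ, 0 ≤ A ∧ ∀ (c : ℝ) (p : Space) (T : ℂ), 0 ≤ c → ‖T‖ ≤ 1 → c ≤ 16 * π ^ 2 * ‖p‖ ^ 2 →
      ∫⁻ q, ENNReal.ofReal (max (4 * π ^ 2 * ‖q‖ ^ 2 - c) 0) * ‖X (q - p) - X q * T‖ₑ ^ 2 ≤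
        ENNReal.ofReal (4 * π ^ 2 * ‖p‖ ^ 2 + A - c / 8) := by
  obtain ⟨S, hS0, hS⟩ : ∃ S : ℝ, 0 < S ∧ ∀ x, ‖X x‖ ≤ S := by
    obtain ⟨M, hM0, hM⟩ := X.decay 0 0
    exact ⟨M, hM0, fun x => by simpa using hM x⟩
  have hi2 := integrable_norm_sq_schwartz X 2
  have hi0 : Integrable fun q => ‖X q‖ ^ 2 := by simpa using integrable_norm_sq_schwartz X 0
  have hj := X.integrable_pow_mul volume 2
  set A := 8 * π ^ 2 * (∫ r, ‖r‖ ^ 2 * ‖X r‖ ^ 2) + 12 * π ^ 2 * S * ∫ q, ‖q‖ ^ 2 * ‖X q‖ with hA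
  refine ⟨A, by positivity, fun c p T hc hT hp => ?_⟩
  have hi1 : Integrable fun r => inner ℝ r p * ‖X r‖ ^ 2 := by
    refine ((integrable_norm_sq_schwartz X 1).const_mul ‖p‖).mono' (by fun_prop) ?_
    refine Eventually.of_forall fun r => ?_
    rw [norm_mul, Real.norm_of_nonneg (sq_nonneg ‖X r‖), pow_one, ← mul_assoc, mul_comm ‖p‖]
    exact mul_le_mul_of_nonneg_right (norm_inner_le_norm _ _) (sq_nonneg _)
  -- the term linear in `p` vanishes by symmetry, so that `‖p‖²` keeps the constant `4π²`
  have hodd : ∫ r, inner ℝ r p * ‖X r‖ ^ 2 = 0 := by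
    have h := integral_neg_eq_self (fun r => inner ℝ r p * ‖X r‖ ^ 2) (volume : Measure Space)
    simp only [heven, inner_neg_left, neg_mul, integral_neg] at h
    linarith
  set H₁ : Space → ℝ := fun r => 8 * π ^ 2 * (‖r‖ ^ 2 * ‖X r‖ ^ 2) +
    8 * π ^ 2 * (inner ℝ r p * ‖X r‖ ^ 2) + (4 * π ^ 2 * ‖p‖ ^ 2 - c / 8) * ‖X r‖ ^ 2 with hH₁
  set H₂ : Space → ℝ := fun q => 12 * π ^ 2 * S * (‖q‖ ^ 2 * ‖X q‖) with hH₂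
  have hH₁i : Integrable H₁ :=
    ((hi2.const_mul _).add (hi1.const_mul _)).add (hi0.const_mul _)
  have hH₂i : Integrable H₂ := hj.const_mul _
  have hbound : ∀ q, max (4 * π ^ 2 * ‖q‖ ^ 2 - c) 0 * ‖X (q - p) - X q * T‖ ^ 2 ≤
      H₁ (q - p) + H₂ q := by
    intro q
    set r := q - p with hr
    have hq : ‖q‖ ^ 2 = ‖r‖ ^ 2 + 2 * inner ℝ r p + ‖p‖ ^ 2 := by
      rw [show q = r + p by simp [hr], norm_add_sq_real]
    have hpq : ‖p‖ ^ 2 ≤ 2 * ‖q‖ ^ 2 + 2 * ‖r‖ ^ 2 := by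
      have : ‖p‖ ≤ ‖q‖ + ‖r‖ := by
        rw [show p = q - r by simp [hr]]; exact norm_sub_le _ _
      nlinarith [norm_nonneg p, sq_nonneg (‖q‖ - ‖r‖)]
    have hpi : 0 < π ^ 2 := by positivity
    -- where the maximum is `0`, the bound `c ≤ 16π²‖p‖²` keeps the right-hand side non-negative
    have h1 : max (4 * π ^ 2 * ‖q‖ ^ 2 - c) 0 ≤
        4 * π ^ 2 * ‖q‖ ^ 2 - c / 8 + 4 * π ^ 2 * ‖r‖ ^ 2 := by
      apply max_le
      · nlinarith [sq_nonneg ‖r‖]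
      · nlinarith [mul_le_mul_of_nonneg_left hpq hpi.le]
    have h1' : max (4 * π ^ 2 * ‖q‖ ^ 2 - c) 0 ≤ 4 * π ^ 2 * ‖q‖ ^ 2 := by
      apply max_le
      · linarith
      · positivity
    have h2 : ‖X r - X q * T‖ ^ 2 ≤ ‖X r‖ ^ 2 + 3 * S * ‖X q‖ := by
      have h3 : ‖X r - X q * T‖ ≤ ‖X r‖ + ‖X q‖ := by
        refine (norm_sub_le _ _).trans ?_
        rw [norm_mul]
        nlinarith [norm_nonneg (X q)]
      have h4 := hS r
      have h5 := hS q
      have h6 := norm_nonneg (X q)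
      have h7 := norm_nonneg (X r)
      calc ‖X r - X q * T‖ ^ 2 ≤ (‖X r‖ + ‖X q‖) ^ 2 :=
            pow_le_pow_left₀ (norm_nonneg _) h3 2
        _ ≤ _ := by nlinarith [mul_nonneg h6 (sub_nonneg.2 h4), mul_nonneg h6 (sub_nonneg.2 h5)]
    have h0 : 0 ≤ max (4 * π ^ 2 * ‖q‖ ^ 2 - c) 0 := le_max_right _ _
    calc max (4 * π ^ 2 * ‖q‖ ^ 2 - c) 0 * ‖X r - X q * T‖ ^ 2
        ≤ max (4 * π ^ 2 * ‖q‖ ^ 2 - c) 0 * (‖X r‖ ^ 2 + 3 * S * ‖X q‖) :=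
          mul_le_mul_of_nonneg_left h2 h0
      _ = max (4 * π ^ 2 * ‖q‖ ^ 2 - c) 0 * ‖X r‖ ^ 2 +
          max (4 * π ^ 2 * ‖q‖ ^ 2 - c) 0 * (3 * S * ‖X q‖) := by ring
      _ ≤ (4 * π ^ 2 * ‖q‖ ^ 2 - c / 8 + 4 * π ^ 2 * ‖r‖ ^ 2) * ‖X r‖ ^ 2 +
          4 * π ^ 2 * ‖q‖ ^ 2 * (3 * S * ‖X q‖) := by gcongr
      _ = H₁ r + H₂ q := by
          simp only [hH₁, hH₂]; rw [hq]; ring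
  have hint : Integrable fun q => H₁ (q - p) + H₂ q := (hH₁i.comp_sub_right p).add hH₂i
  have hval : ∫ q, (H₁ (q - p) + H₂ q) = 4 * π ^ 2 * ‖p‖ ^ 2 + A - c / 8 := by
    have h12 : Integrable fun r => 8 * π ^ 2 * (‖r‖ ^ 2 * ‖X r‖ ^ 2) +
        8 * π ^ 2 * (inner ℝ r p * ‖X r‖ ^ 2) := (hi2.const_mul _).add (hi1.const_mul _)
    have hH₁v : ∫ r, H₁ r = 8 * π ^ 2 * (∫ r, ‖r‖ ^ 2 * ‖X r‖ ^ 2) +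
        (4 * π ^ 2 * ‖p‖ ^ 2 - c / 8) := by
      refine (integral_add h12 (hi0.const_mul _)).trans ?_
      rw [integral_add (hi2.const_mul _) (hi1.const_mul _)]
      simp only [integral_const_mul, hodd, hX]
      ring
    rw [integral_add (hH₁i.comp_sub_right p) hH₂i, integral_sub_right_eq_self, hH₁v,
      integral_const_mul, hA]
    ring
  rw [← hval, ofReal_integral_eq_lintegral_ofReal hint
    (Eventually.of_forall fun q => le_trans (by positivity) (hbound q))]
  refine lintegral_mono fun q => ?_
  rw [← ofReal_norm, ← ENNReal.ofReal_pow (norm_nonneg _),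
    ← ENNReal.ofReal_mul (le_max_right _ _)]
  exact ENNReal.ofReal_le_ofReal (hbound q)

/-- If `‖p‖²` is small compared to the cutoff `c`, only the tails of `X` and of its derivative
contribute, and the difference in the integrand supplies the factor `‖p‖`. -/
theorem lintegral_multiplier_low (X : 𝓢(Space, ℂ)) :
    ∃ M : ℝ, 0 ≤ M ∧ ∀ (c : ℝ) (p : Space) (T : ℂ), 0 < c → ‖1 - T‖ ≤ 6 * ‖p‖ →
      16 * π ^ 2 * ‖p‖ ^ 2 ≤ c →
      ∫⁻ q, ENNReal.ofReal (max (4 * π ^ 2 * ‖q‖ ^ 2 - c) 0) * ‖X (q - p) - X q * T‖ₑ ^ 2 ≤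
        ENNReal.ofReal (M / c * ‖p‖ ^ 2) := by
  obtain ⟨M, hM0, hM1, hM2⟩ : ∃ M : ℝ, 0 ≤ M ∧ (∀ x, (1 + ‖x‖) ^ 4 * ‖X x‖ ≤ M) ∧
      ∀ x, (1 + ‖x‖) ^ 4 * ‖fderiv ℝ X x‖ ≤ M := by
    have h := fun (n : ℕ) (hn : n ≤ 1) => SchwartzMap.one_add_le_sup_seminorm_apply (𝕜 := ℝ)
      (m := (4, 1)) (k := 4) (n := n) (le_refl _) hn X
    refine ⟨_, le_trans (by positivity) (h 0 (by simp) 0), fun x => ?_, fun x => ?_⟩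
    · simpa using h 0 (by simp) x
    · have := h 1 (le_refl _) x
      rwa [norm_iteratedFDeriv_one] at this
  have hJ : Integrable fun q : Space => (1 + ‖q‖) ^ (-4 : ℝ) :=
    integrable_one_add_norm (by simp; norm_num)
  refine ⟨16 * π ^ 4 * (22 * M) ^ 2 * ∫ q : Space, (1 + ‖q‖) ^ (-4 : ℝ), ?_, ?_⟩
  · exact mul_nonneg (by positivity) (integral_nonneg fun q => by positivity)
  intro c p T hc hT hp
  have hbound : ∀ q, max (4 * π ^ 2 * ‖q‖ ^ 2 - c) 0 * ‖X (q - p) - X q * T‖ ^ 2 ≤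
      16 * π ^ 4 * (22 * M) ^ 2 / c * ‖p‖ ^ 2 * (1 + ‖q‖) ^ (-4 : ℝ) := by
    intro q
    rcases le_total (4 * π ^ 2 * ‖q‖ ^ 2 - c) 0 with h | h
    · rw [max_eq_right h, zero_mul]; positivity
    have hpi : 0 < π ^ 2 := by positivity
    -- the ball of radius `‖p‖` around `q` stays away from the origin, where `X` is not small
    have hpq : ‖p‖ ≤ ‖q‖ / 2 := by
      refine abs_le_of_sq_le_sq' ?_ (by positivity) |>.2
      have : π ^ 2 * (16 * ‖p‖ ^ 2) ≤ π ^ 2 * (4 * ‖q‖ ^ 2) := by linarith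
      have := le_of_mul_le_mul_left this hpi
      linarith
    have hder : ∀ y ∈ Metric.closedBall q ‖p‖, ‖fderiv ℝ X y‖ ≤ 16 * M / (1 + ‖q‖) ^ 4 := by
      intro y hy
      have hy' : ‖q‖ / 2 ≤ ‖y‖ := by
        have h1 : ‖y - q‖ ≤ ‖p‖ := by rwa [← dist_eq_norm]
        have h2 : ‖q‖ ≤ ‖y‖ + ‖y - q‖ := by
          have := norm_sub_le y (y - q); rwa [sub_sub_cancel] at this
        linarith
      rw [le_div_iff₀ (by positivity)]
      have h3 : (1 + ‖q‖) ^ 4 ≤ 16 * (1 + ‖y‖) ^ 4 := by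
        have : (1 + ‖q‖) ^ 4 ≤ (2 * (1 + ‖y‖)) ^ 4 :=
          pow_le_pow_left₀ (by positivity) (by linarith) 4
        calc _ ≤ _ := this
          _ = _ := by ring
      nlinarith [hM2 y, mul_le_mul_of_nonneg_right h3 (norm_nonneg (fderiv ℝ X y))]
    have hdiff : ‖X (q - p) - X q‖ ≤ 16 * M / (1 + ‖q‖) ^ 4 * ‖p‖ := by
      have := (convex_closedBall q ‖p‖).norm_image_sub_le_of_norm_fderiv_le
        (fun y _ => X.differentiableAt) hder
        (Metric.mem_closedBall_self (norm_nonneg p))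
        (show q - p ∈ Metric.closedBall q ‖p‖ by simp)
      simpa using this
    have hXq : ‖X q‖ ≤ M / (1 + ‖q‖) ^ 4 := by
      rw [le_div_iff₀ (by positivity), mul_comm]; exact hM1 q
    have hg : ‖X (q - p) - X q * T‖ ≤ 22 * M / (1 + ‖q‖) ^ 4 * ‖p‖ := by
      rw [show X (q - p) - X q * T = (X (q - p) - X q) + X q * (1 - T) by ring]
      refine (norm_add_le _ _).trans ?_
      rw [norm_mul]
      have := mul_le_mul hXq hT (norm_nonneg _) (by positivity)
      calc _ ≤ 16 * M / (1 + ‖q‖) ^ 4 * ‖p‖ + M / (1 + ‖q‖) ^ 4 * (6 * ‖p‖) := by gcongr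
        _ = _ := by ring
    -- the factor `1 / c` is gained because `4π²‖q‖² ≥ c` where the maximum is not `0`
    have hm : max (4 * π ^ 2 * ‖q‖ ^ 2 - c) 0 ≤ 16 * π ^ 4 / c * (1 + ‖q‖) ^ 4 := by
      rw [max_eq_left h, div_mul_eq_mul_div, le_div_iff₀ hc]
      have h1 : ‖q‖ ^ 4 ≤ (1 + ‖q‖) ^ 4 := pow_le_pow_left₀ (norm_nonneg _) (by linarith) 4
      have h2 : (4 * π ^ 2 * ‖q‖ ^ 2 - c) * c ≤ 16 * π ^ 4 * ‖q‖ ^ 4 := by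
        nlinarith [sq_nonneg c, sq_nonneg (4 * π ^ 2 * ‖q‖ ^ 2)]
      exact h2.trans (by gcongr)
    calc _ ≤ 16 * π ^ 4 / c * (1 + ‖q‖) ^ 4 * (22 * M / (1 + ‖q‖) ^ 4 * ‖p‖) ^ 2 := by gcongr
      _ = 16 * π ^ 4 * (22 * M) ^ 2 / c * ‖p‖ ^ 2 * ((1 + ‖q‖) ^ 4)⁻¹ := by
          have : 1 + ‖q‖ ≠ 0 := by positivity
          field_simp
      _ = _ := by
          rw [Real.rpow_neg (by positivity)]; norm_cast
  rw [show 16 * π ^ 4 * (22 * M) ^ 2 * (∫ q : Space, (1 + ‖q‖) ^ (-4 : ℝ)) / c * ‖p‖ ^ 2 =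
    ∫ q : Space, 16 * π ^ 4 * (22 * M) ^ 2 / c * ‖p‖ ^ 2 * (1 + ‖q‖) ^ (-4 : ℝ) by
      rw [integral_const_mul]; ring,
    ofReal_integral_eq_lintegral_ofReal (hJ.const_mul _)
      (Eventually.of_forall fun q => by positivity)]
  refine lintegral_mono fun q => ?_
  rw [← ofReal_norm, ← ENNReal.ofReal_pow (norm_nonneg _),
    ← ENNReal.ofReal_mul (le_max_right _ _)]
  exact ENNReal.ofReal_le_ofReal (hbound q)

/-- The multiplier of the averaged localized kinetic energy, in units where the box has side length
`1`, is at most the multiplier of the Laplacian. Here `X` is the Fourier transform of the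
localization function and `T` the Fourier transform of the indicator function of the box. -/
theorem multiplier_unit_le (X : 𝓢(Space, ℂ)) (hX : ∫ q, ‖X q‖ ^ 2 = 1)
    (heven : ∀ q, ‖X (-q)‖ = ‖X q‖) :
    ∃ C₀ : ℝ, 0 < C₀ ∧ ∀ (b c : ℝ) (p : Space) (T : ℂ), 0 ≤ b → b ≤ 1 / 2 → C₀ ≤ c →
      ‖T‖ ≤ 1 → ‖1 - T‖ ≤ 6 * ‖p‖ → 1 - ‖T‖ ^ 2 ≤ 3 * π ^ 2 * ‖p‖ ^ 2 →
      (∫⁻ q, ENNReal.ofReal (max (4 * π ^ 2 * ‖q‖ ^ 2 - c) 0) * ‖X (q - p) - X q * T‖ₑ ^ 2) +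
        ENNReal.ofReal (b * (1 - ‖T‖ ^ 2)) ≤ ENNReal.ofReal (4 * π ^ 2 * ‖p‖ ^ 2) := by
  obtain ⟨A, hA, hhigh⟩ := lintegral_multiplier_high X hX heven
  obtain ⟨M, hM, hlow⟩ := lintegral_multiplier_low X
  -- the summand `M` makes `M / c ≤ 1`, and `8 * (A + 1)` makes `A + b - c / 8 ≤ 0`
  refine ⟨8 * (A + 1) + M, by positivity, fun b c p T hb hb' hc hT hT1 hT2 => ?_⟩
  have hc0 : 0 < c := by linarith
  have hpi : 1 ≤ π ^ 2 := by nlinarith [Real.pi_gt_three]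
  have hTT : 0 ≤ 1 - ‖T‖ ^ 2 := by nlinarith [norm_nonneg T]
  rcases le_total (16 * π ^ 2 * ‖p‖ ^ 2) c with h | h
  · refine (add_le_add_left (hlow c p T hc0 hT1 h) _).trans ?_
    rw [← ENNReal.ofReal_add (by positivity) (by positivity)]
    apply ENNReal.ofReal_le_ofReal
    have h1 : M / c ≤ 1 := by rw [div_le_one hc0]; linarith
    have h2 : b * (1 - ‖T‖ ^ 2) ≤ 1 / 2 * (3 * π ^ 2 * ‖p‖ ^ 2) :=
      mul_le_mul hb' hT2 hTT (by norm_num)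
    nlinarith [mul_le_mul_of_nonneg_right h1 (sq_nonneg ‖p‖),
      mul_le_mul_of_nonneg_right hpi (sq_nonneg ‖p‖)]
  · refine (add_le_add_left (hhigh c p T hc0.le hT h) _).trans ?_
    rw [← ENNReal.ofReal_add (by linarith) (by positivity)]
    apply ENNReal.ofReal_le_ofReal
    nlinarith [sq_nonneg ‖T‖]

/-! ### The box and the localization function -/

theorem cube_eq_preimage (s : ℝ) :
    cube s = (WithLp.ofLp : Space → Fin 3 → ℝ) ⁻¹' Set.Icc (fun _ => -(s / 2)) fun _ => s / 2 := by
  ext x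
  simp only [cube, Set.mem_ofPred_eq, Set.mem_preimage, Set.mem_Icc, Pi.le_def, abs_le]
  exact ⟨fun h => ⟨fun k => (h k).1, fun k => (h k).2⟩, fun h k => ⟨h.1 k, h.2 k⟩⟩

theorem isClosed_cube (s : ℝ) : IsClosed (cube s) := by
  rw [cube_eq_preimage]
  exact isClosed_Icc.preimage (PiLp.continuous_ofLp 2 _)

theorem measurableSet_cube (s : ℝ) : MeasurableSet (cube s) := (isClosed_cube s).measurableSet

theorem volume_cube {s : ℝ} (hs : 0 ≤ s) : volume (cube s) = ENNReal.ofReal (s ^ 3) := by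
  rw [cube_eq_preimage, (PiLp.volume_preserving_ofLp (Fin 3)).measure_preimage
    measurableSet_Icc.nullMeasurableSet, Real.volume_Icc_pi]
  simp [ENNReal.ofReal_pow hs]

theorem norm_sq_le_of_mem_cube {s : ℝ} {x : Space} (hx : x ∈ cube s) :
    ‖x‖ ^ 2 ≤ 3 / 4 * s ^ 2 := by
  have h : ∀ k, x k ^ 2 ≤ (s / 2) ^ 2 := fun k => by
    rw [← sq_abs]; exact pow_le_pow_left₀ (abs_nonneg _) (hx k) 2
  rw [EuclideanSpace.real_norm_sq_eq, Fin.sum_univ_three]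
  linarith [h 0, h 1, h 2]

theorem isCompact_cube (s : ℝ) : IsCompact (cube s) := by
  refine Metric.isCompact_of_isClosed_isBounded (isClosed_cube s) ?_
  refine (Metric.isBounded_closedBall (x := (0 : Space)) (r := √(3 / 4 * s ^ 2))).subset ?_
  intro x hx
  rw [mem_closedBall_zero_iff]
  exact Real.le_sqrt_of_sq_le (norm_sq_le_of_mem_cube hx)

theorem inv_smul_mem_cube {s : ℝ} (hs : 0 < s) (x : Space) : s⁻¹ • x ∈ cube 1 ↔ x ∈ cube s := by
  simp only [cube, Set.mem_ofPred_eq, PiLp.smul_apply, smul_eq_mul, abs_mul, abs_inv, abs_of_pos hs]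
  refine forall_congr' fun k => ?_
  rw [inv_mul_le_iff₀ hs]
  ring_nf

/-- Dilations in Fourier space. -/
theorem fourier_comp_inv_smul (f : Space → ℂ) {s : ℝ} (hs : 0 < s) (ξ : Space) :
    𝓕 (fun x => f (s⁻¹ • x)) ξ = ((s ^ 3 : ℝ) : ℂ) * 𝓕 f (s • ξ) := by
  rw [Real.fourier_eq, Real.fourier_eq]
  have h := Measure.integral_comp_inv_smul_of_nonneg (volume : Measure Space)
    (fun v => 𝐞 (-(inner ℝ v (s • ξ))) • f v) hs.le
  rw [finrank_euclideanSpace_fin] at h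
  rw [← Complex.real_smul, ← h]
  refine integral_congr_ae (Eventually.of_forall fun x => ?_)
  simp only [inner_smul_left, inner_smul_right, map_inv₀, conj_trivial]
  rw [mul_inv_cancel_left₀ hs.ne']

theorem lintegral_comp_smul_space (f : Space → ℝ≥0∞) {s : ℝ} (hs : 0 < s) :
    ∫⁻ x, f (s • x) = ENNReal.ofReal ((s ^ 3)⁻¹) * ∫⁻ x, f x := by
  have e : MeasurableEmbedding fun x : Space => s • x :=
    (Homeomorph.smulOfNeZero s hs.ne').measurableEmbedding
  rw [← e.lintegral_map, Measure.map_addHaar_smul _ hs.ne', lintegral_smul_measure,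
    finrank_euclideanSpace_fin, abs_of_pos (by positivity)]
  rfl

/-- The indicator function of the unit cube. -/
noncomputable def unitTheta (x : Space) : ℂ := (cube 1).indicator (fun _ => 1) x

theorem fourier_unitTheta (p : Space) :
    𝓕 unitTheta p = ∫ x in cube 1, Complex.exp (((-2 * π * inner ℝ x p : ℝ) : ℂ) * Complex.I) := by
  rw [Real.fourier_eq', ← integral_indicator (measurableSet_cube 1)]
  refine integral_congr_ae (Eventually.of_forall fun x => ?_)
  by_cases hx : x ∈ cube 1 <;> simp [unitTheta, hx]

theorem measureReal_cube_one : (volume : Measure Space).real (cube 1) = 1 := by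
  simp [measureReal_def, volume_cube]

theorem integrableOn_cube_of_continuous {E : Type*} [NormedAddCommGroup E] {f : Space → E}
    (hf : Continuous f) (s : ℝ) : IntegrableOn f (cube s) :=
  hf.continuousOn.integrableOn_compact (isCompact_cube s)

theorem abs_inner_le_of_mem_cube {x p : Space} (hx : x ∈ cube 1) :
    (2 * π * inner ℝ x p) ^ 2 ≤ 3 * π ^ 2 * ‖p‖ ^ 2 := by
  have h1 : (inner ℝ x p) ^ 2 ≤ (‖x‖ * ‖p‖) ^ 2 :=
    sq_le_sq' (neg_le_of_abs_le (abs_real_inner_le_norm x p)) (real_inner_le_norm x p)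
  have h2 := mul_le_mul_of_nonneg_right (norm_sq_le_of_mem_cube hx) (sq_nonneg ‖p‖)
  have h3 : inner ℝ x p ^ 2 ≤ 3 / 4 * ‖p‖ ^ 2 := by nlinarith
  nlinarith [mul_le_mul_of_nonneg_left h3 (sq_nonneg π)]

theorem norm_fourier_unitTheta_le (p : Space) : ‖𝓕 unitTheta p‖ ≤ 1 := by
  rw [fourier_unitTheta]
  refine (norm_setIntegral_le_of_norm_le_const (C := 1) (by simp [volume_cube]) ?_).trans ?_
  · intro x _; rw [Complex.norm_exp_ofReal_mul_I]
  · rw [measureReal_cube_one, one_mul]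

theorem norm_one_sub_fourier_unitTheta_le (p : Space) : ‖1 - 𝓕 unitTheta p‖ ≤ 6 * ‖p‖ := by
  have h1 : (1 : ℂ) = ∫ _x in cube 1, (1 : ℂ) := by
    rw [setIntegral_const, measureReal_cube_one, one_smul]
  rw [fourier_unitTheta]
  nth_rewrite 1 [h1]
  rw [← integral_sub (integrableOn_cube_of_continuous continuous_const 1)
    (integrableOn_cube_of_continuous (by fun_prop) 1)]
  refine (norm_setIntegral_le_of_norm_le_const (C := 6 * ‖p‖) (by simp [volume_cube]) ?_).trans ?_
  · intro x hx
    rw [norm_sub_rev]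
    have h2 : ‖Complex.exp (((-2 * π * inner ℝ x p : ℝ) : ℂ) * Complex.I) - 1‖ ≤
        |2 * π * inner ℝ x p| := by
      have := Real.norm_exp_I_mul_ofReal_sub_one_le (x := -2 * π * inner ℝ x p)
      rw [mul_comm Complex.I] at this
      refine this.trans (le_of_eq ?_)
      rw [Real.norm_eq_abs, ← abs_neg]; ring_nf
    refine h2.trans (abs_le_of_sq_le_sq ?_ (by positivity))
    refine (abs_inner_le_of_mem_cube hx).trans ?_
    have : π ^ 2 ≤ 12 := by nlinarith [Real.pi_lt_d2, Real.pi_pos]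
    nlinarith [mul_le_mul_of_nonneg_right this (sq_nonneg ‖p‖)]
  · rw [measureReal_cube_one, mul_one]

theorem one_sub_norm_fourier_unitTheta_sq_le (p : Space) :
    1 - ‖𝓕 unitTheta p‖ ^ 2 ≤ 3 * π ^ 2 * ‖p‖ ^ 2 := by
  have hre : (𝓕 unitTheta p).re = ∫ x in cube 1, Real.cos (2 * π * inner ℝ x p) := by
    rw [fourier_unitTheta]
    have h := integral_re (𝕜 := ℂ) (integrableOn_cube_of_continuous (E := ℂ) (f := fun x =>
      Complex.exp (((-2 * π * inner ℝ x p : ℝ) : ℂ) * Complex.I)) (by fun_prop) 1)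
    simp only [RCLike.re_to_complex] at h
    rw [← h]
    refine integral_congr_ae (Eventually.of_forall fun x => ?_)
    simp only [Complex.exp_ofReal_mul_I_re]
    rw [← Real.cos_neg]; ring_nf
  have hlow : 1 - 3 * π ^ 2 * ‖p‖ ^ 2 / 2 ≤ (𝓕 unitTheta p).re := by
    have h1 : 1 - 3 * π ^ 2 * ‖p‖ ^ 2 / 2 =
        ∫ _x in cube 1, (1 - 3 * π ^ 2 * ‖p‖ ^ 2 / 2 : ℝ) := by
      rw [setIntegral_const, measureReal_cube_one, one_smul]
    rw [h1, hre]
    refine setIntegral_mono_on (integrableOn_cube_of_continuous continuous_const 1)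
      (integrableOn_cube_of_continuous (by fun_prop) 1) (measurableSet_cube 1) fun x hx => ?_
    have := Real.one_sub_sq_div_two_le_cos (x := 2 * π * inner ℝ x p)
    linarith [abs_inner_le_of_mem_cube (p := p) hx]
  have h2 : (𝓕 unitTheta p).re ^ 2 ≤ ‖𝓕 unitTheta p‖ ^ 2 := by
    rw [← sq_abs]
    exact pow_le_pow_left₀ (abs_nonneg _) (Complex.abs_re_le_norm _) 2
  nlinarith [sq_nonneg (1 - (𝓕 unitTheta p).re)]

/-- The localization function as a complex Schwartz function. -/
theorem IsLocalization.exists_schwartz {χ : Space → ℝ} (hχ : IsLocalization χ) :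
    ∃ F : 𝓢(Space, ℂ), ∀ x, F x = χ x := by
  have hc : HasCompactSupport fun x => (χ x : ℂ) :=
    (HasCompactSupport.intro' (isCompact_cube 1) (isClosed_cube 1) fun x hx => by
      have : χ x = 0 := image_eq_zero_of_notMem_tsupport fun h => hx (hχ.supp h)
      simp [this])
  have hs : ContDiff ℝ (⊤ : ℕ∞) fun x => (χ x : ℂ) := Complex.ofRealCLM.contDiff.comp hχ.smooth
  exact ⟨hc.toSchwartzMap hs, fun x => rfl⟩

theorem IsLocalization.eq_zero {χ : Space → ℝ} (hχ : IsLocalization χ) {x : Space}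
    (hx : x ∉ cube 1) : χ x = 0 :=
  image_eq_zero_of_notMem_tsupport fun h => hx (hχ.supp h)

/-- The Fourier multiplier estimate for a localization function and the unit cube. -/
theorem IsLocalization.multiplier_unit_le {χ : Space → ℝ} (hχ : IsLocalization χ) :
    ∃ C₀ : ℝ, 0 < C₀ ∧ ∀ (b c : ℝ) (p : Space), 0 ≤ b → b ≤ 1 / 2 → C₀ ≤ c →
      (∫⁻ q, ENNReal.ofReal (max (4 * π ^ 2 * ‖q‖ ^ 2 - c) 0) *
        ‖𝓕 (fun x => (χ x : ℂ)) (q - p) - 𝓕 (fun x => (χ x : ℂ)) q * 𝓕 unitTheta (-p)‖ₑ ^ 2) +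
        ENNReal.ofReal (b * (1 - ‖𝓕 unitTheta (-p)‖ ^ 2)) ≤
      ENNReal.ofReal (4 * π ^ 2 * ‖p‖ ^ 2) := by
  obtain ⟨F, hF⟩ := hχ.exists_schwartz
  have hF' : (F : Space → ℂ) = fun x => (χ x : ℂ) := funext hF
  have hX : ∫ q, ‖(𝓕 F) q‖ ^ 2 = 1 := by
    rw [integral_norm_sq_fourier, ← hχ.integral_sq]
    simp [hF]
  have heven : ∀ q, ‖(𝓕 F) (-q)‖ = ‖(𝓕 F) q‖ := by
    intro q
    rw [SchwartzMap.fourier_coe, Real.fourier_eq, Real.fourier_eq, ← integral_neg_eq_self]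
    simp [hF, hχ.even]
  obtain ⟨C₀, hC₀, h⟩ := BoseGas.multiplier_unit_le (𝓕 F) hX heven
  refine ⟨C₀, hC₀, fun b c p hb hb' hc => ?_⟩
  have := h b c p (𝓕 unitTheta (-p)) hb hb' hc (norm_fourier_unitTheta_le _)
    (by simpa using norm_one_sub_fourier_unitTheta_le (-p))
    (by simpa using one_sub_norm_fourier_unitTheta_sq_le (-p))
  simpa only [SchwartzMap.fourier_coe, hF'] using this

/-! ### The localized kinetic energy of one particle -/

namespace BoxData

/-- The integral kernel of `φ ↦ 𝓕 (χ_B Q φ)`. -/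
noncomputable def kernel (S : BoxData) (q x : Space) : ℂ :=
  (𝐞 (-(inner ℝ x q)) : ℂ) * S.chiB x -
    ((S.ℓ ^ 3)⁻¹ : ℝ) * 𝓕 (fun x => (S.chiB x : ℂ)) q * S.theta x

theorem continuous_chiB {S : BoxData} (hχ : IsLocalization S.χ) : Continuous S.chiB :=
  hχ.smooth.continuous.comp (by fun_prop)

theorem chiB_eq_zero {S : BoxData} (hχ : IsLocalization S.χ) (hℓ : 0 < S.ℓ) {x : Space}
    (hx : x ∉ cube S.ℓ) : S.chiB x = 0 :=
  hχ.eq_zero fun h => hx ((inv_smul_mem_cube hℓ x).1 h)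

theorem theta_of_mem {S : BoxData} {x : Space} (hx : x ∈ cube S.ℓ) : S.theta x = 1 := by
  simp [theta, hx]

theorem theta_of_notMem {S : BoxData} {x : Space} (hx : x ∉ cube S.ℓ) : S.theta x = 0 := by
  simp [theta, hx]

theorem chiB_mul_theta {S : BoxData} (hχ : IsLocalization S.χ) (hℓ : 0 < S.ℓ) (x : Space) :
    (S.chiB x : ℂ) * S.theta x = S.chiB x := by
  by_cases hx : x ∈ cube S.ℓ
  · rw [theta_of_mem hx, mul_one]
  · rw [chiB_eq_zero hχ hℓ hx]; simp

theorem measurable_theta (S : BoxData) : Measurable S.theta :=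
  measurable_const.indicator (measurableSet_cube _)

theorem integral_theta_mul (S : BoxData) (f : Space → ℂ) :
    ∫ x, S.theta x * f x = ∫ x in cube S.ℓ, f x := by
  rw [← integral_indicator (measurableSet_cube _)]
  refine integral_congr_ae (Eventually.of_forall fun x => ?_)
  by_cases hx : x ∈ cube S.ℓ <;> simp [theta, hx]

theorem integrable_theta_mul {S : BoxData} {f : Space → ℂ} (hf : IntegrableOn f (cube S.ℓ)) :
    Integrable fun x => S.theta x * f x := by
  have := (integrable_indicator_iff (measurableSet_cube S.ℓ)).2 hf
  refine this.congr (Eventually.of_forall fun x => ?_)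
  by_cases hx : x ∈ cube S.ℓ <;> simp [theta, hx]

theorem integrable_theta (S : BoxData) : Integrable S.theta := by
  simpa using integrable_theta_mul (S := S) (f := fun _ => 1)
    (integrableOn_cube_of_continuous continuous_const _)

theorem hasCompactSupport_chiB {S : BoxData} (hχ : IsLocalization S.χ) (hℓ : 0 < S.ℓ) :
    HasCompactSupport S.chiB :=
  HasCompactSupport.intro' (isCompact_cube _) (isClosed_cube _) fun _ hx => chiB_eq_zero hχ hℓ hx

theorem integrable_chiB {S : BoxData} (hχ : IsLocalization S.χ) (hℓ : 0 < S.ℓ) :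
    Integrable fun x => (S.chiB x : ℂ) :=
  ((continuous_chiB hχ).integrable_of_hasCompactSupport (hasCompactSupport_chiB hχ hℓ)).ofReal

theorem exists_chiB_le {S : BoxData} (hχ : IsLocalization S.χ) (hℓ : 0 < S.ℓ) :
    ∃ M : ℝ, 0 ≤ M ∧ ∀ x, S.chiB x ≤ M := by
  obtain ⟨M, hM⟩ := (continuous_chiB hχ).bounded_above_of_compact_support
    (hasCompactSupport_chiB hχ hℓ)
  exact ⟨M, (norm_nonneg _).trans (hM 0), fun x => (le_abs_self _).trans (hM x)⟩

/-- `φ ↦ 𝓕 (χ_B Q φ)` is the integral operator with kernel `kernel`. -/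
theorem fourierChiQ_eq {S : BoxData} (hχ : IsLocalization S.χ) (hℓ : 0 < S.ℓ) {φ : Space → ℂ}
    (hφ : IntegrableOn φ (cube S.ℓ)) (q : Space) :
    S.fourierChiQ φ q = ∫ x, S.kernel q x * φ x := by
  have hθφ := integrable_theta_mul hφ
  obtain ⟨M, -, hM⟩ := exists_chiB_le hχ hℓ
  have hχ0 : ∀ x, 0 ≤ S.chiB x := fun x => hχ.nonneg _
  have h1 : Integrable fun x => (𝐞 (-(inner ℝ x q)) : ℂ) * (S.chiB x * (S.theta x * φ x)) := by
    refine hθφ.norm.const_mul M |>.mono' ?_ (Eventually.of_forall fun x => ?_)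
    · have := continuous_chiB hχ
      exact AEStronglyMeasurable.mul (by fun_prop)
        (AEStronglyMeasurable.mul (by fun_prop) hθφ.aestronglyMeasurable)
    · rw [norm_mul, Circle.norm_coe, one_mul, norm_mul, Complex.norm_real,
        Real.norm_of_nonneg (hχ0 x)]
      exact mul_le_mul_of_nonneg_right (hM x) (norm_nonneg _)
  have h2 : Integrable fun x => (𝐞 (-(inner ℝ x q)) : ℂ) * S.chiB x := by
    refine (integrable_chiB hχ hℓ).norm.mono' ?_ (Eventually.of_forall fun x => ?_)
    · have := continuous_chiB hχ
      fun_prop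
    · rw [norm_mul, Circle.norm_coe, one_mul]
  set m : ℂ := ∫ y, S.theta y * φ y with hm
  have h3 : S.fourierChiQ φ q = (∫ x, (𝐞 (-(inner ℝ x q)) : ℂ) *
      (S.chiB x * (S.theta x * φ x))) - ((S.ℓ ^ 3)⁻¹ : ℝ) * m *
        ∫ x, (𝐞 (-(inner ℝ x q)) : ℂ) * S.chiB x := by
    rw [fourierChiQ, Real.fourier_eq, ← integral_const_mul, ← integral_sub h1 (h2.const_mul _)]
    refine integral_congr_ae (Eventually.of_forall fun x => ?_)
    simp only [Circle.smul_def, projQ, smul_eq_mul]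
    rw [← hm]
    conv_rhs => rw [← chiB_mul_theta hχ hℓ x]
    linear_combination (-(𝐞 (-(inner ℝ x q)) : ℂ) * S.theta x * φ x) *
      chiB_mul_theta hχ hℓ x
  have h4 : 𝓕 (fun x => (S.chiB x : ℂ)) q = ∫ x, (𝐞 (-(inner ℝ x q)) : ℂ) * S.chiB x := by
    rw [Real.fourier_eq]; rfl
  have h5 : ∀ x, S.kernel q x * φ x = (𝐞 (-(inner ℝ x q)) : ℂ) *
      (S.chiB x * (S.theta x * φ x)) - ((S.ℓ ^ 3)⁻¹ : ℝ) *
      𝓕 (fun x => (S.chiB x : ℂ)) q * (S.theta x * φ x) := by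
    intro x
    rw [kernel]
    linear_combination (-(𝐞 (-(inner ℝ x q)) : ℂ) * φ x) * chiB_mul_theta hχ hℓ x
  simp only [h5]
  rw [integral_sub h1 (hθφ.const_mul _), integral_const_mul, h3, h4]
  ring

theorem kernel_eq_zero {S : BoxData} (hχ : IsLocalization S.χ) (hℓ : 0 < S.ℓ) (q : Space)
    {x : Space} (hx : x ∉ cube S.ℓ) : S.kernel q x = 0 := by
  simp [kernel, chiB_eq_zero hχ hℓ hx, theta_of_notMem hx]

theorem hasCompactSupport_kernel {S : BoxData} (hχ : IsLocalization S.χ) (hℓ : 0 < S.ℓ)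
    (q : Space) : HasCompactSupport (S.kernel q) :=
  HasCompactSupport.intro' (isCompact_cube _) (isClosed_cube _)
    fun _ hx => kernel_eq_zero hχ hℓ q hx

theorem continuous_fourier_chiB {S : BoxData} (hχ : IsLocalization S.χ) (hℓ : 0 < S.ℓ) :
    Continuous (𝓕 fun x => (S.chiB x : ℂ)) :=
  VectorFourier.fourierIntegral_continuous Real.continuous_fourierChar
    (by exact continuous_inner) (integrable_chiB hχ hℓ)

theorem measurable_kernel {S : BoxData} (hχ : IsLocalization S.χ) (hℓ : 0 < S.ℓ) {α : Type*}
    [MeasurableSpace α] {g h : α → Space} (hg : Measurable g) (hh : Measurable h) :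
    Measurable fun z => S.kernel (g z) (h z) := by
  have h1 : Measurable fun z => 𝓕 (fun x => (S.chiB x : ℂ)) (g z) :=
    (continuous_fourier_chiB hχ hℓ).measurable.comp hg
  have h2 : Measurable fun z => (S.chiB (h z) : ℂ) :=
    Complex.measurable_ofReal.comp ((continuous_chiB hχ).measurable.comp hh)
  have h3 : Measurable fun z => S.theta (h z) := S.measurable_theta.comp hh
  have h4 : Measurable fun z => inner ℝ (h z) (g z) := hh.inner hg
  have h5 : Measurable fun z => (𝐞 (-(inner ℝ (h z) (g z))) : ℂ) :=
    (continuous_subtype_val.comp Real.continuous_fourierChar).measurable.comp h4.neg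
  unfold kernel
  have h6 := h5.mul h2
  have h7 := (h1.const_mul (((S.ℓ ^ 3)⁻¹ : ℝ) : ℂ)).mul h3
  exact Measurable.sub h6 h7

theorem norm_kernel_le {S : BoxData} (hχ : IsLocalization S.χ) (hℓ : 0 < S.ℓ) :
    ∃ M : ℝ, 0 ≤ M ∧ ∀ q x, ‖S.kernel q x‖ ≤ M := by
  obtain ⟨M, hM0, hM⟩ := exists_chiB_le hχ hℓ
  have hF : ∀ q, ‖𝓕 (fun x => (S.chiB x : ℂ)) q‖ ≤ ∫ x, ‖(S.chiB x : ℂ)‖ := fun q =>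
    VectorFourier.norm_fourierIntegral_le_integral_norm _ _ _ _ _
  have hI : 0 ≤ ∫ x, ‖(S.chiB x : ℂ)‖ := integral_nonneg fun x => norm_nonneg _
  refine ⟨M + (S.ℓ ^ 3)⁻¹ * ∫ x, ‖(S.chiB x : ℂ)‖, by positivity, fun q x => ?_⟩
  refine (norm_sub_le _ _).trans (add_le_add ?_ ?_)
  · rw [norm_mul, Circle.norm_coe, one_mul, Complex.norm_real,
      Real.norm_of_nonneg (show 0 ≤ S.chiB x from hχ.nonneg _)]
    exact hM x
  · rw [norm_mul, norm_mul, Complex.norm_real, Real.norm_of_nonneg (by positivity)]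
    have hθ : ‖S.theta x‖ ≤ 1 := by
      by_cases hx : x ∈ cube S.ℓ
      · simp [theta_of_mem hx]
      · simp [theta_of_notMem hx]
    calc _ ≤ (S.ℓ ^ 3)⁻¹ * (∫ x, ‖(S.chiB x : ℂ)‖) * 1 := by
          gcongr
          exact hF q
      _ = _ := mul_one _

theorem integrable_kernel {S : BoxData} (hχ : IsLocalization S.χ) (hℓ : 0 < S.ℓ) (q : Space) :
    Integrable (S.kernel q) := by
  refine Integrable.sub ?_ (S.integrable_theta.const_mul _)
  refine (integrable_chiB hχ hℓ).norm.mono' ?_ (Eventually.of_forall fun x => ?_)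
  · have := continuous_chiB hχ
    fun_prop
  · rw [norm_mul, Circle.norm_coe, one_mul]

theorem chiB_fourier (S : BoxData) (hℓ : 0 < S.ℓ) (q : Space) :
    𝓕 (fun x => (S.chiB x : ℂ)) q =
      ((S.ℓ ^ 3 : ℝ) : ℂ) * 𝓕 (fun x => (S.χ x : ℂ)) (S.ℓ • q) :=
  fourier_comp_inv_smul (fun x => (S.χ x : ℂ)) hℓ q

theorem theta_fourier (S : BoxData) (hℓ : 0 < S.ℓ) (q : Space) :
    𝓕 S.theta q = ((S.ℓ ^ 3 : ℝ) : ℂ) * 𝓕 unitTheta (S.ℓ • q) := by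
  rw [← fourier_comp_inv_smul unitTheta hℓ q]
  have h : S.theta = fun x => unitTheta (S.ℓ⁻¹ • x) := by
    funext x
    by_cases hx : x ∈ cube S.ℓ
    · rw [theta_of_mem hx, unitTheta, Set.indicator_of_mem ((inv_smul_mem_cube hℓ x).2 hx)]
    · rw [theta_of_notMem hx, unitTheta,
        Set.indicator_of_notMem fun h => hx ((inv_smul_mem_cube hℓ x).1 h)]
  rw [← h]

/-- The Fourier transform of the kernel in the position, in units of the box. -/
theorem fourier_kernel {S : BoxData} (hχ : IsLocalization S.χ) (hℓ : 0 < S.ℓ) (q p : Space) :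
    𝓕 (S.kernel q) (-p) = ((S.ℓ ^ 3 : ℝ) : ℂ) *
      (𝓕 (fun x => (S.χ x : ℂ)) (S.ℓ • q - S.ℓ • p) -
        𝓕 (fun x => (S.χ x : ℂ)) (S.ℓ • q) * 𝓕 unitTheta (-(S.ℓ • p))) := by
  have hℓ' : ((S.ℓ ^ 3 : ℝ) : ℂ) ≠ 0 := by exact_mod_cast (by positivity : S.ℓ ^ 3 ≠ 0)
  have h1 : Integrable fun x => (𝐞 (-(inner ℝ x (q - p))) : ℂ) * S.chiB x := by
    refine (integrable_chiB hχ hℓ).norm.mono' ?_ (Eventually.of_forall fun x => ?_)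
    · have := continuous_chiB hχ
      fun_prop
    · rw [norm_mul, Circle.norm_coe, one_mul]
  have h2 : Integrable fun x => (𝐞 (-(inner ℝ x (-p))) : ℂ) * S.theta x := by
    refine S.integrable_theta.norm.mono' ?_ (Eventually.of_forall fun x => ?_)
    · have := S.measurable_theta.aestronglyMeasurable (μ := (volume : Measure Space))
      exact AEStronglyMeasurable.mul (by fun_prop) this
    · rw [norm_mul, Circle.norm_coe, one_mul]
  have h3 : 𝓕 (S.kernel q) (-p) = 𝓕 (fun x => (S.chiB x : ℂ)) (q - p) -
      ((S.ℓ ^ 3)⁻¹ : ℝ) * 𝓕 (fun x => (S.chiB x : ℂ)) q * 𝓕 S.theta (-p) := by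
    rw [Real.fourier_eq, Real.fourier_eq (fun x => (S.chiB x : ℂ)) (q - p),
      Real.fourier_eq S.theta]
    simp only [Circle.smul_def, smul_eq_mul]
    rw [← integral_const_mul, ← integral_sub h1 (h2.const_mul _)]
    refine integral_congr_ae (Eventually.of_forall fun x => ?_)
    have h4 : (𝐞 (-(inner ℝ x (q - p))) : ℂ) =
        (𝐞 (-(inner ℝ x (-p))) : ℂ) * (𝐞 (-(inner ℝ x q)) : ℂ) := by
      rw [← Circle.coe_mul, ← AddChar.map_add_eq_mul]
      congr 2
      rw [inner_sub_right, inner_neg_right]; ring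
    simp only [kernel]
    rw [h4]
    ring
  rw [h3, chiB_fourier S hℓ, chiB_fourier S hℓ, theta_fourier S hℓ, smul_sub, smul_neg,
    Complex.ofReal_inv]
  field_simp

theorem measurable_multiplier (S : BoxData) : Measurable S.multiplier := by
  unfold multiplier; fun_prop

theorem multiplier_smul (S : BoxData) (hℓ : 0 < S.ℓ) (q : Space) :
    S.multiplier q = (S.ℓ ^ 2)⁻¹ * max (4 * π ^ 2 * ‖S.ℓ • q‖ ^ 2 - S.c) 0 := by
  rw [multiplier, norm_smul, Real.norm_of_nonneg hℓ.le, mul_max_of_nonneg _ _ (by positivity),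
    mul_zero]
  congr 1
  field_simp

/-- `Q` is an orthogonal projection: the theorem of Pythagoras. -/
theorem lintegral_projQ {S : BoxData} (hℓ : 0 < S.ℓ) {φ : Space → ℂ}
    (hφ : MemLp φ 2 (volume.restrict (cube S.ℓ))) :
    (∫⁻ x, ‖S.projQ φ x‖ₑ ^ 2) +
        ENNReal.ofReal ((S.ℓ ^ 3)⁻¹) * ‖∫ x, S.theta x * φ x‖ₑ ^ 2 =
      ∫⁻ x in cube S.ℓ, ‖φ x‖ₑ ^ 2 := by
  have hfin : IsFiniteMeasure (volume.restrict (cube S.ℓ)) :=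
    ⟨by simp [volume_cube hℓ.le]⟩
  have hφ1 : IntegrableOn φ (cube S.ℓ) := hφ.integrable (by norm_num)
  have hφ2 : Integrable (fun x => ‖φ x‖ ^ 2) (volume.restrict (cube S.ℓ)) :=
    hφ.integrable_norm_pow (by norm_num)
  set m : ℂ := ∫ x, S.theta x * φ x with hm
  set t : ℂ := ((S.ℓ ^ 3)⁻¹ : ℝ) * m with ht
  have hmm : m = ∫ x in cube S.ℓ, φ x := S.integral_theta_mul φ
  have h1 : ∫⁻ x, ‖S.projQ φ x‖ₑ ^ 2 = ∫⁻ x in cube S.ℓ, ‖φ x - t‖ₑ ^ 2 := by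
    rw [← lintegral_indicator (measurableSet_cube _)]
    refine lintegral_congr fun x => ?_
    by_cases hx : x ∈ cube S.ℓ
    · simp [projQ, theta_of_mem hx, hx, ← hm, ht]
    · simp [projQ, theta_of_notMem hx, hx]
  have hd2 : Integrable (fun x => ‖φ x - t‖ ^ 2) (volume.restrict (cube S.ℓ)) :=
    (hφ.sub (memLp_const t)).integrable_norm_pow (by norm_num)
  have hcr : Integrable (fun x => ((starRingEnd ℂ) t * φ x).re) (volume.restrict (cube S.ℓ)) :=
    (hφ1.const_mul _).re
  have hexp : ∀ x, ‖φ x - t‖ ^ 2 = ‖φ x‖ ^ 2 - 2 * ((starRingEnd ℂ) t * φ x).re + ‖t‖ ^ 2 := by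
    intro x
    simp only [← Complex.normSq_eq_norm_sq, Complex.normSq_apply, Complex.sub_re, Complex.sub_im,
      Complex.mul_re, Complex.conj_re, Complex.conj_im]
    ring
  have hvol : (volume : Measure Space).real (cube S.ℓ) = S.ℓ ^ 3 := by
    rw [measureReal_def, volume_cube hℓ.le, ENNReal.toReal_ofReal (by positivity)]
  have hnt : ‖t‖ = (S.ℓ ^ 3)⁻¹ * ‖m‖ := by
    rw [ht, norm_mul, Complex.norm_real, Real.norm_of_nonneg (by positivity)]
  have hval : ∫ x in cube S.ℓ, ‖φ x - t‖ ^ 2 =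
      (∫ x in cube S.ℓ, ‖φ x‖ ^ 2) - (S.ℓ ^ 3)⁻¹ * ‖m‖ ^ 2 := by
    simp only [hexp]
    have hc : ∫ x in cube S.ℓ, ((starRingEnd ℂ) t * φ x).re = (S.ℓ ^ 3)⁻¹ * ‖m‖ ^ 2 := by
      have := integral_re (𝕜 := ℂ) (hφ1.const_mul ((starRingEnd ℂ) t))
      simp only [RCLike.re_to_complex] at this
      rw [this, integral_const_mul, ← hmm, ht, map_mul, Complex.conj_ofReal, mul_assoc,
        Complex.conj_mul', ← Complex.ofReal_pow, ← Complex.ofReal_mul, Complex.ofReal_re]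
    have h12 : Integrable (fun x => ‖φ x‖ ^ 2 - 2 * ((starRingEnd ℂ) t * φ x).re)
        (volume.restrict (cube S.ℓ)) := hφ2.sub (hcr.const_mul 2)
    rw [integral_add h12 (integrable_const _), integral_sub hφ2 (hcr.const_mul 2),
      integral_const_mul, hc, setIntegral_const, hvol, smul_eq_mul, hnt]
    field_simp
    ring
  rw [h1, lintegral_enorm_sq_eq_ofReal hd2, lintegral_enorm_sq_eq_ofReal hφ2, hval,
    ← ofReal_norm, ← ENNReal.ofReal_pow (norm_nonneg _), ← ENNReal.ofReal_mul (by positivity),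
    ← ENNReal.ofReal_add _ (by positivity), sub_add_cancel]
  rw [← hval]
  exact integral_nonneg fun x => by positivity

/-- The inequality between Fourier symbols that expresses that the average over all translates of
the localized kinetic energy is at most the kinetic energy, in units of the box. -/
def SymbolBound (S : BoxData) : Prop :=
  ∀ p : Space, (∫⁻ q, ENNReal.ofReal (max (4 * π ^ 2 * ‖q‖ ^ 2 - S.c) 0) *
      ‖𝓕 (fun x => (S.χ x : ℂ)) (q - p) -
        𝓕 (fun x => (S.χ x : ℂ)) q * 𝓕 unitTheta (-p)‖ₑ ^ 2) +
      ENNReal.ofReal (S.b * (1 - ‖𝓕 unitTheta (-p)‖ ^ 2)) ≤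
    ENNReal.ofReal (4 * π ^ 2 * ‖p‖ ^ 2)

/-- The multiplier of the localized kinetic energy, averaged over all translates of the box. -/
theorem lintegral_multiplier_kernel_le {S : BoxData} (hχ : IsLocalization S.χ) (hℓ : 0 < S.ℓ)
    (hb : 0 ≤ S.b) (hS : S.SymbolBound) (p : Space) :
    (∫⁻ q, ENNReal.ofReal (S.multiplier q) * ‖𝓕 (S.kernel q) (-p)‖ₑ ^ 2) +
        ENNReal.ofReal (S.b * (S.ℓ ^ 2)⁻¹) *
          ENNReal.ofReal (S.ℓ ^ 3 - (S.ℓ ^ 3)⁻¹ * ‖𝓕 S.theta (-p)‖ ^ 2) ≤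
      ENNReal.ofReal (S.ℓ ^ 3) * ENNReal.ofReal (4 * π ^ 2 * ‖p‖ ^ 2) := by
  have hT := norm_fourier_unitTheta_le (-(S.ℓ • p))
  have h1 : ∫⁻ q, ENNReal.ofReal (S.multiplier q) * ‖𝓕 (S.kernel q) (-p)‖ₑ ^ 2 =
      ENNReal.ofReal S.ℓ * ∫⁻ q, ENNReal.ofReal (max (4 * π ^ 2 * ‖q‖ ^ 2 - S.c) 0) *
        ‖𝓕 (fun x => (S.χ x : ℂ)) (q - S.ℓ • p) -
          𝓕 (fun x => (S.χ x : ℂ)) q * 𝓕 unitTheta (-(S.ℓ • p))‖ₑ ^ 2 := by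
    have h2 : ∀ q, ENNReal.ofReal (S.multiplier q) * ‖𝓕 (S.kernel q) (-p)‖ₑ ^ 2 =
        ENNReal.ofReal (S.ℓ ^ 4) * (fun q' => ENNReal.ofReal (max (4 * π ^ 2 * ‖q'‖ ^ 2 - S.c) 0) *
          ‖𝓕 (fun x => (S.χ x : ℂ)) (q' - S.ℓ • p) -
            𝓕 (fun x => (S.χ x : ℂ)) q' * 𝓕 unitTheta (-(S.ℓ • p))‖ₑ ^ 2) (S.ℓ • q) := by
      intro q
      rw [multiplier_smul S hℓ, fourier_kernel hχ hℓ, enorm_mul, mul_pow,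
        ENNReal.ofReal_mul (by positivity), ← ofReal_norm ((S.ℓ ^ 3 : ℝ) : ℂ), Complex.norm_real,
        Real.norm_of_nonneg (by positivity), ← ENNReal.ofReal_pow (by positivity)]
      have : ENNReal.ofReal (S.ℓ ^ 4) =
          ENNReal.ofReal ((S.ℓ ^ 2)⁻¹) * ENNReal.ofReal ((S.ℓ ^ 3) ^ 2) := by
        rw [← ENNReal.ofReal_mul (by positivity)]
        congr 1
        field_simp
      rw [this]
      ring
    simp only [h2]
    rw [lintegral_const_mul' _ _ ENNReal.ofReal_ne_top,
      lintegral_comp_smul_space (fun q' => ENNReal.ofReal (max (4 * π ^ 2 * ‖q'‖ ^ 2 - S.c) 0) *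
          ‖𝓕 (fun x => (S.χ x : ℂ)) (q' - S.ℓ • p) -
            𝓕 (fun x => (S.χ x : ℂ)) q' * 𝓕 unitTheta (-(S.ℓ • p))‖ₑ ^ 2) hℓ, ← mul_assoc,
      ← ENNReal.ofReal_mul (by positivity)]
    congr 2
    field_simp
  have h3 : ENNReal.ofReal (S.b * (S.ℓ ^ 2)⁻¹) *
      ENNReal.ofReal (S.ℓ ^ 3 - (S.ℓ ^ 3)⁻¹ * ‖𝓕 S.theta (-p)‖ ^ 2) =
      ENNReal.ofReal S.ℓ * ENNReal.ofReal (S.b * (1 - ‖𝓕 unitTheta (-(S.ℓ • p))‖ ^ 2)) := by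
    rw [← ENNReal.ofReal_mul (by positivity), ← ENNReal.ofReal_mul hℓ.le, theta_fourier S hℓ,
      norm_mul, Complex.norm_real, Real.norm_of_nonneg (by positivity), smul_neg]
    congr 1
    field_simp
  rw [h1, h3, ← mul_add]
  refine (mul_le_mul_right (hS (S.ℓ • p)) _).trans (le_of_eq ?_)
  rw [← ENNReal.ofReal_mul hℓ.le, ← ENNReal.ofReal_mul (by positivity), norm_smul,
    Real.norm_of_nonneg hℓ.le]
  congr 1
  ring

/-- The projection `Q` averaged over all translates: by Pythagoras, it is the identity on the box
minus the projection onto the constants, and the latter is a correlation with `θ`. -/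
theorem lintegral_projQ_translate {S : BoxData} (hℓ : 0 < S.ℓ) {f : Space → ℂ}
    (hf : ContDiff ℝ (⊤ : ℕ∞) f) (hfc : HasCompactSupport f) :
    ∫⁻ u, ∫⁻ x, ‖S.projQ (fun y => f (y + u)) x‖ₑ ^ 2 =
      ∫⁻ p, ENNReal.ofReal (S.ℓ ^ 3 - (S.ℓ ^ 3)⁻¹ * ‖𝓕 S.theta (-p)‖ ^ 2) * ‖𝓕 f p‖ₑ ^ 2 := by
  have hf0 := hf.continuous
  have hF0 : Continuous (𝓕 f) :=
    VectorFourier.fourierIntegral_continuous Real.continuous_fourierChar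
      (by exact continuous_inner) (hf0.integrable_of_hasCompactSupport hfc)
  have hT0 : Continuous (𝓕 S.theta) :=
    VectorFourier.fourierIntegral_continuous Real.continuous_fourierChar
      (by exact continuous_inner) S.integrable_theta
  have hfin : IsFiniteMeasure (volume.restrict (cube S.ℓ)) :=
    ⟨by simp [volume_cube hℓ.le]⟩
  have hL2 : ∫⁻ x, ‖f x‖ₑ ^ 2 = ∫⁻ p, ‖𝓕 f p‖ₑ ^ 2 :=
    (lintegral_fourier_schwartz (hfc.toSchwartzMap hf)).symm
  have hfinite : ∫⁻ x, ‖f x‖ₑ ^ 2 ≠ ⊤ := by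
    have : MemLp f 2 volume := hf0.memLp_of_hasCompactSupport hfc
    have h := this.eLpNorm_lt_top
    rw [eLpNorm_lt_top_iff_lintegral_rpow_enorm_lt_top (by norm_num) (by norm_num)] at h
    simpa using h.ne
  have hpyth : ∀ u, (∫⁻ x, ‖S.projQ (fun y => f (y + u)) x‖ₑ ^ 2) +
      ENNReal.ofReal ((S.ℓ ^ 3)⁻¹) * ‖∫ x, S.theta x * f (x + u)‖ₑ ^ 2 =
        ∫⁻ x in cube S.ℓ, ‖f (x + u)‖ₑ ^ 2 := by
    intro u
    refine lintegral_projQ hℓ (φ := fun y => f (y + u)) ?_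
    exact ((hf0.comp (continuous_add_const u)).memLp_of_hasCompactSupport
      (hfc.comp_homeomorph (Homeomorph.addRight u))).restrict _
  have hmeas : Measurable fun u => ENNReal.ofReal ((S.ℓ ^ 3)⁻¹) *
      ‖∫ x, S.theta x * f (x + u)‖ₑ ^ 2 := by
    have h1 : StronglyMeasurable fun z : Space × Space => S.theta z.2 * f (z.2 + z.1) := by
      have := S.measurable_theta
      exact ((this.comp measurable_snd).mul
        (hf0.measurable.comp (by fun_prop))).stronglyMeasurable
    have h2 := (h1.integral_prod_right' (ν := (volume : Measure Space))).enorm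
    exact (h2.pow_const 2).const_mul _
  have htot : (∫⁻ u, ∫⁻ x, ‖S.projQ (fun y => f (y + u)) x‖ₑ ^ 2) +
      ∫⁻ p, ENNReal.ofReal ((S.ℓ ^ 3)⁻¹ * ‖𝓕 S.theta (-p)‖ ^ 2) * ‖𝓕 f p‖ₑ ^ 2 =
        ENNReal.ofReal (S.ℓ ^ 3) * ∫⁻ p, ‖𝓕 f p‖ₑ ^ 2 := by
    have h1 : ∫⁻ p, ENNReal.ofReal ((S.ℓ ^ 3)⁻¹ * ‖𝓕 S.theta (-p)‖ ^ 2) * ‖𝓕 f p‖ₑ ^ 2 =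
        ∫⁻ u, ENNReal.ofReal ((S.ℓ ^ 3)⁻¹) * ‖∫ x, S.theta x * f (x + u)‖ₑ ^ 2 := by
      rw [lintegral_const_mul' _ _ ENNReal.ofReal_ne_top,
        lintegral_correlation hf hfc S.integrable_theta
          (HasCompactSupport.intro' (isCompact_cube _) (isClosed_cube _)
            fun _ hx => theta_of_notMem hx), ← lintegral_const_mul' _ _ ENNReal.ofReal_ne_top]
      refine lintegral_congr fun p => ?_
      rw [ENNReal.ofReal_mul (by positivity), ENNReal.ofReal_pow (norm_nonneg _), ofReal_norm,
        mul_assoc]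
    rw [h1, ← lintegral_add_right _ hmeas]
    simp only [hpyth]
    rw [lintegral_lintegral_swap]
    · have : ∀ x : Space, ∫⁻ u, ‖f (x + u)‖ₑ ^ 2 = ∫⁻ p, ‖𝓕 f p‖ₑ ^ 2 := fun x => by
        rw [lintegral_add_left_eq_self (fun u => ‖f u‖ₑ ^ 2) x, hL2]
      simp only [this, setLIntegral_const, volume_cube hℓ.le]
      rw [mul_comm]
    · have : Continuous fun z : Space × Space => ‖f (z.2 + z.1)‖ₑ ^ 2 := by
        have h : Continuous fun z : Space × Space => f (z.2 + z.1) := by fun_prop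
        fun_prop
      exact this.measurable.aemeasurable
  have hle : ∀ p, (S.ℓ ^ 3)⁻¹ * ‖𝓕 S.theta (-p)‖ ^ 2 ≤ S.ℓ ^ 3 := by
    intro p
    have hT := norm_fourier_unitTheta_le (-(S.ℓ • p))
    rw [theta_fourier S hℓ, norm_mul, Complex.norm_real, Real.norm_of_nonneg (by positivity),
      smul_neg]
    have : ‖𝓕 unitTheta (-(S.ℓ • p))‖ ^ 2 ≤ 1 := by
      nlinarith [norm_nonneg (𝓕 unitTheta (-(S.ℓ • p)))]
    calc _ = S.ℓ ^ 3 * ‖𝓕 unitTheta (-(S.ℓ • p))‖ ^ 2 := by field_simp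
      _ ≤ S.ℓ ^ 3 * 1 := by gcongr
      _ = _ := mul_one _
  have hmeas2 : Measurable fun p =>
      ENNReal.ofReal ((S.ℓ ^ 3)⁻¹ * ‖𝓕 S.theta (-p)‖ ^ 2) * ‖𝓕 f p‖ₑ ^ 2 := by
    have h1 : Continuous fun p => (S.ℓ ^ 3)⁻¹ * ‖𝓕 S.theta (-p)‖ ^ 2 := by fun_prop
    exact h1.measurable.ennreal_ofReal.mul (hF0.enorm.measurable.pow_const 2)
  have hsplit : ENNReal.ofReal (S.ℓ ^ 3) * ∫⁻ p, ‖𝓕 f p‖ₑ ^ 2 =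
      (∫⁻ p, ENNReal.ofReal (S.ℓ ^ 3 - (S.ℓ ^ 3)⁻¹ * ‖𝓕 S.theta (-p)‖ ^ 2) * ‖𝓕 f p‖ₑ ^ 2) +
      ∫⁻ p, ENNReal.ofReal ((S.ℓ ^ 3)⁻¹ * ‖𝓕 S.theta (-p)‖ ^ 2) * ‖𝓕 f p‖ₑ ^ 2 := by
    rw [← lintegral_add_right _ hmeas2, ← lintegral_const_mul' _ _ ENNReal.ofReal_ne_top]
    refine lintegral_congr fun p => ?_
    rw [← add_mul, ← ENNReal.ofReal_add (sub_nonneg.2 (hle p)) (by positivity), sub_add_cancel]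
  refine (ENNReal.add_left_inj ?_).1 (htot.trans hsplit)
  refine ne_top_of_le_ne_top (ENNReal.mul_ne_top ENNReal.ofReal_ne_top (hL2 ▸ hfinite))
    (le_of_le_of_eq le_add_self hsplit.symm)

theorem measurable_fourier_kernel {S : BoxData} (hχ : IsLocalization S.χ) (hℓ : 0 < S.ℓ) :
    Measurable fun z : Space × Space => 𝓕 (S.kernel z.1) (-z.2) := by
  obtain ⟨F, hF⟩ := hχ.exists_schwartz
  have hF' : (fun x => (S.χ x : ℂ)) = F := (funext hF).symm
  have h3 : Continuous (𝓕 fun x => (S.χ x : ℂ)) := by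
    rw [hF', ← SchwartzMap.fourier_coe]; exact (𝓕 F).continuous
  have h4 : Continuous (𝓕 unitTheta) :=
    VectorFourier.fourierIntegral_continuous Real.continuous_fourierChar
      (by exact continuous_inner)
      ((integrable_indicator_iff (measurableSet_cube 1)).2
        (integrableOn_cube_of_continuous continuous_const 1))
  simp only [fourier_kernel hχ hℓ]
  generalize 𝓕 (fun x => (S.χ x : ℂ)) = g at h3
  generalize 𝓕 unitTheta = t at h4
  have h5 : Continuous fun z : Space × Space => ((S.ℓ ^ 3 : ℝ) : ℂ) *
      (g (S.ℓ • z.1 - S.ℓ • z.2) - g (S.ℓ • z.1) * t (-(S.ℓ • z.2))) := by fun_prop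
  exact h5.measurable

theorem measurable_integral_kernel {S : BoxData} (hχ : IsLocalization S.χ) (hℓ : 0 < S.ℓ)
    {f : Space → ℂ} (hf : Continuous f) :
    Measurable fun z : Space × Space => ∫ x, S.kernel z.2 x * f (x + z.1) := by
  have h2 : Measurable fun z : (Space × Space) × Space =>
      S.kernel z.1.2 z.2 * f (z.2 + z.1.1) := by
    refine Measurable.mul ?_ ?_
    · exact measurable_kernel hχ hℓ (by fun_prop) measurable_snd
    · have h3 : Measurable fun z : (Space × Space) × Space => z.2 + z.1.1 := by fun_prop
      exact hf.measurable.comp h3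
  have h6 := h2.stronglyMeasurable.integral_prod_right' (ν := (volume : Measure Space))
  exact h6.measurable

/-- The kinetic energy of a test function dominates the localized kinetic energies, averaged over
all translates of the box. -/
theorem lintegral_localized_kinetic_le {S : BoxData} (hχ : IsLocalization S.χ) (hℓ : 0 < S.ℓ)
    (hb : 0 ≤ S.b) (hS : S.SymbolBound) {f : Space → ℂ}
    (hf : ContDiff ℝ (⊤ : ℕ∞) f) (hfc : HasCompactSupport f) :
    (∫⁻ u, ∫⁻ q, ENNReal.ofReal (S.multiplier q) * ‖∫ x, S.kernel q x * f (x + u)‖ₑ ^ 2) +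
        ENNReal.ofReal (S.b * (S.ℓ ^ 2)⁻¹) *
          ∫⁻ u, ∫⁻ x, ‖S.projQ (fun y => f (y + u)) x‖ₑ ^ 2 ≤
      ENNReal.ofReal (S.ℓ ^ 3) *
        ∑ k, ∫⁻ x, ‖fderiv ℝ f x (EuclideanSpace.single k 1)‖ₑ ^ 2 := by
  have hf0 := hf.continuous
  have hF0 : Continuous (𝓕 f) :=
    VectorFourier.fourierIntegral_continuous Real.continuous_fourierChar
      (by exact continuous_inner) (hf0.integrable_of_hasCompactSupport hfc)
  have hT0 : Continuous (𝓕 S.theta) :=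
    VectorFourier.fourierIntegral_continuous Real.continuous_fourierChar
      (by exact continuous_inner) S.integrable_theta
  have hm := S.measurable_multiplier
  have hkin : ∫⁻ u, ∫⁻ q, ENNReal.ofReal (S.multiplier q) *
      ‖∫ x, S.kernel q x * f (x + u)‖ₑ ^ 2 =
      ∫⁻ p, (∫⁻ q, ENNReal.ofReal (S.multiplier q) * ‖𝓕 (S.kernel q) (-p)‖ₑ ^ 2) *
        ‖𝓕 f p‖ₑ ^ 2 := by
    rw [lintegral_lintegral_swap]
    · have h1 : ∀ q, ∫⁻ u, ENNReal.ofReal (S.multiplier q) *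
          ‖∫ x, S.kernel q x * f (x + u)‖ₑ ^ 2 =
          ∫⁻ p, ENNReal.ofReal (S.multiplier q) * ‖𝓕 (S.kernel q) (-p)‖ₑ ^ 2 * ‖𝓕 f p‖ₑ ^ 2 := by
        intro q
        rw [lintegral_const_mul' _ _ ENNReal.ofReal_ne_top,
          lintegral_correlation hf hfc (integrable_kernel hχ hℓ q)
            (hasCompactSupport_kernel hχ hℓ q),
          ← lintegral_const_mul' _ _ ENNReal.ofReal_ne_top]
        simp only [mul_assoc]
      simp only [h1]
      rw [lintegral_lintegral_swap]
      · refine lintegral_congr fun p => lintegral_mul_const' _ _ ?_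
        exact ENNReal.pow_ne_top enorm_ne_top
      · have h2 := (measurable_fourier_kernel hχ hℓ).enorm.pow_const 2
        have h3 : Measurable fun z : Space × Space => ‖𝓕 f z.2‖ₑ ^ 2 :=
          (hF0.enorm.measurable.pow_const 2).comp measurable_snd
        exact (((hm.comp measurable_fst).ennreal_ofReal.mul h2).mul h3).aemeasurable
    · have h2 := (measurable_integral_kernel hχ hℓ hf0).enorm.pow_const 2
      exact ((hm.comp measurable_snd).ennreal_ofReal.mul h2).aemeasurable
  rw [hkin, lintegral_projQ_translate hℓ hf hfc, lintegral_gradient hf hfc,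
    ← lintegral_const_mul' _ _ ENNReal.ofReal_ne_top,
    ← lintegral_const_mul' _ _ ENNReal.ofReal_ne_top, ← lintegral_add_right]
  · refine lintegral_mono fun p => ?_
    rw [← mul_assoc, ← mul_assoc, ← add_mul]
    exact mul_le_mul_left (lintegral_multiplier_kernel_le hχ hℓ hb hS p) _
  · have h1 : Continuous fun p => S.ℓ ^ 3 - (S.ℓ ^ 3)⁻¹ * ‖𝓕 S.theta (-p)‖ ^ 2 := by fun_prop
    exact (h1.measurable.ennreal_ofReal.mul (hF0.enorm.measurable.pow_const 2)).const_mul _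

end BoxData

/-! ### Separating one particle from the others -/

/-- The coordinates of all particles except the `i`-th. -/
abbrev Rest {N : ℕ} (i : Fin N) : Type := {p : Fin N × Fin 3 // ¬p.1 = i} → ℝ

/-- The configuration in which the `i`-th particle is at `y` and the others are at `r`. -/
def glue {N : ℕ} (i : Fin N) (r : Rest i) (y : Space) : Config N :=
  WithLp.toLp 2 (fun p => if h : p.1 = i then y p.2 else r ⟨p, h⟩)

theorem glue_apply {N : ℕ} (i : Fin N) (r : Rest i) (y : Space) (p : Fin N × Fin 3) :
    glue i r y p = if h : p.1 = i then y p.2 else r ⟨p, h⟩ := rfl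

theorem pos_glue {N : ℕ} (i : Fin N) (r : Rest i) (y : Space) : pos i (glue i r y) = y := by
  ext k; simp [pos, glue_apply]

theorem replace_glue {N : ℕ} (i : Fin N) (r : Rest i) (y z : Space) :
    replace i (glue i r y) z = glue i r z := by
  ext p
  by_cases h : p.1 = i <;> simp [replace, glue_apply, h]

theorem actOn_glue {N : ℕ} (i : Fin N) (A : (Space → ℂ) → (Space → ℂ)) (f : Config N → ℂ)
    (r : Rest i) (y : Space) : actOn i A f (glue i r y) = A (fun z => f (glue i r z)) y := by
  simp only [actOn, pos_glue, replace_glue]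

/-- The `i`-th particle's coordinates among all coordinates. -/
def coordEquiv {N : ℕ} (i : Fin N) : Fin 3 ≃ {p : Fin N × Fin 3 // p.1 = i} where
  toFun k := ⟨(i, k), rfl⟩
  invFun p := p.1.2
  left_inv _ := rfl
  right_inv p := by obtain ⟨⟨j, k⟩, rfl⟩ := p; rfl

/-- Gluing as a measurable equivalence. -/
noncomputable def glueEquiv {N : ℕ} (i : Fin N) : Rest i × Space ≃ᵐ Config N :=
  MeasurableEquiv.prodComm.trans <|
    ((((MeasurableEquiv.toLp 2 (Fin 3 → ℝ)).symm.trans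
      (MeasurableEquiv.piCongrLeft (fun _ => ℝ) (coordEquiv i))).prodCongr
      (MeasurableEquiv.refl (Rest i))).trans
    (MeasurableEquiv.piEquivPiSubtypeProd (fun _ : Fin N × Fin 3 => ℝ)
      (fun p => p.1 = i)).symm).trans
    (MeasurableEquiv.toLp 2 (Fin N × Fin 3 → ℝ))

theorem glueEquiv_apply {N : ℕ} (i : Fin N) (z : Rest i × Space) :
    glueEquiv i z = glue i z.1 z.2 := by
  ext p
  by_cases h : p.1 = i
  · obtain ⟨j, k⟩ := p
    obtain rfl : j = i := h
    have := Equiv.piCongrLeft_apply_apply (fun _ : {p : Fin N × Fin 3 // p.1 = j} => ℝ)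
      (coordEquiv j) (fun k => z.2 k) k
    simp [glueEquiv, glue_apply, MeasurableEquiv.piEquivPiSubtypeProd,
      Equiv.piEquivPiSubtypeProd]
    exact this
  · simp [glueEquiv, glue_apply, h, MeasurableEquiv.piEquivPiSubtypeProd,
      Equiv.piEquivPiSubtypeProd]
    rfl

theorem measurePreserving_glueEquiv {N : ℕ} (i : Fin N) :
    MeasurePreserving (glueEquiv i) (volume.prod volume) volume := by
  have h1 : MeasurePreserving (MeasurableEquiv.toLp 2 (Fin 3 → ℝ)).symm volume volume :=
    PiLp.volume_preserving_ofLp (Fin 3)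
  have h2 := h1.trans (volume_measurePreserving_piCongrLeft (fun _ => ℝ) (coordEquiv i))
  have h3 : MeasurePreserving ((((MeasurableEquiv.toLp 2 (Fin 3 → ℝ)).symm.trans
      (MeasurableEquiv.piCongrLeft (fun _ => ℝ) (coordEquiv i))).prodCongr
      (MeasurableEquiv.refl (Rest i)))) (volume.prod volume) (volume.prod volume) :=
    h2.prod (MeasurePreserving.id _)
  have h4 := (volume_preserving_piEquivPiSubtypeProd (fun _ : Fin N × Fin 3 => ℝ)
    (fun p => p.1 = i)).symm
  have h5 : MeasurePreserving (MeasurableEquiv.toLp 2 (Fin N × Fin 3 → ℝ)) volume volume :=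
    PiLp.volume_preserving_toLp (Fin N × Fin 3)
  exact Measure.measurePreserving_swap.trans ((h3.trans h4).trans h5)

theorem lintegral_glue {N : ℕ} (i : Fin N) {F : Config N → ℝ≥0∞} (hF : AEMeasurable F volume) :
    ∫⁻ x, F x = ∫⁻ r : Rest i, ∫⁻ y, F (glue i r y) := by
  rw [← (measurePreserving_glueEquiv i).lintegral_comp_emb (glueEquiv i).measurableEmbedding]
  rw [lintegral_prod (fun z => F (glueEquiv i z)) (hF.comp_quasiMeasurePreserving
    (measurePreserving_glueEquiv i).quasiMeasurePreserving)]
  simp only [glueEquiv_apply]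

theorem ae_glue {N : ℕ} (i : Fin N) {P : Config N → Prop} (h : ∀ᵐ x, P x) :
    ∀ᵐ r : Rest i, ∀ᵐ y : Space, P (glue i r y) := by
  have h1 := (measurePreserving_glueEquiv i).quasiMeasurePreserving.ae h
  have h2 := Measure.ae_ae_of_ae_prod h1
  simpa only [glueEquiv_apply] using h2

theorem ae_of_ae_glue {N : ℕ} (i : Fin N) {P : Config N → Prop} (hP : MeasurableSet {x | P x})
    (h : ∀ᵐ r : Rest i, ∀ᵐ y : Space, P (glue i r y)) : ∀ᵐ x, P x := by
  have h1 : ∀ᵐ z ∂(volume.prod volume : Measure (Rest i × Space)), P (glueEquiv i z) := by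
    refine (Measure.ae_prod_iff_ae_ae ((glueEquiv i).measurable hP)).2 ?_
    change ∀ᵐ r, ∀ᵐ y, P (glueEquiv i (r, y))
    simpa only [glueEquiv_apply] using h
  rw [← (measurePreserving_glueEquiv i).map_eq]
  exact (ae_map_iff (glueEquiv i).measurable.aemeasurable hP).2 h1

theorem measurable_glue {N : ℕ} (i : Fin N) :
    Measurable fun z : Rest i × Space => glue i z.1 z.2 := by
  have h : (fun z : Rest i × Space => glue i z.1 z.2) = glueEquiv i :=
    funext fun z => (glueEquiv_apply i z).symm
  rw [h]
  exact (glueEquiv i).measurable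

theorem continuous_glue {N : ℕ} (i : Fin N) (r : Rest i) : Continuous (glue i r) := by
  refine (PiLp.continuous_toLp 2 _).comp (continuous_pi fun p => ?_)
  by_cases h : p.1 = i
  · simp only [h, dite_true]; fun_prop
  · simp only [h, dite_false]; fun_prop

theorem continuous_pos {N : ℕ} (i : Fin N) : Continuous (pos i : Config N → Space) := by
  refine (PiLp.continuous_toLp 2 _).comp (continuous_pi fun k => ?_)
  fun_prop

theorem continuous_replace {N : ℕ} (i : Fin N) :
    Continuous fun z : Config N × Space => replace i z.1 z.2 := by
  refine (PiLp.continuous_toLp 2 _).comp (continuous_pi fun p => ?_)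
  by_cases h : p.1 = i
  · simp only [h, if_true]; fun_prop
  · simp only [h, if_false]; fun_prop

/-! ### One-particle operators acting on one variable of a wave function -/

theorem ae_memLp_glue {N : ℕ} (i : Fin N) {f : Config N → ℂ} (hf : StronglyMeasurable f)
    (hf2 : MemLp f 2 volume) : ∀ᵐ r : Rest i, MemLp (fun y => f (glue i r y)) 2 volume := by
  have h := hf2.eLpNorm_lt_top
  rw [eLpNorm_lt_top_iff_lintegral_rpow_enorm_lt_top (by norm_num) (by norm_num)] at h
  have hm : Measurable fun x => ‖f x‖ₑ ^ (2 : ℝ) := hf.enorm.pow_const _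
  simp only [ENNReal.toReal_ofNat] at h
  rw [lintegral_glue i hm.aemeasurable] at h
  have hm2 : Measurable fun r : Rest i => ∫⁻ y, ‖f (glue i r y)‖ₑ ^ (2 : ℝ) :=
    (hm.comp (measurable_glue i)).lintegral_prod_right'
  filter_upwards [ae_lt_top hm2 h.ne] with r hr
  refine ⟨(hf.comp_measurable (continuous_glue i r).measurable).aestronglyMeasurable, ?_⟩
  rw [eLpNorm_lt_top_iff_lintegral_rpow_enorm_lt_top (by norm_num) (by norm_num)]
  simpa using hr

theorem integrableOn_cube_of_memLp {f : Space → ℂ} (hf : MemLp f 2 volume) (s : ℝ) :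
    IntegrableOn f (cube s) := by
  have : IsFiniteMeasure (volume.restrict (cube s)) :=
    ⟨by simpa using (isCompact_cube s).measure_lt_top⟩
  exact (hf.restrict (cube s)).integrable (by norm_num)

namespace BoxData

theorem measurable_projQ (S : BoxData) {α : Type*} [MeasurableSpace α] {f : α → Space → ℂ}
    {g : α → Space} (hf : StronglyMeasurable (Function.uncurry f)) (hg : Measurable g)
    (hfg : Measurable fun a => f a (g a)) : Measurable fun a => S.projQ (f a) (g a) := by
  have h1 : Measurable fun z : α × Space => S.theta z.2 := S.measurable_theta.comp measurable_snd
  have h2 := (h1.stronglyMeasurable.mul hf).integral_prod_right' (ν := (volume : Measure Space))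
  have h3 : Measurable fun a => ∫ y, S.theta y * f a y := h2.measurable
  have h4 : Measurable fun a => S.theta (g a) := S.measurable_theta.comp hg
  unfold projQ
  exact Measurable.sub (h4.mul hfg) ((h3.const_mul (((S.ℓ ^ 3)⁻¹ : ℝ) : ℂ)).mul h4)

theorem stronglyMeasurable_actOn_projQ (S : BoxData) {N : ℕ} (i : Fin N) {f : Config N → ℂ}
    (hf : StronglyMeasurable f) : StronglyMeasurable (actOn i S.projQ f) := by
  have h1 : StronglyMeasurable (Function.uncurry fun x y => f (replace i x y)) :=
    hf.comp_measurable (continuous_replace i).measurable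
  have h2 := (continuous_pos (N := N) i).measurable
  have h3 : Measurable fun x : Config N => f (replace i x (pos i x)) :=
    hf.measurable.comp ((continuous_replace i).comp
      (continuous_id.prodMk (continuous_pos i))).measurable
  exact (S.measurable_projQ h1 h2 h3).stronglyMeasurable

theorem stronglyMeasurable_actOn_fourierChiQ {S : BoxData} (hχ : IsLocalization S.χ) {N : ℕ}
    (i : Fin N) {f : Config N → ℂ} (hf : StronglyMeasurable f) :
    StronglyMeasurable (actOn i S.fourierChiQ f) := by
  have h0 : StronglyMeasurable
      (Function.uncurry fun (z : Config N × Space) y => f (replace i z.1 y)) :=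
    hf.comp_measurable ((continuous_replace i).comp
      (continuous_fst.fst.prodMk continuous_snd)).measurable
  have h1 : Measurable fun z : Config N × Space => S.projQ (fun y => f (replace i z.1 y)) z.2 :=
    S.measurable_projQ h0 measurable_snd (hf.measurable.comp (continuous_replace i).measurable)
  have h2 : Measurable fun z : Config N × Space => inner ℝ z.2 (pos i z.1) :=
    measurable_snd.inner ((continuous_pos i).measurable.comp measurable_fst)
  have h3 : Measurable fun z : Config N × Space => (𝐞 (-(inner ℝ z.2 (pos i z.1))) : ℂ) :=
    (continuous_subtype_val.comp Real.continuous_fourierChar).measurable.comp h2.neg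
  have h4 : Measurable fun z : Config N × Space => (S.chiB z.2 : ℂ) :=
    Complex.measurable_ofReal.comp ((continuous_chiB hχ).measurable.comp measurable_snd)
  have h5 := Measurable.mul h3 (Measurable.mul h4 h1)
  have h7 := h5.stronglyMeasurable.integral_prod_right' (ν := (volume : Measure Space))
  have h6 : actOn i S.fourierChiQ f = fun x => ∫ y, (𝐞 (-(inner ℝ y (pos i x))) : ℂ) *
      ((S.chiB y : ℂ) * S.projQ (fun y => f (replace i x y)) y) := by
    funext x
    rw [actOn, fourierChiQ, Real.fourier_eq]
    simp only [Circle.smul_def, smul_eq_mul]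
  rw [h6]
  exact h7

theorem projQ_congr (S : BoxData) {φ ψ : Space → ℂ} (h : φ =ᵐ[volume] ψ) :
    S.projQ φ =ᵐ[volume] S.projQ ψ := by
  have h1 : ∫ y, S.theta y * φ y = ∫ y, S.theta y * ψ y :=
    integral_congr_ae (h.mono fun y hy => by simp only [hy])
  filter_upwards [h] with x hx
  simp only [projQ, hx, h1]

theorem fourierChiQ_congr (S : BoxData) {φ ψ : Space → ℂ} (h : φ =ᵐ[volume] ψ) (q : Space) :
    S.fourierChiQ φ q = S.fourierChiQ ψ q := by
  rw [fourierChiQ, fourierChiQ, Real.fourier_eq, Real.fourier_eq]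
  refine integral_congr_ae ((S.projQ_congr h).mono fun y hy => ?_)
  simp only [hy]

theorem actOn_projQ_congr (S : BoxData) {N : ℕ} (i : Fin N) {f g : Config N → ℂ}
    (hf : StronglyMeasurable f) (hg : StronglyMeasurable g) (h : f =ᵐ[volume] g) :
    actOn i S.projQ f =ᵐ[volume] actOn i S.projQ g := by
  refine ae_of_ae_glue i ((S.stronglyMeasurable_actOn_projQ i hf).measurableSet_eq_fun
    (S.stronglyMeasurable_actOn_projQ i hg)) ?_
  filter_upwards [ae_glue i h] with r hr
  simp only [actOn_glue]
  exact S.projQ_congr hr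

theorem actOn_fourierChiQ_congr {S : BoxData} (hχ : IsLocalization S.χ) {N : ℕ} (i : Fin N)
    {f g : Config N → ℂ} (hf : StronglyMeasurable f) (hg : StronglyMeasurable g)
    (h : f =ᵐ[volume] g) :
    actOn i S.fourierChiQ f =ᵐ[volume] actOn i S.fourierChiQ g := by
  refine ae_of_ae_glue i ((stronglyMeasurable_actOn_fourierChiQ hχ i hf).measurableSet_eq_fun
    (stronglyMeasurable_actOn_fourierChiQ hχ i hg)) ?_
  filter_upwards [ae_glue i h] with r hr
  simp only [actOn_glue]
  exact Eventually.of_forall fun q => S.fourierChiQ_congr hr q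

theorem projQ_sub_smul (S : BoxData) {φ ψ : Space → ℂ} (hφ : IntegrableOn φ (cube S.ℓ))
    (hψ : IntegrableOn ψ (cube S.ℓ)) (s : ℂ) (x : Space) :
    S.projQ (fun y => φ y - s * ψ y) x = S.projQ φ x - s * S.projQ ψ x := by
  have h : ∫ y, S.theta y * (φ y - s * ψ y) =
      (∫ y, S.theta y * φ y) - s * ∫ y, S.theta y * ψ y := by
    rw [← integral_const_mul, ← integral_sub (integrable_theta_mul hφ)
      ((integrable_theta_mul hψ).const_mul s)]
    refine integral_congr_ae (Eventually.of_forall fun y => ?_)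
    simp only
    ring
  simp only [projQ, h]
  ring

theorem fourierChiQ_sub_smul {S : BoxData} (hχ : IsLocalization S.χ) (hℓ : 0 < S.ℓ)
    {φ ψ : Space → ℂ} (hφ : IntegrableOn φ (cube S.ℓ)) (hψ : IntegrableOn ψ (cube S.ℓ)) (s : ℂ)
    (q : Space) :
    S.fourierChiQ (fun y => φ y - s * ψ y) q = S.fourierChiQ φ q - s * S.fourierChiQ ψ q := by
  have hk : ∀ {f : Space → ℂ}, IntegrableOn f (cube S.ℓ) →
      Integrable fun x => S.kernel q x * f x := by
    intro f hf
    obtain ⟨M, -, hM⟩ := norm_kernel_le hχ hℓ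
    refine ((integrable_theta_mul hf).norm.const_mul M).mono' ?_ (Eventually.of_forall fun x => ?_)
    · have h1 := (integrable_kernel hχ hℓ q).aestronglyMeasurable.mul
        (integrable_theta_mul hf).aestronglyMeasurable
      refine h1.congr (Eventually.of_forall fun x => ?_)
      by_cases hx : x ∈ cube S.ℓ
      · simp [theta_of_mem hx]
      · simp [theta_of_notMem hx, kernel_eq_zero hχ hℓ q hx]
    · by_cases hx : x ∈ cube S.ℓ
      · rw [norm_mul, theta_of_mem hx, one_mul]
        exact mul_le_mul_of_nonneg_right (hM q x) (norm_nonneg _)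
      · simp [theta_of_notMem hx, kernel_eq_zero hχ hℓ q hx]
  rw [fourierChiQ_eq hχ hℓ hφ, fourierChiQ_eq hχ hℓ hψ,
    fourierChiQ_eq hχ hℓ (φ := fun y => φ y - s * ψ y) (hφ.sub (hψ.const_mul s)),
    ← integral_const_mul, ← integral_sub (hk hφ) ((hk hψ).const_mul s)]
  refine integral_congr_ae (Eventually.of_forall fun y => ?_)
  simp only
  ring

theorem actOn_projQ_sub_smul (S : BoxData) {N : ℕ} (i : Fin N) {f g : Config N → ℂ}
    (hf : StronglyMeasurable f) (hg : StronglyMeasurable g) (hf2 : MemLp f 2 volume)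
    (hg2 : MemLp g 2 volume) (s : ℂ) :
    actOn i S.projQ (fun x => f x - s * g x) =ᵐ[volume]
      fun x => actOn i S.projQ f x - s * actOn i S.projQ g x := by
  refine ae_of_ae_glue i ((S.stronglyMeasurable_actOn_projQ i
    (hf.sub (hg.const_mul s))).measurableSet_eq_fun
    ((S.stronglyMeasurable_actOn_projQ i hf).sub
      ((S.stronglyMeasurable_actOn_projQ i hg).const_mul s))) ?_
  filter_upwards [ae_memLp_glue i hf hf2, ae_memLp_glue i hg hg2] with r hr hr'
  simp only [actOn_glue]
  exact Eventually.of_forall fun q => S.projQ_sub_smul (integrableOn_cube_of_memLp hr _)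
    (integrableOn_cube_of_memLp hr' _) s q

theorem actOn_fourierChiQ_sub_smul {S : BoxData} (hχ : IsLocalization S.χ) (hℓ : 0 < S.ℓ) {N : ℕ}
    (i : Fin N) {f g : Config N → ℂ}
    (hf : StronglyMeasurable f) (hg : StronglyMeasurable g) (hf2 : MemLp f 2 volume)
    (hg2 : MemLp g 2 volume) (s : ℂ) :
    actOn i S.fourierChiQ (fun x => f x - s * g x) =ᵐ[volume]
      fun x => actOn i S.fourierChiQ f x - s * actOn i S.fourierChiQ g x := by
  refine ae_of_ae_glue i ((stronglyMeasurable_actOn_fourierChiQ hχ i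
    (hf.sub (hg.const_mul s))).measurableSet_eq_fun
    ((stronglyMeasurable_actOn_fourierChiQ hχ i hf).sub
      ((stronglyMeasurable_actOn_fourierChiQ hχ i hg).const_mul s))) ?_
  filter_upwards [ae_memLp_glue i hf hf2, ae_memLp_glue i hg hg2] with r hr hr'
  simp only [actOn_glue]
  exact Eventually.of_forall fun q => fourierChiQ_sub_smul hχ hℓ (integrableOn_cube_of_memLp hr _)
    (integrableOn_cube_of_memLp hr' _) s q

theorem lintegral_actOn_projQ_le {S : BoxData} (hℓ : 0 < S.ℓ) {N : ℕ} (i : Fin N)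
    {f : Config N → ℂ} (hf : StronglyMeasurable f) (hf2 : MemLp f 2 volume) :
    ∫⁻ x, ‖actOn i S.projQ f x‖ₑ ^ 2 ≤ ∫⁻ x, ‖f x‖ₑ ^ 2 := by
  rw [lintegral_glue i ((S.stronglyMeasurable_actOn_projQ i hf).enorm.pow_const 2).aemeasurable,
    lintegral_glue i (hf.enorm.pow_const 2).aemeasurable]
  refine lintegral_mono_ae ?_
  filter_upwards [ae_memLp_glue i hf hf2] with r hr
  simp only [actOn_glue]
  calc _ ≤ ∫⁻ y in cube S.ℓ, ‖f (glue i r y)‖ₑ ^ 2 := by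
        rw [← lintegral_projQ hℓ (hr.restrict _)]; exact le_self_add
    _ ≤ _ := setLIntegral_le_lintegral _ _

/-! ### The localized interaction -/

/-- The properties of the data of the localized Hamiltonian on which the comparison rests. The last
field says that the box is large compared to the range of the potential. -/
structure Admissible (S : BoxData) : Prop where
  loc : IsLocalization S.χ
  side_pos : 0 < S.ℓ
  b_nonneg : 0 ≤ S.b
  nonneg : ∀ x, 0 ≤ S.v x
  integrable_v : Integrable S.v
  integrable_g : Integrable (scatteringG S.v S.ω)
  selfConv_ge : ∀ x, S.v x ≠ 0 → 1 / 2 ≤ selfConv S.χ (S.ℓ⁻¹ • x)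

theorem chiB_nonneg {S : BoxData} (h : S.Admissible) (x : Space) : 0 ≤ S.chiB x :=
  h.loc.nonneg _

theorem chiB_neg {S : BoxData} (h : S.Admissible) (x : Space) : S.chiB (-x) = S.chiB x := by
  simp [chiB, h.loc.even]

theorem integral_chiB_mul_chiB {S : BoxData} (h : S.Admissible) (x y : Space) :
    ∫ u, S.chiB (x - u) * S.chiB (y - u) = S.ℓ ^ 3 * selfConv S.χ (S.ℓ⁻¹ • (x - y)) := by
  have h1 := integral_sub_left_eq_self (fun u => S.chiB u * S.chiB (x - y - u))
    (volume : Measure Space) x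
  have h2 : ∀ u, S.chiB (x - u) * S.chiB (x - y - (x - u)) =
      S.chiB (x - u) * S.chiB (y - u) := fun u => by
    rw [show x - y - (x - u) = -(y - u) by abel, chiB_neg h]
  simp only [h2] at h1
  rw [h1]
  have h3 := Measure.integral_comp_inv_smul_of_nonneg (volume : Measure Space)
    (fun u => S.χ u * S.χ (S.ℓ⁻¹ • (x - y) - u)) h.side_pos.le
  rw [finrank_euclideanSpace_fin, smul_eq_mul] at h3
  rw [selfConv, ← h3]
  simp only [chiB, smul_sub]

theorem integrable_chiB_real {S : BoxData} (h : S.Admissible) : Integrable S.chiB :=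
  (continuous_chiB h.loc).integrable_of_hasCompactSupport (hasCompactSupport_chiB h.loc h.side_pos)

theorem measurable_selfConv {χ : Space → ℝ} (hχ : IsLocalization χ) : Measurable (selfConv χ) := by
  have h0 := hχ.smooth.continuous
  have h1 : Continuous fun z : Space × Space => χ z.2 * χ (z.1 - z.2) := by fun_prop
  exact (h1.stronglyMeasurable.integral_prod_right' (ν := (volume : Measure Space))).measurable

theorem selfConv_nonneg {χ : Space → ℝ} (hχ : IsLocalization χ) (x : Space) : 0 ≤ selfConv χ x :=
  integral_nonneg fun _ => mul_nonneg (hχ.nonneg _) (hχ.nonneg _)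

theorem measurable_inv_selfConv {S : BoxData} (h : S.Admissible) :
    Measurable fun x => (selfConv S.χ (S.ℓ⁻¹ • x))⁻¹ :=
  ((measurable_selfConv h.loc).comp (measurable_const_smul _)).inv

theorem W_nonneg {S : BoxData} (h : S.Admissible) (x : Space) : 0 ≤ S.W x :=
  div_nonneg (h.nonneg x) (selfConv_nonneg h.loc _)

theorem w_nonneg {S : BoxData} (h : S.Admissible) (x y : Space) : 0 ≤ S.w x y :=
  mul_nonneg (mul_nonneg (chiB_nonneg h x) (W_nonneg h _)) (chiB_nonneg h y)

theorem aestronglyMeasurable_W {S : BoxData} (h : S.Admissible) :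
    AEStronglyMeasurable S.W volume := by
  have := h.integrable_v.aestronglyMeasurable.mul
    (measurable_inv_selfConv h).aestronglyMeasurable
  exact this.congr (Eventually.of_forall fun x => by simp [W, div_eq_mul_inv])

theorem selfConv_mul_W {S : BoxData} (h : S.Admissible) (x : Space) :
    selfConv S.χ (S.ℓ⁻¹ • x) * S.W x = S.v x := by
  by_cases hv : S.v x = 0
  · simp [W, hv]
  · have := h.selfConv_ge x hv
    rw [W, mul_div_cancel₀]
    linarith

/-- Averaged over all translates of the box, the localized interaction is the interaction. -/
theorem lintegral_w_translate {S : BoxData} (h : S.Admissible) (x y : Space) :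
    ∫⁻ u, ENNReal.ofReal (S.w (x - u) (y - u)) =
      ENNReal.ofReal (S.ℓ ^ 3) * ENNReal.ofReal (S.v (x - y)) := by
  have hc := continuous_chiB h.loc
  obtain ⟨M, hM0, hM⟩ := exists_chiB_le h.loc h.side_pos
  have hi : Integrable fun u => S.chiB (x - u) * S.chiB (y - u) := by
    have h1 : Integrable fun u => S.chiB (y - u) := (integrable_chiB_real h).comp_sub_left y
    refine (h1.const_mul M).mono' (by fun_prop) (Eventually.of_forall fun u => ?_)
    rw [Real.norm_of_nonneg (mul_nonneg (chiB_nonneg h _) (chiB_nonneg h _))]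
    exact mul_le_mul_of_nonneg_right (hM _) (chiB_nonneg h _)
  have hw : ∀ u, S.w (x - u) (y - u) = S.W (x - y) * (S.chiB (x - u) * S.chiB (y - u)) := by
    intro u
    rw [w, sub_sub_sub_cancel_right]; ring
  simp only [hw]
  rw [← ofReal_integral_eq_lintegral_ofReal (hi.const_mul _) (Eventually.of_forall fun u =>
      mul_nonneg (W_nonneg h _) (mul_nonneg (chiB_nonneg h _) (chiB_nonneg h _))),
    integral_const_mul, integral_chiB_mul_chiB h,
    ← ENNReal.ofReal_mul (by have := h.side_pos; positivity),
    ← selfConv_mul_W h]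
  congr 1
  ring

/-- The scattering function of the localized interaction, `W (1 - ω)`. -/
noncomputable def scatteringW (S : BoxData) (x : Space) : ℝ := S.W x * (1 - S.ω x)

theorem integrable_scatteringW {S : BoxData} (h : S.Admissible) : Integrable S.scatteringW := by
  have hm : AEStronglyMeasurable S.scatteringW volume := by
    have := h.integrable_g.aestronglyMeasurable.mul
      (measurable_inv_selfConv h).aestronglyMeasurable
    refine this.congr (Eventually.of_forall fun x => ?_)
    simp only [Pi.mul_apply, scatteringG, scatteringW, W, div_eq_mul_inv]
    ring
  refine (h.integrable_g.norm.const_mul 2).mono' hm (Eventually.of_forall fun x => ?_)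
  by_cases hv : S.v x = 0
  · simp [scatteringW, W, hv]
  · have h1 := h.selfConv_ge x hv
    have h2 : S.scatteringW x = (selfConv S.χ (S.ℓ⁻¹ • x))⁻¹ * scatteringG S.v S.ω x := by
      simp only [scatteringG, scatteringW, W, div_eq_mul_inv]; ring
    rw [h2, norm_mul, Real.norm_of_nonneg (by positivity)]
    refine mul_le_mul_of_nonneg_right ?_ (norm_nonneg _)
    rw [inv_le_comm₀ (by linarith) (by norm_num)]
    linarith

/-- The one-body potential `∫ w₁(x,y) dy`. -/
noncomputable def background (S : BoxData) (x : Space) : ℝ := ∫ y, S.w₁ x y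

theorem w₁_eq (S : BoxData) (x y : Space) :
    S.w₁ x y = S.chiB x * (S.scatteringW (x - y) * S.chiB y) := by
  simp only [w₁, w, scatteringW]; ring

theorem background_eq (S : BoxData) (x : Space) :
    S.background x = S.chiB x * ∫ y, S.scatteringW (x - y) * S.chiB y := by
  simp only [background, w₁_eq, integral_const_mul]

theorem background_eq_zero {S : BoxData} (h : S.Admissible) {x : Space} (hx : x ∉ cube S.ℓ) :
    S.background x = 0 := by
  rw [background_eq, chiB_eq_zero h.loc h.side_pos hx, zero_mul]

theorem measurable_background {S : BoxData} (h : S.Admissible) : Measurable S.background := by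
  have hs := (integrable_scatteringW h).aestronglyMeasurable
  set G := hs.mk S.scatteringW with hG
  have hc := continuous_chiB h.loc
  have h1 : StronglyMeasurable fun z : Space × Space => G (z.1 - z.2) * S.chiB z.2 :=
    (hs.stronglyMeasurable_mk.comp_measurable (by fun_prop)).mul
      (hc.comp continuous_snd).stronglyMeasurable
  have h2 := h1.integral_prod_right' (ν := (volume : Measure Space))
  have h3 : S.background = fun x => S.chiB x * ∫ y, G (x - y) * S.chiB y := by
    funext x
    rw [background_eq]
    congr 1
    refine integral_congr_ae ?_
    have h4 := (quasiMeasurePreserving_sub_left (volume : Measure Space) x).ae_eq_comp hs.ae_eq_mk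
    filter_upwards [h4] with y hy
    simp only [Function.comp_apply] at hy
    rw [hy]
  rw [h3]
  exact hc.measurable.mul h2.measurable

theorem exists_abs_background_le {S : BoxData} (h : S.Admissible) :
    ∃ M : ℝ, 0 ≤ M ∧ ∀ x, |S.background x| ≤ M := by
  obtain ⟨M, hM0, hM⟩ := exists_chiB_le h.loc h.side_pos
  have hI : 0 ≤ ∫ y, ‖S.scatteringW y‖ := integral_nonneg fun _ => norm_nonneg _
  refine ⟨M * ((∫ y, ‖S.scatteringW y‖) * M), by positivity, fun x => ?_⟩
  rw [background_eq, abs_mul, abs_of_nonneg (chiB_nonneg h x)]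
  refine mul_le_mul (hM x) ?_ (abs_nonneg _) hM0
  rw [← Real.norm_eq_abs]
  refine (norm_integral_le_integral_norm _).trans ?_
  rw [← integral_sub_left_eq_self (fun y => ‖S.scatteringW y‖) (volume : Measure Space) x,
    ← integral_mul_const]
  refine integral_mono_of_nonneg (Eventually.of_forall fun _ => norm_nonneg _)
    (((integrable_scatteringW h).comp_sub_left x).norm.mul_const M)
    (Eventually.of_forall fun y => ?_)
  simp only [norm_mul]
  rw [Real.norm_of_nonneg (chiB_nonneg h y)]
  exact mul_le_mul_of_nonneg_left (hM y) (norm_nonneg _)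

theorem integrable_background {S : BoxData} (h : S.Admissible) : Integrable S.background := by
  obtain ⟨M, -, hM⟩ := exists_abs_background_le h
  refine IntegrableOn.integrable_of_forall_notMem_eq_zero (s := cube S.ℓ) ?_
    fun x hx => background_eq_zero h hx
  have : IsFiniteMeasure (volume.restrict (cube S.ℓ)) :=
    ⟨by simpa using (isCompact_cube S.ℓ).measure_lt_top⟩
  exact Integrable.of_bound (measurable_background h).aestronglyMeasurable M
    (Eventually.of_forall hM)

/-- The total mass of the one-body potential. -/
theorem integral_background {S : BoxData} (h : S.Admissible) :
    ∫ x, S.background x = S.ℓ ^ 3 * ∫ y, scatteringG S.v S.ω y := by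
  have hs := integrable_scatteringW h
  have hχi := integrable_chiB_real h
  have hc := continuous_chiB h.loc
  obtain ⟨M, hM0, hM⟩ := exists_chiB_le h.loc h.side_pos
  have h1 : ∀ x, S.background x = ∫ z, S.chiB x * S.chiB (x - z) * S.scatteringW z := by
    intro x
    rw [background, ← integral_sub_left_eq_self (fun y => S.w₁ x y) (volume : Measure Space) x]
    refine integral_congr_ae (Eventually.of_forall fun z => ?_)
    simp only [w₁_eq, sub_sub_cancel]
    ring
  have hint : Integrable (fun z : Space × Space =>
      S.chiB z.1 * S.chiB (z.1 - z.2) * S.scatteringW z.2) (volume.prod volume) := by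
    refine ((hχi.mul_prod hs).norm.const_mul M).mono' ?_ (Eventually.of_forall fun z => ?_)
    · refine AEStronglyMeasurable.mul ?_ hs.aestronglyMeasurable.comp_snd
      exact Continuous.aestronglyMeasurable (by fun_prop)
    · rw [norm_mul, norm_mul, norm_mul, Real.norm_of_nonneg (chiB_nonneg h (z.1 - z.2))]
      calc ‖S.chiB z.1‖ * S.chiB (z.1 - z.2) * ‖S.scatteringW z.2‖
          ≤ ‖S.chiB z.1‖ * M * ‖S.scatteringW z.2‖ := by gcongr; exact hM _
        _ = _ := by ring
  simp only [h1]
  rw [integral_integral_swap hint, ← integral_const_mul]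
  refine integral_congr_ae (Eventually.of_forall fun z => ?_)
  simp only
  rw [integral_mul_const]
  have h2 : ∫ x, S.chiB x * S.chiB (x - z) = S.ℓ ^ 3 * selfConv S.χ (S.ℓ⁻¹ • z) := by
    have h3 := integral_chiB_mul_chiB h 0 (-z)
    rw [show (0 : Space) - -z = z by abel] at h3
    rw [← h3, ← integral_neg_eq_self]
    refine integral_congr_ae (Eventually.of_forall fun x => ?_)
    simp only [zero_sub]
    rw [show -x - z = -z - x by abel]
  rw [h2, scatteringW, scatteringG, ← selfConv_mul_W h]
  ring

end BoxData

/-! ### Pair interactions on configuration space -/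

/-- Differences of positions pull null sets back to null sets, so that a potential that is only
almost everywhere measurable may be evaluated at them. -/
theorem quasiMeasurePreserving_pos_sub_pos {N : ℕ} {i j : Fin N} (hij : i ≠ j) :
    Measure.QuasiMeasurePreserving (fun x : Config N => pos i x - pos j x) volume volume := by
  let L : Config N →ₗ[ℝ] Space :=
    { toFun := fun x => pos i x - pos j x
      map_add' := fun x y => by ext k; simp [pos]; ring
      map_smul' := fun c x => by ext k; simp [pos]; ring }
  have hL : Function.Surjective L := by
    intro z
    refine ⟨WithLp.toLp 2 fun p => if p.1 = i then z p.2 else 0, ?_⟩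
    ext k
    simp [L, pos, hij.symm]
  obtain ⟨c, -, hc⟩ := L.exists_map_addHaar_eq_smul_addHaar (volume : Measure (Config N))
    (volume : Measure Space) hL
  refine ⟨((continuous_pos i).sub (continuous_pos j)).measurable, ?_⟩
  change Measure.map L volume ≪ volume
  rw [hc]
  exact Measure.smul_absolutelyContinuous

theorem ofReal_pairSum {N : ℕ} {V : Space → Space → ℝ} (hV : ∀ x y, 0 ≤ V x y) (x : Config N) :
    ENNReal.ofReal (pairSum V x) =
      ∑ i : Fin N, ∑ j ∈ Finset.Ioi i, ENNReal.ofReal (V (pos i x) (pos j x)) := by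
  rw [pairSum, ENNReal.ofReal_sum_of_nonneg fun i _ => Finset.sum_nonneg fun j _ => hV _ _]
  exact Finset.sum_congr rfl fun i _ => ENNReal.ofReal_sum_of_nonneg fun j _ => hV _ _

theorem pairSum_nonneg {N : ℕ} {V : Space → Space → ℝ} (hV : ∀ x y, 0 ≤ V x y) (x : Config N) :
    0 ≤ pairSum V x :=
  Finset.sum_nonneg fun _ _ => Finset.sum_nonneg fun _ _ => hV _ _

theorem aestronglyMeasurable_pairSum {N : ℕ} {V : Space → Space → ℝ}
    (hV : ∀ i j : Fin N, i ≠ j →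
      AEStronglyMeasurable (fun x : Config N => V (pos i x) (pos j x)) volume) :
    AEStronglyMeasurable (pairSum V : Config N → ℝ) volume := by
  have : (pairSum V : Config N → ℝ) =
      ∑ i : Fin N, ∑ j ∈ Finset.Ioi i, fun x => V (pos i x) (pos j x) := by
    funext x; simp [pairSum]
  rw [this]
  refine Finset.aestronglyMeasurable_sum _ fun i _ => Finset.aestronglyMeasurable_sum _
    fun j hj => hV i j (Finset.mem_Ioi.1 hj).ne

namespace BoxData

theorem aestronglyMeasurable_w {S : BoxData} (h : S.Admissible) {N : ℕ} {i j : Fin N}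
    (hij : i ≠ j) :
    AEStronglyMeasurable (fun x : Config N => S.w (pos i x) (pos j x)) volume := by
  have hc := continuous_chiB h.loc
  exact ((hc.comp (continuous_pos i)).aestronglyMeasurable.mul
    ((aestronglyMeasurable_W h).comp_quasiMeasurePreserving
      (quasiMeasurePreserving_pos_sub_pos hij))).mul
    (hc.comp (continuous_pos j)).aestronglyMeasurable

end BoxData

/-! ### Weighted quadratic forms -/

section Weighted

variable {α : Type*} [MeasurableSpace α] {μ : Measure α}

theorem integrable_weight_of_lintegral_lt_top {V : α → ℝ} {F : α → ℂ}
    (hV : AEStronglyMeasurable V μ) (hV0 : ∀ x, 0 ≤ V x) (hF : AEStronglyMeasurable F μ)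
    (h : ∫⁻ x, ENNReal.ofReal (V x) * ‖F x‖ₑ ^ 2 ∂μ < ⊤) :
    Integrable (fun x => V x * ‖F x‖ ^ 2) μ := by
  refine ⟨hV.mul (hF.norm.pow 2), ?_⟩
  rw [hasFiniteIntegral_iff_ofReal (Eventually.of_forall fun x => mul_nonneg (hV0 x) (sq_nonneg _))]
  refine lt_of_le_of_lt (le_of_eq (lintegral_congr fun x => ?_)) h
  rw [ENNReal.ofReal_mul (hV0 x), ENNReal.ofReal_pow (norm_nonneg _), ofReal_norm]

theorem toReal_lintegral_weight {V : α → ℝ} {F : α → ℂ}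
    (hV : AEStronglyMeasurable V μ) (hV0 : ∀ x, 0 ≤ V x) (hF : AEStronglyMeasurable F μ) :
    (∫⁻ x, ENNReal.ofReal (V x) * ‖F x‖ₑ ^ 2 ∂μ).toReal = ∫ x, V x * ‖F x‖ ^ 2 ∂μ := by
  rw [integral_eq_lintegral_of_nonneg_ae
    (Eventually.of_forall fun x => mul_nonneg (hV0 x) (sq_nonneg _)) (hV.mul (hF.norm.pow 2))]
  congr 1
  refine lintegral_congr fun x => ?_
  rw [ENNReal.ofReal_mul (hV0 x), ENNReal.ofReal_pow (norm_nonneg _), ofReal_norm]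

theorem integral_weight_self (V : α → ℝ) (F : α → ℂ) :
    (∫ x, (V x : ℂ) * starRingEnd ℂ (F x) * F x ∂μ).re = ∫ x, V x * ‖F x‖ ^ 2 ∂μ := by
  have : ∀ x, (V x : ℂ) * starRingEnd ℂ (F x) * F x = ((V x * ‖F x‖ ^ 2 : ℝ) : ℂ) := fun x => by
    rw [mul_assoc, Complex.conj_mul']; push_cast; ring
  simp only [this]
  rw [integral_complex_ofReal, Complex.ofReal_re]

/-- Expanding a weighted square norm at `F - s G`. -/
theorem integral_weight_sub_smul {V : α → ℝ} {F G H : α → ℂ} (hV : AEStronglyMeasurable V μ)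
    (hF : AEStronglyMeasurable F μ) (hG : AEStronglyMeasurable G μ)
    (hF2 : Integrable (fun x => V x * ‖F x‖ ^ 2) μ) (hG2 : Integrable (fun x => V x * ‖G x‖ ^ 2) μ)
    (s : ℝ) (hH : H =ᵐ[μ] fun x => F x - s * G x) :
    Integrable (fun x => V x * ‖H x‖ ^ 2) μ ∧
    (∫ x, (V x : ℂ) * starRingEnd ℂ (H x) * H x ∂μ).re =
      (∫ x, (V x : ℂ) * starRingEnd ℂ (F x) * F x ∂μ).re -
        2 * s * (∫ x, (V x : ℂ) * starRingEnd ℂ (F x) * G x ∂μ).re +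
        s ^ 2 * (∫ x, (V x : ℂ) * starRingEnd ℂ (G x) * G x ∂μ).re := by
  have hFG : Integrable (fun x => (V x : ℂ) * starRingEnd ℂ (F x) * G x) μ := by
    refine (hF2.norm.add hG2.norm).mono'
      (((Complex.continuous_ofReal.comp_aestronglyMeasurable hV).mul
        (Complex.continuous_conj.comp_aestronglyMeasurable hF)).mul hG)
      (Eventually.of_forall fun x => ?_)
    simp only [norm_mul, Pi.add_apply, Complex.norm_real, RCLike.norm_conj, norm_pow, norm_norm]
    nlinarith [mul_nonneg (norm_nonneg (V x)) (sq_nonneg (‖F x‖ - ‖G x‖)),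
      mul_nonneg (norm_nonneg (V x)) (sq_nonneg (‖F x‖)),
      mul_nonneg (norm_nonneg (V x)) (sq_nonneg (‖G x‖))]
  have hre : (∫ x, (V x : ℂ) * starRingEnd ℂ (F x) * G x ∂μ).re =
      ∫ x, ((V x : ℂ) * starRingEnd ℂ (F x) * G x).re ∂μ := by
    have := integral_re (𝕜 := ℂ) hFG
    simpa only [RCLike.re_to_complex] using this.symm
  have hreI : Integrable (fun x => ((V x : ℂ) * starRingEnd ℂ (F x) * G x).re) μ := hFG.re
  have hexp : (fun x => V x * ‖H x‖ ^ 2) =ᵐ[μ] fun x => V x * ‖F x‖ ^ 2 -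
      2 * s * ((V x : ℂ) * starRingEnd ℂ (F x) * G x).re + s ^ 2 * (V x * ‖G x‖ ^ 2) := by
    filter_upwards [hH] with x hx
    rw [hx]
    simp only [← Complex.normSq_eq_norm_sq, Complex.normSq_apply, Complex.sub_re, Complex.sub_im,
      Complex.mul_re, Complex.mul_im, Complex.conj_re, Complex.conj_im, Complex.ofReal_re,
      Complex.ofReal_im]
    ring
  have hi1 : Integrable (fun x => V x * ‖F x‖ ^ 2 -
      2 * s * ((V x : ℂ) * starRingEnd ℂ (F x) * G x).re) μ := hF2.sub (hreI.const_mul _)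
  refine ⟨(hi1.add (hG2.const_mul _)).congr hexp.symm, ?_⟩
  rw [integral_weight_self, integral_weight_self, integral_weight_self, integral_congr_ae hexp,
    integral_add hi1 (hG2.const_mul _), integral_sub hF2 (hreI.const_mul _), integral_const_mul,
    integral_const_mul, hre]

end Weighted

/-! ### Wave functions -/

theorem stronglyMeasurable_wave {N : ℕ} (Ψ : bosonic N) : StronglyMeasurable (wave Ψ) :=
  Lp.stronglyMeasurable _

theorem memLp_wave {N : ℕ} (Ψ : bosonic N) : MemLp (wave Ψ) 2 volume := Lp.memLp _

theorem integrable_norm_sq_wave {N : ℕ} (Ψ : bosonic N) : Integrable fun x => ‖wave Ψ x‖ ^ 2 :=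
  (memLp_wave Ψ).integrable_norm_pow (by norm_num)

theorem lintegral_wave {N : ℕ} (Ψ : bosonic N) : ∫⁻ x, ‖wave Ψ x‖ₑ ^ 2 = ‖Ψ‖ₑ ^ 2 := by
  have h : ‖Ψ‖ₑ = eLpNorm (wave Ψ) 2 volume := Lp.enorm_def _
  rw [h, eLpNorm_two_sq]

theorem integral_norm_sq_wave {N : ℕ} (Ψ : bosonic N) : ∫ x, ‖wave Ψ x‖ ^ 2 = ‖Ψ‖ ^ 2 := by
  have h := lintegral_enorm_sq_eq_ofReal (integrable_norm_sq_wave Ψ)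
  rw [lintegral_wave, ← ofReal_norm, ← ENNReal.ofReal_pow (norm_nonneg _)] at h
  exact ((ENNReal.ofReal_eq_ofReal_iff (by positivity)
    (integral_nonneg fun _ => by positivity)).1 h).symm

theorem wave_sub_smul {N : ℕ} (Φ Ψ : bosonic N) (s : ℂ) :
    wave (Φ - s • Ψ) =ᵐ[volume] fun x => wave Φ x - s * wave Ψ x := by
  have h1 := Lp.coeFn_sub (Φ : Lp ℂ 2 (volume : Measure (Config N))) (s • Ψ : bosonic N)
  have h2 := Lp.coeFn_smul s (Ψ : Lp ℂ 2 (volume : Measure (Config N)))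
  filter_upwards [h1, h2] with x hx1 hx2
  have h3 : wave (Φ - s • Ψ) x = ((Φ : Lp ℂ 2 (volume : Measure (Config N))) -
    ((s • Ψ : bosonic N) : Lp ℂ 2 (volume : Measure (Config N))) : Lp ℂ 2 volume) x := rfl
  rw [h3, hx1, Pi.sub_apply]
  congr 1

/-! ### The form of the box Hamiltonian -/

namespace BoxData

theorem multiplier_nonneg (S : BoxData) (q : Space) : 0 ≤ S.multiplier q := le_max_right _ _

/-- The expectation of the high-momentum part of the localized kinetic energy of particle `i`. -/
noncomputable def kineticEnergy (S : BoxData) {N : ℕ} (i : Fin N) (f : Config N → ℂ) : ℝ≥0∞ :=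
  ∫⁻ x : Config N, ENNReal.ofReal (S.multiplier (pos i x)) * ‖actOn i S.fourierChiQ f x‖ₑ ^ 2

/-- The expectation of the projection `Q` in the variable of particle `i`. -/
noncomputable def excitation (S : BoxData) {N : ℕ} (i : Fin N) (f : Config N → ℂ) : ℝ≥0∞ :=
  ∫⁻ x : Config N, ‖actOn i S.projQ f x‖ₑ ^ 2

/-- The expectation of the localized pair interaction. -/
noncomputable def pairEnergy (S : BoxData) {N : ℕ} (f : Config N → ℂ) : ℝ≥0∞ :=
  ∫⁻ x : Config N, ENNReal.ofReal (pairSum S.w x) * ‖f x‖ₑ ^ 2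

/-- The expectation of the one-body potential, without the factor `-ρ`. -/
noncomputable def backgroundEnergy (S : BoxData) {N : ℕ} (f : Config N → ℂ) : ℝ :=
  ∫ x : Config N, (∑ i : Fin N, S.background (pos i x)) * ‖f x‖ ^ 2

theorem measurable_multiplier_pos (S : BoxData) {N : ℕ} (i : Fin N) :
    Measurable fun x : Config N => S.multiplier (pos i x) :=
  S.measurable_multiplier.comp (continuous_pos i).measurable

theorem excitation_lt_top {S : BoxData} (h : S.Admissible) {N : ℕ} (i : Fin N) (Ψ : bosonic N) :
    S.excitation i (wave Ψ) < ⊤ := by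
  refine (lintegral_actOn_projQ_le h.side_pos i (stronglyMeasurable_wave Ψ)
    (memLp_wave Ψ)).trans_lt ?_
  rw [lintegral_wave]
  exact ENNReal.pow_lt_top enorm_lt_top

theorem integrable_excitation {S : BoxData} (h : S.Admissible) {N : ℕ} (i : Fin N)
    (Ψ : bosonic N) : Integrable fun x => (1 : ℝ) * ‖actOn i S.projQ (wave Ψ) x‖ ^ 2 := by
  refine integrable_weight_of_lintegral_lt_top aestronglyMeasurable_const (fun _ => zero_le_one)
    (S.stronglyMeasurable_actOn_projQ i (stronglyMeasurable_wave Ψ)).aestronglyMeasurable ?_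
  simpa [excitation] using excitation_lt_top h i Ψ

theorem integrable_kineticEnergy {S : BoxData} (h : S.Admissible) {N : ℕ} (i : Fin N)
    {Ψ : bosonic N} (hΨ : Ψ ∈ S.formDomain N) :
    Integrable fun x => S.multiplier (pos i x) * ‖actOn i S.fourierChiQ (wave Ψ) x‖ ^ 2 :=
  integrable_weight_of_lintegral_lt_top (S.measurable_multiplier_pos i).aestronglyMeasurable
    (fun _ => S.multiplier_nonneg _)
    (stronglyMeasurable_actOn_fourierChiQ h.loc i (stronglyMeasurable_wave Ψ)).aestronglyMeasurable
    (hΨ.1 i)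

theorem aestronglyMeasurable_pairSum_w {S : BoxData} (h : S.Admissible) (N : ℕ) :
    AEStronglyMeasurable (pairSum S.w : Config N → ℝ) volume :=
  aestronglyMeasurable_pairSum fun _ _ hij => aestronglyMeasurable_w h hij

theorem integrable_pairEnergy {S : BoxData} (h : S.Admissible) {N : ℕ}
    {Ψ : bosonic N} (hΨ : Ψ ∈ S.formDomain N) :
    Integrable fun x => pairSum S.w x * ‖wave Ψ x‖ ^ 2 :=
  integrable_weight_of_lintegral_lt_top (aestronglyMeasurable_pairSum_w h N)
    (pairSum_nonneg (w_nonneg h)) (stronglyMeasurable_wave Ψ).aestronglyMeasurable hΨ.2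

theorem measurable_sum_background {S : BoxData} (h : S.Admissible) (N : ℕ) :
    Measurable fun x : Config N => ∑ i : Fin N, S.background (pos i x) :=
  Finset.measurable_sum _ fun i _ => (measurable_background h).comp (continuous_pos i).measurable

theorem abs_sum_background_le {S : BoxData} {M : ℝ} (hM : ∀ x, |S.background x| ≤ M) {N : ℕ}
    (x : Config N) : |∑ i : Fin N, S.background (pos i x)| ≤ N * M := by
  refine (Finset.abs_sum_le_sum_abs _ _).trans ?_
  refine (Finset.sum_le_sum fun i _ => hM (pos i x)).trans (le_of_eq ?_)
  simp

theorem integrable_backgroundEnergy {S : BoxData} (h : S.Admissible) {N : ℕ} (Ψ : bosonic N) :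
    Integrable fun x => (∑ i : Fin N, S.background (pos i x)) * ‖wave Ψ x‖ ^ 2 := by
  obtain ⟨M, -, hM⟩ := exists_abs_background_le h
  exact (integrable_norm_sq_wave Ψ).bdd_mul (c := N * M)
    (measurable_sum_background h N).aestronglyMeasurable
    (Eventually.of_forall fun x => abs_sum_background_le hM x)

theorem potential_eq (S : BoxData) {N : ℕ} (x : Config N) :
    S.potential x = -S.ρ * (∑ i : Fin N, S.background (pos i x)) + pairSum S.w x := by
  rw [potential, Finset.mul_sum]
  rfl

theorem integrable_potential {S : BoxData} (h : S.Admissible) {N : ℕ}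
    {Ψ : bosonic N} (hΨ : Ψ ∈ S.formDomain N) :
    Integrable fun x => S.potential x * ‖wave Ψ x‖ ^ 2 := by
  have := ((integrable_backgroundEnergy h Ψ).const_mul (-S.ρ)).add (integrable_pairEnergy h hΨ)
  refine this.congr (Eventually.of_forall fun x => ?_)
  simp only [Pi.add_apply, potential_eq]
  ring

/-- The form domain is closed under real linear combinations, and the form is quadratic on it. -/
theorem form_sub_smul {S : BoxData} (h : S.Admissible) {N : ℕ} {Φ Ψ : bosonic N}
    (hΦ : Φ ∈ S.formDomain N) (hΨ : Ψ ∈ S.formDomain N) (s : ℝ) :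
    Φ - (s : ℂ) • Ψ ∈ S.formDomain N ∧
    (S.form (Φ - (s : ℂ) • Ψ) (Φ - (s : ℂ) • Ψ)).re =
      (S.form Φ Φ).re - 2 * s * (S.form Φ Ψ).re + s ^ 2 * (S.form Ψ Ψ).re := by
  have hΦm := stronglyMeasurable_wave Φ
  have hΨm := stronglyMeasurable_wave Ψ
  have hm := stronglyMeasurable_wave (Φ - (s : ℂ) • Ψ)
  have hw := wave_sub_smul Φ Ψ (s : ℂ)
  have hsm : StronglyMeasurable fun x => wave Φ x - (s : ℂ) * wave Ψ x := hΦm.sub (hΨm.const_mul _)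
  have hK : ∀ i : Fin N, _ := fun i => integral_weight_sub_smul
    (S.measurable_multiplier_pos i).aestronglyMeasurable
    (stronglyMeasurable_actOn_fourierChiQ h.loc i hΦm).aestronglyMeasurable
    (stronglyMeasurable_actOn_fourierChiQ h.loc i hΨm).aestronglyMeasurable
    (integrable_kineticEnergy h i hΦ) (integrable_kineticEnergy h i hΨ) s
    ((actOn_fourierChiQ_congr h.loc i hm hsm hw).trans
      (actOn_fourierChiQ_sub_smul h.loc h.side_pos i hΦm hΨm (memLp_wave Φ) (memLp_wave Ψ) s))
  have hE : ∀ i : Fin N, _ := fun i => integral_weight_sub_smul (V := fun _ => 1)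
    aestronglyMeasurable_const
    (S.stronglyMeasurable_actOn_projQ i hΦm).aestronglyMeasurable
    (S.stronglyMeasurable_actOn_projQ i hΨm).aestronglyMeasurable
    (integrable_excitation h i Φ) (integrable_excitation h i Ψ) s
    ((S.actOn_projQ_congr i hm hsm hw).trans
      (S.actOn_projQ_sub_smul i hΦm hΨm (memLp_wave Φ) (memLp_wave Ψ) s))
  have hP := integral_weight_sub_smul (aestronglyMeasurable_pairSum_w h N)
    hΦm.aestronglyMeasurable hΨm.aestronglyMeasurable (integrable_pairEnergy h hΦ)
    (integrable_pairEnergy h hΨ) s hw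
  have hVm : AEStronglyMeasurable (S.potential : Config N → ℝ) volume := by
    have := ((measurable_sum_background h N).const_mul (-S.ρ)).aestronglyMeasurable.add
      (aestronglyMeasurable_pairSum_w h N)
    exact this.congr (Eventually.of_forall fun x => (S.potential_eq x).symm)
  have hV := integral_weight_sub_smul hVm
    hΦm.aestronglyMeasurable hΨm.aestronglyMeasurable (integrable_potential h hΦ)
    (integrable_potential h hΨ) s hw
  refine ⟨⟨fun i => ?_, ?_⟩, ?_⟩
  · have := (hK i).1.2
    rw [hasFiniteIntegral_iff_ofReal (Eventually.of_forall fun x =>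
      mul_nonneg (S.multiplier_nonneg _) (sq_nonneg _))] at this
    refine lt_of_le_of_lt (le_of_eq (lintegral_congr fun x => ?_)) this
    rw [ENNReal.ofReal_mul (S.multiplier_nonneg _), ENNReal.ofReal_pow (norm_nonneg _), ofReal_norm]
  · have := hP.1.2
    rw [hasFiniteIntegral_iff_ofReal (Eventually.of_forall fun x =>
      mul_nonneg (pairSum_nonneg (w_nonneg h) _) (sq_nonneg _))] at this
    refine lt_of_le_of_lt (le_of_eq (lintegral_congr fun x => ?_)) this
    rw [ENNReal.ofReal_mul (pairSum_nonneg (w_nonneg h) _), ENNReal.ofReal_pow (norm_nonneg _),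
      ofReal_norm]
  · simp only [Complex.ofReal_one, one_mul] at hE
    simp only [form, Complex.add_re, Complex.re_sum, Complex.re_ofReal_mul, hV.2,
      fun i => (hK i).2, fun i => (hE i).2]
    simp only [Finset.sum_add_distrib, Finset.sum_sub_distrib, ← Finset.mul_sum]
    ring

theorem form_self_re {S : BoxData} (h : S.Admissible) {N : ℕ} {Ψ : bosonic N}
    (hΨ : Ψ ∈ S.formDomain N) :
    (S.form Ψ Ψ).re = (∑ i : Fin N, ((S.kineticEnergy i (wave Ψ)).toReal +
        S.b * (S.ℓ ^ 2)⁻¹ * (S.excitation i (wave Ψ)).toReal)) +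
      (S.pairEnergy (wave Ψ)).toReal - S.ρ * S.backgroundEnergy (wave Ψ) := by
  have hΨm := stronglyMeasurable_wave Ψ
  have h1 : ∀ i : Fin N, (S.kineticEnergy i (wave Ψ)).toReal = _ := fun i =>
    toReal_lintegral_weight (S.measurable_multiplier_pos i).aestronglyMeasurable
    (fun _ => S.multiplier_nonneg _)
    (stronglyMeasurable_actOn_fourierChiQ h.loc i hΨm).aestronglyMeasurable
  have h2 : ∀ i : Fin N, (S.excitation i (wave Ψ)).toReal =
      ∫ x, 1 * ‖actOn i S.projQ (wave Ψ) x‖ ^ 2 := fun i => by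
    rw [← toReal_lintegral_weight aestronglyMeasurable_const (fun _ => zero_le_one)
      (S.stronglyMeasurable_actOn_projQ i hΨm).aestronglyMeasurable]
    simp [excitation]
  have h3 : (S.pairEnergy (wave Ψ)).toReal = _ :=
    toReal_lintegral_weight (aestronglyMeasurable_pairSum_w h N)
    (pairSum_nonneg (w_nonneg h)) hΨm.aestronglyMeasurable
  have h4 : ∀ i : Fin N, (∫ x, starRingEnd ℂ (actOn i S.projQ (wave Ψ) x) *
      actOn i S.projQ (wave Ψ) x).re = ∫ x, 1 * ‖actOn i S.projQ (wave Ψ) x‖ ^ 2 := fun i => by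
    rw [← integral_weight_self]; simp
  have h5 : ∫ x, S.potential x * ‖wave Ψ x‖ ^ 2 =
      -S.ρ * S.backgroundEnergy (wave Ψ) + ∫ x, pairSum S.w x * ‖wave Ψ x‖ ^ 2 := by
    rw [backgroundEnergy, ← integral_const_mul,
      ← integral_add ((integrable_backgroundEnergy h Ψ).const_mul _) (integrable_pairEnergy h hΨ)]
    refine integral_congr_ae (Eventually.of_forall fun x => ?_)
    simp only [potential_eq]
    ring
  simp only [form, Complex.add_re, Complex.re_sum, Complex.re_ofReal_mul, integral_weight_self,
    h1, h2, h3, h4, h5]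
  ring

/-- On a fixed number of particles, the form is bounded from below. -/
theorem exists_form_ge {S : BoxData} (h : S.Admissible) (N : ℕ) :
    ∃ M : ℝ, ∀ Ψ ∈ S.formDomain N, -M * ‖Ψ‖ ^ 2 ≤ (S.form Ψ Ψ).re := by
  obtain ⟨M, hM0, hM⟩ := exists_abs_background_le h
  refine ⟨|S.ρ| * (N * M), fun Ψ hΨ => ?_⟩
  rw [form_self_re h hΨ]
  have h1 : |S.backgroundEnergy (wave Ψ)| ≤ N * M * ‖Ψ‖ ^ 2 := by
    rw [← integral_norm_sq_wave, ← integral_const_mul, backgroundEnergy, ← Real.norm_eq_abs]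
    refine (norm_integral_le_integral_norm _).trans (integral_mono
      (integrable_backgroundEnergy h Ψ).norm ((integrable_norm_sq_wave Ψ).const_mul _) fun x => ?_)
    simp only [norm_mul, norm_pow, norm_norm]
    exact mul_le_mul_of_nonneg_right (abs_sum_background_le hM x) (sq_nonneg _)
  have h2 : 0 ≤ ∑ i : Fin N, ((S.kineticEnergy i (wave Ψ)).toReal +
        S.b * (S.ℓ ^ 2)⁻¹ * (S.excitation i (wave Ψ)).toReal) := by
    have := h.b_nonneg
    exact Finset.sum_nonneg fun i _ => by positivity
  have h3 : 0 ≤ (S.pairEnergy (wave Ψ)).toReal := ENNReal.toReal_nonneg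
  have h4 : S.ρ * S.backgroundEnergy (wave Ψ) ≤ |S.ρ| * (N * M * ‖Ψ‖ ^ 2) := by
    refine (le_abs_self _).trans ?_
    rw [abs_mul]
    exact mul_le_mul_of_nonneg_left h1 (abs_nonneg _)
  nlinarith

end BoxData

/-! ### The spectrum and the form -/

/-- If a quadratic form bounded from below has a resolvent at every `t < t₀`, then `t₀` is a lower
bound of the form: at its infimum `m`, a resolvent of norm `a` would make the form at least `m +
1/a`. No spectral theorem is needed. -/
theorem form_ge_of_resolvent {H : Type*} [NormedAddCommGroup H] [InnerProductSpace ℂ H] {D : Set H}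
    {q : H → H → ℂ} (hsub : ∀ Φ ∈ D, ∀ Ψ ∈ D, ∀ s : ℝ, Φ - (s : ℂ) • Ψ ∈ D ∧
      (q (Φ - (s : ℂ) • Ψ) (Φ - (s : ℂ) • Ψ)).re =
        (q Φ Φ).re - 2 * s * (q Φ Ψ).re + s ^ 2 * (q Ψ Ψ).re)
    {M : ℝ} (hM : ∀ Ψ ∈ D, -M * ‖Ψ‖ ^ 2 ≤ (q Ψ Ψ).re) {t₀ : ℝ}
    (hres : ∀ t : ℝ, t < t₀ → ∃ a : ℝ, 0 < a ∧ ∀ Φ, ∃ Y ∈ D, ‖Y‖ ≤ a * ‖Φ‖ ∧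
      ∀ Φ' ∈ D, q Φ' Y = inner ℂ Φ' (Φ + (t : ℂ) • Y)) {Ψ : H} (hΨ : Ψ ∈ D) :
    t₀ * ‖Ψ‖ ^ 2 ≤ (q Ψ Ψ).re := by
  by_contra! hlt
  set B : Set ℝ := {μ | ∀ Φ ∈ D, μ * ‖Φ‖ ^ 2 ≤ (q Φ Φ).re} with hB
  have hpos : 0 < ‖Ψ‖ ^ 2 := by
    rcases (sq_nonneg ‖Ψ‖).lt_or_eq with h0 | h0
    · exact h0
    · have := hM Ψ hΨ
      rw [← h0] at this hlt
      linarith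
  have hne : B.Nonempty := ⟨-M, hM⟩
  have hub : ∀ μ ∈ B, μ ≤ (q Ψ Ψ).re / ‖Ψ‖ ^ 2 := fun μ hμ => by
    rw [le_div_iff₀ hpos]; exact hμ Ψ hΨ
  have hbdd : BddAbove B := ⟨_, hub⟩
  set m := sSup B with hm
  have hmt : m < t₀ := lt_of_le_of_lt (csSup_le hne hub) (by rwa [div_lt_iff₀ hpos])
  have hmB : ∀ Φ ∈ D, m * ‖Φ‖ ^ 2 ≤ (q Φ Φ).re := by
    intro Φ hΦ
    rcases (sq_nonneg ‖Φ‖).lt_or_eq with h0 | h0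
    · rw [← le_div_iff₀ h0]
      exact csSup_le hne fun μ hμ => by rw [le_div_iff₀ h0]; exact hμ Φ hΦ
    · have := hM Φ hΦ
      rw [← h0] at this ⊢
      linarith
  obtain ⟨a, ha, hres⟩ := hres m hmt
  have hbig : m + a⁻¹ ∈ B := by
    intro Φ hΦ
    obtain ⟨Y, hYD, hYa, hY⟩ := hres Φ
    have h1 : (q Φ Y).re = ‖Φ‖ ^ 2 + m * (inner ℂ Φ Y).re := by
      rw [hY Φ hΦ, inner_add_right, inner_smul_right, Complex.add_re, Complex.re_ofReal_mul,
        inner_self_eq_norm_sq_to_K]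
      norm_cast
    have h2 : (q Y Y).re = (inner ℂ Y Φ).re + m * ‖Y‖ ^ 2 := by
      rw [hY Y hYD, inner_add_right, inner_smul_right, Complex.add_re, Complex.re_ofReal_mul,
        inner_self_eq_norm_sq_to_K]
      norm_cast
    have h3 : (inner ℂ Y Φ).re ≤ a * ‖Φ‖ ^ 2 := by
      refine (Complex.re_le_norm _).trans ((norm_inner_le_norm Y Φ).trans ?_)
      nlinarith [norm_nonneg Φ]
    -- `Y` solves `(q - m) Y = Φ`; testing with `Φ - s Y`, the choice `s = 1/a` is optimal
    obtain ⟨h4, h5⟩ := hsub Φ hΦ Y hYD a⁻¹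
    have h6 := hmB _ h4
    have h7 : ‖Φ - ((a⁻¹ : ℝ) : ℂ) • Y‖ ^ 2 =
        ‖Φ‖ ^ 2 - 2 * a⁻¹ * (inner ℂ Φ Y).re + a⁻¹ ^ 2 * ‖Y‖ ^ 2 := by
      rw [norm_sub_sq (𝕜 := ℂ), inner_smul_right, norm_smul, Complex.norm_real,
        Real.norm_of_nonneg (by positivity), RCLike.re_to_complex, Complex.re_ofReal_mul]
      ring
    rw [h5, h7, h1, h2] at h6
    have h8 : a⁻¹ ^ 2 * (inner ℂ Y Φ).re ≤ a⁻¹ * ‖Φ‖ ^ 2 := by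
      calc a⁻¹ ^ 2 * (inner ℂ Y Φ).re ≤ a⁻¹ ^ 2 * (a * ‖Φ‖ ^ 2) := by gcongr
        _ = _ := by field_simp
    nlinarith
  have := le_csSup hbdd hbig
  have : 0 < a⁻¹ := by positivity
  linarith

namespace BoxData

theorem mem_sectorGraph_iff {S : BoxData} {N : ℕ} (Y Z : bosonic N) :
    (Y, Z) ∈ S.sectorGraph N ↔
      Y ∈ S.formDomain N ∧ ∀ Φ ∈ S.formDomain N, S.form Φ Y = inner ℂ Φ Z :=
  Iff.rfl

set_option maxHeartbeats 1000000 in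
/-- A resolvent of the box Hamiltonian restricts to every particle number. -/
theorem exists_sector_resolvent {S : BoxData} {t : ℝ}
    (ht : (t : ℂ) ∉ graphSpectrum S.hamiltonianGraph) (N : ℕ) :
    ∃ a : ℝ, 0 < a ∧ ∀ Φ : bosonic N, ∃ Y ∈ S.formDomain N, ‖Y‖ ≤ a * ‖Φ‖ ∧
      ∀ Φ' ∈ S.formDomain N, S.form Φ' Y = inner ℂ Φ' (Φ + (t : ℂ) • Y) := by
  obtain ⟨A, hA, -⟩ := not_not.1 ht
  refine ⟨‖A‖ + 1, by positivity, fun Φ => ?_⟩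
  have hA' : ∀ f : Fock, (A f N, f N + (t : ℂ) • A f N) ∈ S.sectorGraph N := fun f => hA f N
  simp only [mem_sectorGraph_iff] at hA'
  obtain ⟨h1, h2⟩ := hA' (lp.single 2 N Φ)
  rw [lp.single_apply_self] at h2
  have hnorm : ‖A (lp.single 2 N Φ)‖ ≤ ‖A‖ * ‖(lp.single 2 N Φ : Fock)‖ := A.le_opNorm _
  have hnorm2 : ‖(lp.single 2 N Φ : Fock)‖ = ‖Φ‖ := lp.norm_single (by norm_num) _ _
  have hnorm3 : ‖A (lp.single 2 N Φ) N‖ ≤ ‖A (lp.single 2 N Φ)‖ :=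
    lp.norm_apply_le_norm (by norm_num) _ _
  refine ⟨_, h1, ?_, h2⟩
  rw [hnorm2] at hnorm
  exact hnorm3.trans (hnorm.trans
    (mul_le_mul_of_nonneg_right (le_add_of_nonneg_right zero_le_one) (norm_nonneg Φ)))

/-- A lower bound on the spectrum is a lower bound on the form. -/
theorem form_ge_of_spectrum {S : BoxData} (h : S.Admissible) {t₀ : ℝ}
    (ht : ∀ t : ℝ, t < t₀ → (t : ℂ) ∉ graphSpectrum S.hamiltonianGraph) {N : ℕ} {Ψ : bosonic N}
    (hΨ : Ψ ∈ S.formDomain N) : t₀ * ‖Ψ‖ ^ 2 ≤ (S.form Ψ Ψ).re := by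
  obtain ⟨M, hM⟩ := exists_form_ge h N
  exact form_ge_of_resolvent (fun Φ hΦ Ψ hΨ s => form_sub_smul h hΦ hΨ s) hM
    (fun t htt => exists_sector_resolvent (ht t htt) N) hΨ

/-- A lower bound on the spectrum bounds the energies of arbitrary vectors; outside of the form
domain the right-hand side is infinite. -/
theorem energy_ge_of_spectrum {S : BoxData} (h : S.Admissible) {t₀ : ℝ}
    (ht : ∀ t : ℝ, t < t₀ → (t : ℂ) ∉ graphSpectrum S.hamiltonianGraph) {N : ℕ} (Ψ : bosonic N) :
    ENNReal.ofReal (S.ρ * S.backgroundEnergy (wave Ψ) + t₀ * ‖Ψ‖ ^ 2) ≤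
      (∑ i : Fin N, (S.kineticEnergy i (wave Ψ) +
        ENNReal.ofReal (S.b * (S.ℓ ^ 2)⁻¹) * S.excitation i (wave Ψ))) +
      S.pairEnergy (wave Ψ) := by
  by_cases hΨ : Ψ ∈ S.formDomain N
  · have h1 := form_ge_of_spectrum h ht hΨ
    rw [form_self_re h hΨ] at h1
    have hb : 0 ≤ S.b * (S.ℓ ^ 2)⁻¹ := by have := h.b_nonneg; positivity
    have hk : ∀ i : Fin N, S.kineticEnergy i (wave Ψ) ≠ ⊤ := fun i => (hΨ.1 i).ne
    have he : ∀ i : Fin N, S.excitation i (wave Ψ) ≠ ⊤ := fun i => (excitation_lt_top h i Ψ).ne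
    have hterm : ∀ i : Fin N, S.kineticEnergy i (wave Ψ) +
        ENNReal.ofReal (S.b * (S.ℓ ^ 2)⁻¹) * S.excitation i (wave Ψ) =
        ENNReal.ofReal ((S.kineticEnergy i (wave Ψ)).toReal +
          S.b * (S.ℓ ^ 2)⁻¹ * (S.excitation i (wave Ψ)).toReal) := fun i => by
      rw [ENNReal.ofReal_add ENNReal.toReal_nonneg (by positivity), ENNReal.ofReal_mul hb,
        ENNReal.ofReal_toReal (hk i), ENNReal.ofReal_toReal (he i)]
    have hp : S.pairEnergy (wave Ψ) = ENNReal.ofReal (S.pairEnergy (wave Ψ)).toReal :=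
      (ENNReal.ofReal_toReal hΨ.2.ne).symm
    rw [Finset.sum_congr rfl fun i _ => hterm i, hp,
      ← ENNReal.ofReal_sum_of_nonneg fun i _ => by positivity,
      ← ENNReal.ofReal_add (Finset.sum_nonneg fun i _ => by positivity) ENNReal.toReal_nonneg]
    exact ENNReal.ofReal_le_ofReal (by linarith)
  · have htop : (∑ i : Fin N, (S.kineticEnergy i (wave Ψ) +
        ENNReal.ofReal (S.b * (S.ℓ ^ 2)⁻¹) * S.excitation i (wave Ψ))) +
      S.pairEnergy (wave Ψ) = ⊤ := by
      by_contra hne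
      rw [ENNReal.add_eq_top, not_or] at hne
      refine hΨ ⟨fun i => lt_top_iff_ne_top.2 fun hi => hne.1 ?_, lt_top_iff_ne_top.2 hne.2⟩
      refine ENNReal.sum_eq_top.2 ⟨i, Finset.mem_univ i, ?_⟩
      rw [ENNReal.add_eq_top]
      exact Or.inl hi
    rw [htop]
    exact le_top

theorem wave_zero (N : ℕ) : wave (0 : bosonic N) =ᵐ[volume] fun _ => 0 := Lp.coeFn_zero _ _ _

theorem actOn_fourierChiQ_wave_zero {S : BoxData} (h : S.Admissible) {N : ℕ} (i : Fin N) :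
    actOn i S.fourierChiQ (wave (0 : bosonic N)) =ᵐ[volume] fun _ => 0 := by
  refine (actOn_fourierChiQ_congr h.loc i (stronglyMeasurable_wave _) stronglyMeasurable_const
    (wave_zero N)).trans (Eventually.of_forall fun x => ?_)
  simp [actOn, fourierChiQ, projQ, Real.fourier_eq]

theorem actOn_projQ_wave_zero (S : BoxData) {N : ℕ} (i : Fin N) :
    actOn i S.projQ (wave (0 : bosonic N)) =ᵐ[volume] fun _ => 0 := by
  refine (S.actOn_projQ_congr i (stronglyMeasurable_wave _) stronglyMeasurable_const
    (wave_zero N)).trans (Eventually.of_forall fun x => ?_)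
  simp [actOn, projQ]

theorem zero_mem_sectorGraph {S : BoxData} (h : S.Admissible) (N : ℕ) :
    ((0 : bosonic N), (0 : bosonic N)) ∈ S.sectorGraph N := by
  refine ⟨⟨fun i => ?_, ?_⟩, fun Φ _ => ?_⟩
  · rw [lintegral_eq_zero_of_ae_eq_zero]
    · exact ENNReal.zero_lt_top
    · filter_upwards [actOn_fourierChiQ_wave_zero h i] with x hx
      simp [hx]
  · rw [lintegral_eq_zero_of_ae_eq_zero]
    · exact ENNReal.zero_lt_top
    · filter_upwards [wave_zero N] with x hx
      simp [hx]
  · have h1 : ∀ i : Fin N, ∫ x : Config N, (S.multiplier (pos i x) : ℂ) *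
        starRingEnd ℂ (actOn i S.fourierChiQ (wave Φ) x) *
          actOn i S.fourierChiQ (wave (0 : bosonic N)) x = 0 := fun i =>
      integral_eq_zero_of_ae <| by
        filter_upwards [actOn_fourierChiQ_wave_zero h i] with x hx
        simp [hx]
    have h2 : ∀ i : Fin N, ∫ x : Config N, starRingEnd ℂ (actOn i S.projQ (wave Φ) x) *
          actOn i S.projQ (wave (0 : bosonic N)) x = 0 := fun i =>
      integral_eq_zero_of_ae <| by
        filter_upwards [S.actOn_projQ_wave_zero i] with x hx
        simp [hx]
    have h3 : ∫ x : Config N, (S.potential x : ℂ) * starRingEnd ℂ (wave Φ x) *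
          wave (0 : bosonic N) x = 0 :=
      integral_eq_zero_of_ae <| by
        filter_upwards [wave_zero N] with x hx
        simp [hx]
    simp [form, h1, h2, h3]

theorem bosonic_zero_eq_top : bosonic 0 = ⊤ := by
  refine eq_top_iff.2 fun f _ => ?_
  rw [bosonic, Submodule.mem_iInf]
  intro σ
  rw [LinearMap.mem_eqLocus]
  have h : (permute σ : Config 0 → Config 0) = id := by
    funext x; ext p; exact p.1.elim0
  refine Lp.ext ?_
  have h1 := Lp.coeFn_compMeasurePreserving f (permute σ).measurePreserving
  refine h1.trans (Eventually.of_forall fun x => ?_)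
  simp [h]

/-- The vacuum has energy zero, so that the bottom of the spectrum is at most zero. -/
theorem zero_mem_graphSpectrum {S : BoxData} (h : S.Admissible) :
    ((0 : ℝ) : ℂ) ∈ graphSpectrum S.hamiltonianGraph := by
  rintro ⟨A, -, hA⟩
  obtain ⟨Ω, hΩ⟩ : ∃ Ω : bosonic 0, Ω ≠ 0 := by
    have hfin : volume (Set.univ : Set (Config 0)) ≠ ⊤ := by
      have : (Set.univ : Set (Config 0)) = {0} := by
        ext x; simp [Subsingleton.elim x 0]
      rw [this]
      exact (isCompact_singleton.measure_lt_top).ne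
    refine ⟨⟨indicatorConstLp 2 MeasurableSet.univ hfin (1 : ℂ),
      bosonic_zero_eq_top ▸ Submodule.mem_top⟩, fun h0 => ?_⟩
    have h1 := congrArg norm (congrArg Subtype.val h0)
    simp only [norm_indicatorConstLp (p := 2) (by norm_num) (by norm_num)] at h1
    have hpos : (volume : Measure (Config 0)).real Set.univ ≠ 0 := by
      rw [measureReal_def, ENNReal.toReal_ne_zero]
      exact ⟨(isOpen_univ.measure_pos _ ⟨0, trivial⟩).ne', hfin⟩
    have : 0 < (volume : Measure (Config 0)).real Set.univ :=
      lt_of_le_of_ne measureReal_nonneg hpos.symm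
    simp at h1
    exact hpos h1
  have hmem : ((lp.single 2 0 Ω : Fock), (0 : Fock)) ∈ S.hamiltonianGraph := by
    intro N
    rcases Nat.eq_zero_or_pos N with rfl | hN
    · simp only [lp.single_apply_self]
      refine ⟨⟨fun i => i.elim0, by simp [pairSum]⟩, fun Φ _ => ?_⟩
      simp [form, potential, pairSum]
    · have h1 : (lp.single 2 0 Ω : Fock) N = 0 :=
        lp.single_apply_ne (E := fun N => bosonic N) 2 0 Ω hN.ne'
      change ((lp.single 2 0 Ω : Fock) N, (0 : bosonic N)) ∈ S.sectorGraph N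
      rw [h1]
      exact zero_mem_sectorGraph h N
  have h1 := hA _ hmem
  simp only [Complex.ofReal_zero, zero_smul, sub_zero, map_zero] at h1
  have h2 := congrArg norm h1
  rw [lp.norm_single (by norm_num)] at h2
  rw [norm_zero] at h2
  exact hΩ (norm_eq_zero.1 h2.symm)

end BoxData

/-! ### Translations of configurations -/

/-- The configuration with all particles at `u`. -/
def diag {N : ℕ} (u : Space) : Config N := WithLp.toLp 2 fun p => u p.2

theorem pos_sub_diag {N : ℕ} (i : Fin N) (x : Config N) (u : Space) :
    pos i (x - diag u) = pos i x - u := by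
  ext k; simp [pos, diag]

theorem glue_add_diag {N : ℕ} (i : Fin N) (r : Rest i) (y u : Space) :
    glue i r y + diag u = glue i (r + fun p => u p.1.2) (y + u) := by
  ext p
  by_cases h : p.1 = i <;> simp [glue_apply, diag, h]

theorem permute_diag {N : ℕ} (σ : Equiv.Perm (Fin N)) (u : Space) :
    permute σ (diag u) = diag u := by
  ext p
  simp [permute, diag, LinearIsometryEquiv.piLpCongrLeft_apply, Equiv.piCongrLeft'_apply]

/-- Translating all particles by the same vector preserves the bosonic symmetry. -/
theorem exists_translate {N : ℕ} (Ψ : bosonic N) (u : Space) :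
    ∃ Ψ' : bosonic N, (wave Ψ' =ᵐ[volume] fun x => wave Ψ (x + diag u)) ∧ ‖Ψ'‖ = ‖Ψ‖ := by
  have hmp : MeasurePreserving (fun x : Config N => x + diag u) volume volume :=
    measurePreserving_add_right volume _
  set f : Lp ℂ 2 (volume : Measure (Config N)) := Lp.compMeasurePreserving _ hmp Ψ with hf
  have hfc : f =ᵐ[volume] fun x => wave Ψ (x + diag u) := Lp.coeFn_compMeasurePreserving _ hmp
  have hmem : f ∈ bosonic N := by
    rw [bosonic, Submodule.mem_iInf]
    intro σ
    have hσ : Lp.compMeasurePreserving (permute σ) (permute σ).measurePreserving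
        (Ψ : Lp ℂ 2 (volume : Measure (Config N))) = Ψ :=
      LinearMap.mem_eqLocus.1 ((Submodule.mem_iInf _).1 Ψ.2 σ)
    have hσ' : (fun x => wave Ψ (permute σ x)) =ᵐ[volume] wave Ψ := by
      have h1 := Lp.coeFn_compMeasurePreserving (Ψ : Lp ℂ 2 (volume : Measure (Config N)))
        (permute σ).measurePreserving
      rw [hσ] at h1
      exact h1.symm
    rw [LinearMap.mem_eqLocus]
    refine Lp.ext ?_
    have h2 := Lp.coeFn_compMeasurePreserving f (permute σ).measurePreserving
    refine h2.trans ?_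
    have h3 := (permute σ).measurePreserving.quasiMeasurePreserving.ae_eq_comp hfc
    refine h3.trans (EventuallyEq.trans ?_ hfc.symm)
    have h4 := hmp.quasiMeasurePreserving.ae_eq_comp hσ'
    filter_upwards [h4] with x hx
    simp only [Function.comp_apply, map_add, permute_diag] at hx ⊢
    exact hx
  exact ⟨⟨f, hmem⟩, hfc, Lp.norm_compMeasurePreserving _ hmp⟩

/-! ### Averaging the localized kinetic energy of one particle over all boxes -/

/-- Convergence in `L²` implies convergence of the pairings. -/
theorem tendsto_integral_mul {k f : Space → ℂ} {F : ℕ → Space → ℂ} (hk : MemLp k 2 volume)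
    (hf : MemLp f 2 volume) (hF : ∀ n, MemLp (F n) 2 volume)
    (h : Tendsto (fun n => ∫⁻ y, ‖F n y - f y‖ₑ ^ 2) atTop (𝓝 0)) :
    Tendsto (fun n => ∫ y, k y * F n y) atTop (𝓝 (∫ y, k y * f y)) := by
  rw [tendsto_iff_edist_tendsto_0]
  have hbound : ∀ n, edist (∫ y, k y * F n y) (∫ y, k y * f y) ≤
      (∫⁻ y, ‖k y‖ₑ ^ (2 : ℝ)) ^ (1 / (2 : ℝ)) * (∫⁻ y, ‖F n y - f y‖ₑ ^ 2) ^ (1 / (2 : ℝ)) := by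
    intro n
    have i1 : Integrable fun y => k y * F n y := hk.integrable_mul (hF n)
    have i2 : Integrable fun y => k y * f y := hk.integrable_mul hf
    rw [edist_eq_enorm_sub, ← integral_sub i1 i2]
    refine (enorm_integral_le_lintegral_enorm _).trans ?_
    have hH := ENNReal.lintegral_mul_le_Lp_mul_Lq (volume : Measure Space)
      (Real.HolderConjugate.two_two) hk.aestronglyMeasurable.enorm
      ((hF n).sub hf).aestronglyMeasurable.enorm
    simp only [Pi.mul_apply, Pi.sub_apply, ENNReal.rpow_ofNat] at hH ⊢
    refine le_trans (le_of_eq (lintegral_congr fun y => ?_)) hH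
    rw [← mul_sub, enorm_mul]
  have hkfin : (∫⁻ y, ‖k y‖ₑ ^ (2 : ℝ)) ^ (1 / (2 : ℝ)) ≠ ⊤ := by
    have h1 := hk.eLpNorm_lt_top
    rw [eLpNorm_lt_top_iff_lintegral_rpow_enorm_lt_top (by norm_num) (by norm_num)] at h1
    exact ENNReal.rpow_ne_top_of_nonneg (by norm_num) (by simpa using h1.ne)
  have hlim : Tendsto (fun n => (∫⁻ y, ‖k y‖ₑ ^ (2 : ℝ)) ^ (1 / (2 : ℝ)) *
      (∫⁻ y, ‖F n y - f y‖ₑ ^ 2) ^ (1 / (2 : ℝ))) atTop (𝓝 0) := by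
    have h1 := (ENNReal.continuous_rpow_const (y := 1 / (2 : ℝ))).tendsto 0 |>.comp h
    have h2 := ENNReal.Tendsto.const_mul h1 (Or.inr hkfin)
    simpa using h2
  exact tendsto_of_tendsto_of_tendsto_of_le_of_le tendsto_const_nhds hlim
    (fun _ => zero_le) hbound

namespace BoxData

/-- The density of the localized kinetic energy of particle `i` in the remaining particles `r`, the
translation `u` and a variable `q`, which is a momentum in the first and a position in the second
summand. -/
noncomputable def kineticDensity (S : BoxData) {N : ℕ} (i : Fin N) (f : Config N → ℂ)
    (z : Rest i × (Space × Space)) : ℝ≥0∞ :=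
  ENNReal.ofReal (S.multiplier z.2.2) *
      ‖∫ y, S.kernel z.2.2 y * f (glue i z.1 (y + z.2.1))‖ₑ ^ 2 +
    ENNReal.ofReal (S.b * (S.ℓ ^ 2)⁻¹) *
      ‖S.projQ (fun y => f (glue i z.1 (y + z.2.1))) z.2.2‖ₑ ^ 2

theorem measurable_kernel_part {S : BoxData} (h : S.Admissible) {N : ℕ} (i : Fin N)
    {f : Config N → ℂ} (hf : StronglyMeasurable f) :
    Measurable fun z : Rest i × (Space × Space) => ENNReal.ofReal (S.multiplier z.2.2) *
      ‖∫ y, S.kernel z.2.2 y * f (glue i z.1 (y + z.2.1))‖ₑ ^ 2 := by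
  have h1 : Measurable fun z : Rest i × (Space × Space) => S.multiplier z.2.2 :=
    S.measurable_multiplier.comp (by fun_prop)
  have h2 : Measurable fun w : (Rest i × (Space × Space)) × Space => S.kernel w.1.2.2 w.2 :=
    measurable_kernel h.loc h.side_pos (by fun_prop) measurable_snd
  have h3 : Measurable fun w : (Rest i × (Space × Space)) × Space => (w.1.1, w.2 + w.1.2.1) := by
    fun_prop
  have h4 : Measurable fun w : (Rest i × (Space × Space)) × Space =>
      f (glue i w.1.1 (w.2 + w.1.2.1)) := hf.measurable.comp ((measurable_glue i).comp h3)
  have h5 := Measurable.mul h2 h4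
  have h6 := h5.stronglyMeasurable.integral_prod_right' (ν := (volume : Measure Space))
  exact h1.ennreal_ofReal.mul (h6.enorm.pow_const 2)

theorem measurable_projQ_part (S : BoxData) {N : ℕ} (i : Fin N)
    {f : Config N → ℂ} (hf : StronglyMeasurable f) :
    Measurable fun z : Rest i × (Space × Space) => ENNReal.ofReal (S.b * (S.ℓ ^ 2)⁻¹) *
      ‖S.projQ (fun y => f (glue i z.1 (y + z.2.1))) z.2.2‖ₑ ^ 2 := by
  have h3 : Measurable fun w : (Rest i × (Space × Space)) × Space => (w.1.1, w.2 + w.1.2.1) := by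
    fun_prop
  have h4 : StronglyMeasurable (Function.uncurry fun (z : Rest i × (Space × Space)) y =>
      f (glue i z.1 (y + z.2.1))) := hf.comp_measurable ((measurable_glue i).comp h3)
  have h5 : Measurable fun z : Rest i × (Space × Space) => (z.1, z.2.2 + z.2.1) := by fun_prop
  have h6 : Measurable fun z : Rest i × (Space × Space) => f (glue i z.1 (z.2.2 + z.2.1)) :=
    hf.measurable.comp ((measurable_glue i).comp h5)
  have h7 := S.measurable_projQ h4 (measurable_snd.comp measurable_snd) h6
  exact (h7.enorm.pow_const 2).const_mul _

theorem measurable_kineticDensity {S : BoxData} (h : S.Admissible) {N : ℕ} (i : Fin N)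
    {f : Config N → ℂ} (hf : StronglyMeasurable f) : Measurable (S.kineticDensity i f) :=
  (measurable_kernel_part h i hf).add (S.measurable_projQ_part i hf)

theorem kineticEnergy_translate_eq {S : BoxData} (h : S.Admissible) {N : ℕ} (i : Fin N)
    {f : Config N → ℂ} (hf : StronglyMeasurable f) (hf2 : MemLp f 2 volume) (u : Space) :
    S.kineticEnergy i (fun x => f (x + diag u)) = ∫⁻ r : Rest i, ∫⁻ q,
      ENNReal.ofReal (S.multiplier q) * ‖∫ y, S.kernel q y * f (glue i r (y + u))‖ₑ ^ 2 := by
  have hfu : StronglyMeasurable fun x => f (x + diag u) :=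
    hf.comp_measurable (measurable_add_const _)
  have hm : Measurable fun x : Config N => ENNReal.ofReal (S.multiplier (pos i x)) *
      ‖actOn i S.fourierChiQ (fun x => f (x + diag u)) x‖ₑ ^ 2 :=
    (S.measurable_multiplier_pos i).ennreal_ofReal.mul
      ((stronglyMeasurable_actOn_fourierChiQ h.loc i hfu).enorm.pow_const 2)
  rw [kineticEnergy, lintegral_glue i hm.aemeasurable]
  simp only [actOn_glue, pos_glue, glue_add_diag]
  rw [lintegral_add_right_eq_self (fun r : Rest i => ∫⁻ q, ENNReal.ofReal (S.multiplier q) *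
    ‖S.fourierChiQ (fun y => f (glue i r (y + u))) q‖ₑ ^ 2)]
  refine lintegral_congr_ae ?_
  filter_upwards [ae_memLp_glue i hf hf2] with r hr
  have h1 : MemLp (fun y => f (glue i r (y + u))) 2 volume :=
    hr.comp_measurePreserving (measurePreserving_add_right volume u)
  refine lintegral_congr fun q => ?_
  rw [fourierChiQ_eq h.loc h.side_pos (integrableOn_cube_of_memLp h1 _) q]

theorem excitation_translate_eq (S : BoxData) {N : ℕ} (i : Fin N)
    {f : Config N → ℂ} (hf : StronglyMeasurable f) (u : Space) :
    S.excitation i (fun x => f (x + diag u)) = ∫⁻ r : Rest i, ∫⁻ q,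
      ‖S.projQ (fun y => f (glue i r (y + u))) q‖ₑ ^ 2 := by
  have hfu : StronglyMeasurable fun x => f (x + diag u) :=
    hf.comp_measurable (measurable_add_const _)
  rw [excitation, lintegral_glue i
    ((S.stronglyMeasurable_actOn_projQ i hfu).enorm.pow_const 2).aemeasurable]
  simp only [actOn_glue, glue_add_diag]
  rw [lintegral_add_right_eq_self (fun r : Rest i => ∫⁻ q,
    ‖S.projQ (fun y => f (glue i r (y + u))) q‖ₑ ^ 2)]

/-- The localized kinetic energy of a translate, as an integral over the remaining particles. -/
theorem kineticEnergy_translate {S : BoxData} (h : S.Admissible) {N : ℕ} (i : Fin N)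
    {f : Config N → ℂ} (hf : StronglyMeasurable f) (hf2 : MemLp f 2 volume) (u : Space) :
    S.kineticEnergy i (fun x => f (x + diag u)) +
        ENNReal.ofReal (S.b * (S.ℓ ^ 2)⁻¹) * S.excitation i (fun x => f (x + diag u)) =
      ∫⁻ r, ∫⁻ q, S.kineticDensity i f (r, (u, q)) := by
  set A : Rest i × (Space × Space) → ℝ≥0∞ := fun z => ENNReal.ofReal (S.multiplier z.2.2) *
      ‖∫ y, S.kernel z.2.2 y * f (glue i z.1 (y + z.2.1))‖ₑ ^ 2 with hA
  have hAm : Measurable A := measurable_kernel_part h i hf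
  have hm : Measurable fun w : Rest i × Space => (w.1, (u, w.2)) := by fun_prop
  have hm1 : Measurable fun w : Rest i × Space => A (w.1, (u, w.2)) := hAm.comp hm
  have hm2 : Measurable fun r : Rest i => ∫⁻ q, A (r, (u, q)) := hm1.lintegral_prod_right'
  have hm3 : ∀ r : Rest i, Measurable fun q => A (r, (u, q)) := fun r => by
    have hr : Measurable fun q : Space => (r, (u, q)) := by fun_prop
    exact hAm.comp hr
  have hk : S.kineticEnergy i (fun x => f (x + diag u)) = ∫⁻ r : Rest i, ∫⁻ q, A (r, (u, q)) :=
    kineticEnergy_translate_eq h i hf hf2 u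
  clear_value A
  rw [hk, S.excitation_translate_eq i hf,
    ← lintegral_const_mul' _ _ ENNReal.ofReal_ne_top, ← lintegral_add_left hm2]
  refine lintegral_congr fun r => ?_
  rw [← lintegral_const_mul' _ _ ENNReal.ofReal_ne_top, ← lintegral_add_left (hm3 r)]
  simp only [kineticDensity, hA]

theorem measurable_kineticEnergy_translate {S : BoxData} (h : S.Admissible) {N : ℕ} (i : Fin N)
    {f : Config N → ℂ} (hf : StronglyMeasurable f) :
    Measurable fun u => ∫⁻ r, ∫⁻ q, S.kineticDensity i f (r, (u, q)) := by
  have hm : Measurable fun w : (Space × Rest i) × Space => (w.1.2, (w.1.1, w.2)) := by fun_prop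
  have h1 : Measurable fun w : (Space × Rest i) × Space =>
      S.kineticDensity i f (w.1.2, (w.1.1, w.2)) := (measurable_kineticDensity h i hf).comp hm
  have h2 : Measurable fun w : Space × Rest i =>
      ∫⁻ q, S.kineticDensity i f (w.2, (w.1, q)) := h1.lintegral_prod_right'
  exact h2.lintegral_prod_right'

/-- The average over all translates. -/
theorem lintegral_kineticEnergy_translate {S : BoxData} (h : S.Admissible) {N : ℕ} (i : Fin N)
    {f : Config N → ℂ} (hf : StronglyMeasurable f) :
    ∫⁻ u, ∫⁻ r, ∫⁻ q, S.kineticDensity i f (r, (u, q)) =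
      ∫⁻ z, S.kineticDensity i f z ∂(volume.prod (volume.prod volume)) := by
  have hm := measurable_kineticDensity h i hf
  rw [lintegral_prod _ hm.aemeasurable, lintegral_lintegral_swap]
  · refine lintegral_congr fun r => ?_
    have hr : Measurable fun w : Space × Space => (r, w) := by fun_prop
    have hm2 : Measurable fun w : Space × Space => S.kineticDensity i f (r, w) := hm.comp hr
    exact (lintegral_prod (fun w => S.kineticDensity i f (r, w)) hm2.aemeasurable).symm
  · have hm' : Measurable fun w : (Space × Rest i) × Space => (w.1.2, (w.1.1, w.2)) := by fun_prop
    have h1 : Measurable fun w : (Space × Rest i) × Space =>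
      S.kineticDensity i f (w.1.2, (w.1.1, w.2)) := hm.comp hm'
    exact h1.lintegral_prod_right'.aemeasurable

end BoxData

/-! ### The averaged kinetic energy is at most the Dirichlet energy -/

/-- The linear part of gluing in the variable of particle `i`. -/
noncomputable def glueL {N : ℕ} (i : Fin N) : Space →L[ℝ] Config N :=
  LinearMap.toContinuousLinearMap
    { toFun := glue i 0
      map_add' := fun y z => by
        ext p; by_cases h : p.1 = i <;> simp [glue_apply, h]
      map_smul' := fun c y => by
        ext p; by_cases h : p.1 = i <;> simp [glue_apply, h] }

theorem glueL_apply {N : ℕ} (i : Fin N) (y : Space) : glueL i y = glue i 0 y := rfl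

theorem glueL_single {N : ℕ} (i : Fin N) (k : Fin 3) :
    glueL i (EuclideanSpace.single k 1) = EuclideanSpace.single (i, k) (1 : ℝ) := by
  ext ⟨j, m⟩
  by_cases h : j = i
  · subst h
    simp [glueL_apply, glue_apply]
  · simp [glueL_apply, glue_apply, h]

theorem hasFDerivAt_glue {N : ℕ} (i : Fin N) (r : Rest i) (y : Space) :
    HasFDerivAt (glue i r) (glueL i) y := by
  have h : glue i r = fun y => glueL i y + glue i r 0 := by
    funext y; ext p
    by_cases h : p.1 = i <;> simp [glueL_apply, glue_apply, h]
  rw [h]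
  exact (glueL i).hasFDerivAt.add_const _

theorem contDiff_glue {N : ℕ} (i : Fin N) (r : Rest i) :
    ContDiff ℝ (⊤ : ℕ∞) (glue i r) := by
  have h : glue i r = fun y => glueL i y + glue i r 0 := by
    funext y; ext p
    by_cases h : p.1 = i <;> simp [glueL_apply, glue_apply, h]
  rw [h]
  exact (glueL i).contDiff.add contDiff_const

theorem hasCompactSupport_comp_glue {N : ℕ} (i : Fin N) (r : Rest i) {φ : Config N → ℂ}
    (hφ : HasCompactSupport φ) : HasCompactSupport fun y => φ (glue i r y) := by
  refine HasCompactSupport.intro (hφ.isCompact.image (continuous_pos i)) fun y hy => ?_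
  by_contra hne
  exact hy ⟨glue i r y, subset_tsupport _ hne, pos_glue i r y⟩

theorem fderiv_comp_glue {N : ℕ} (i : Fin N) (r : Rest i) {φ : Config N → ℂ}
    (hφ : ContDiff ℝ (⊤ : ℕ∞) φ) (y : Space) (k : Fin 3) :
    fderiv ℝ (fun y => φ (glue i r y)) y (EuclideanSpace.single k 1) =
      fderiv ℝ φ (glue i r y) (EuclideanSpace.single (i, k) 1) := by
  have h1 := (hφ.differentiable (by norm_num) (glue i r y)).hasFDerivAt.comp y
    (hasFDerivAt_glue i r y)
  have h2 : fderiv ℝ (fun y => φ (glue i r y)) y =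
      (fderiv ℝ φ (glue i r y)).comp (glueL i) := h1.fderiv
  rw [h2, ContinuousLinearMap.comp_apply, glueL_single]

theorem memLp_two_of_bounded {f : Space → ℂ} (hf : Integrable f) {M : ℝ} (hM : ∀ x, ‖f x‖ ≤ M) :
    MemLp f 2 volume := by
  rw [memLp_two_iff_integrable_sq_norm hf.aestronglyMeasurable]
  refine (hf.norm.const_mul M).mono (hf.aestronglyMeasurable.norm.pow 2)
    (Eventually.of_forall fun x => ?_)
  rw [Real.norm_of_nonneg (by positivity), sq]
  exact (mul_le_mul_of_nonneg_right (hM x) (norm_nonneg _)).trans (le_abs_self _)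

namespace BoxData

/-- The bound for one fixed configuration of the other particles. -/
theorem lintegral_kineticDensity_slice_le {S : BoxData} (h : S.Admissible) (hS : S.SymbolBound)
    {N : ℕ} (i : Fin N) {φ : Config N → ℂ} (hφ : ContDiff ℝ (⊤ : ℕ∞) φ)
    (hφc : HasCompactSupport φ) (r : Rest i) :
    ∫⁻ u, ∫⁻ q, S.kineticDensity i φ (r, (u, q)) ≤ ENNReal.ofReal (S.ℓ ^ 3) *
      ∑ k, ∫⁻ y, ‖fderiv ℝ φ (glue i r y) (EuclideanSpace.single (i, k) 1)‖ₑ ^ 2 := by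
  have h1 := lintegral_localized_kinetic_le h.loc h.side_pos h.b_nonneg hS
    (hφ.comp (contDiff_glue i r)) (hasCompactSupport_comp_glue i r hφc)
  have hd : ∀ y k, fderiv ℝ (φ ∘ glue i r) y (EuclideanSpace.single k 1) =
      fderiv ℝ φ (glue i r y) (EuclideanSpace.single (i, k) 1) :=
    fun y k => fderiv_comp_glue i r hφ y k
  simp only [hd, Function.comp_apply] at h1
  refine le_trans (le_of_eq ?_) h1
  set A : Rest i × (Space × Space) → ℝ≥0∞ := fun z => ENNReal.ofReal (S.multiplier z.2.2) *
      ‖∫ y, S.kernel z.2.2 y * φ (glue i z.1 (y + z.2.1))‖ₑ ^ 2 with hA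
  have hAm : Measurable A := measurable_kernel_part h i hφ.continuous.stronglyMeasurable
  have hr : Measurable fun w : Space × Space => (r, w) := by fun_prop
  have hm1 : Measurable fun w : Space × Space => A (r, w) := hAm.comp hr
  have hm2 : Measurable fun u => ∫⁻ q, A (r, (u, q)) := hm1.lintegral_prod_right'
  have hm3 : ∀ u, Measurable fun q => A (r, (u, q)) := fun u => by
    have hr : Measurable fun q : Space => (u, q) := by fun_prop
    exact hm1.comp hr
  have hk : ∫⁻ u, ∫⁻ q, ENNReal.ofReal (S.multiplier q) *
      ‖∫ x, S.kernel q x * φ (glue i r (x + u))‖ₑ ^ 2 = ∫⁻ u, ∫⁻ q, A (r, (u, q)) := rfl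
  have hD : ∀ z, S.kineticDensity i φ z = A z + ENNReal.ofReal (S.b * (S.ℓ ^ 2)⁻¹) *
      ‖S.projQ (fun y => φ (glue i z.1 (y + z.2.1))) z.2.2‖ₑ ^ 2 := fun z => rfl
  rw [hk]
  clear_value A
  rw [← lintegral_const_mul' _ _ ENNReal.ofReal_ne_top, ← lintegral_add_left hm2]
  refine lintegral_congr fun u => ?_
  rw [← lintegral_const_mul' _ _ ENNReal.ofReal_ne_top, ← lintegral_add_left (hm3 u)]
  exact lintegral_congr fun q => hD _

/-- The averaged kinetic energy of a test function. -/
theorem lintegral_kineticDensity_le_of_contDiff {S : BoxData} (h : S.Admissible)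
    (hS : S.SymbolBound) {N : ℕ} (i : Fin N) {φ : Config N → ℂ} (hφ : ContDiff ℝ (⊤ : ℕ∞) φ)
    (hφc : HasCompactSupport φ) :
    ∫⁻ z, S.kineticDensity i φ z ∂(volume.prod (volume.prod volume)) ≤
      ENNReal.ofReal (S.ℓ ^ 3) *
        ∑ k, ∫⁻ x, ‖fderiv ℝ φ x (EuclideanSpace.single (i, k) 1)‖ₑ ^ 2 := by
  have hm := measurable_kineticDensity h i hφ.continuous.stronglyMeasurable
  have hd : ∀ k, Measurable fun x => ‖fderiv ℝ φ x (EuclideanSpace.single (i, k) 1)‖ₑ ^ 2 :=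
    fun k => ((hφ.continuous_fderiv (by norm_num)).clm_apply
      continuous_const).measurable.enorm.pow_const 2
  have hd2 : ∀ k, Measurable fun r : Rest i =>
      ∫⁻ y, ‖fderiv ℝ φ (glue i r y) (EuclideanSpace.single (i, k) 1)‖ₑ ^ 2 := fun k => by
    have h1 : Measurable fun z : Rest i × Space =>
        ‖fderiv ℝ φ (glue i z.1 z.2) (EuclideanSpace.single (i, k) 1)‖ₑ ^ 2 :=
      (hd k).comp (measurable_glue i)
    exact h1.lintegral_prod_right'
  have hs : ∀ k, ∫⁻ x, ‖fderiv ℝ φ x (EuclideanSpace.single (i, k) 1)‖ₑ ^ 2 = ∫⁻ r : Rest i,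
      ∫⁻ y, ‖fderiv ℝ φ (glue i r y) (EuclideanSpace.single (i, k) 1)‖ₑ ^ 2 :=
    fun k => lintegral_glue i (hd k).aemeasurable
  simp only [hs]
  rw [← lintegral_finsetSum _ fun k _ => hd2 k, ← lintegral_const_mul' _ _ ENNReal.ofReal_ne_top,
    lintegral_prod _ hm.aemeasurable]
  refine lintegral_mono fun r => ?_
  have hr : Measurable fun w : Space × Space => (r, w) := by fun_prop
  have hm2 : Measurable fun w : Space × Space => S.kineticDensity i φ (r, w) := hm.comp hr
  rw [lintegral_prod (fun w => S.kineticDensity i φ (r, w)) hm2.aemeasurable]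
  exact lintegral_kineticDensity_slice_le h hS i hφ hφc r

/-- Convergence of the slices in `L²` and pointwise gives convergence of the density of the
localized kinetic energy. -/
theorem tendsto_kineticDensity {S : BoxData} (h : S.Admissible) {N : ℕ} (i : Fin N)
    {f : Config N → ℂ} {F : ℕ → Config N → ℂ} {r : Rest i}
    (hf : MemLp (fun y => f (glue i r y)) 2 volume)
    (hF : ∀ n, MemLp (fun y => F n (glue i r y)) 2 volume)
    (hlim : Tendsto (fun n => ∫⁻ y, ‖F n (glue i r y) - f (glue i r y)‖ₑ ^ 2) atTop (𝓝 0))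
    {u q : Space}
    (hpt : Tendsto (fun n => F n (glue i r (q + u))) atTop (𝓝 (f (glue i r (q + u))))) :
    Tendsto (fun n => S.kineticDensity i (F n) (r, (u, q))) atTop
      (𝓝 (S.kineticDensity i f (r, (u, q)))) := by
  have hmp := measurePreserving_add_right (volume : Measure Space) u
  have hf' : MemLp (fun y => f (glue i r (y + u))) 2 volume := hf.comp_measurePreserving hmp
  have hF' : ∀ n, MemLp (fun y => F n (glue i r (y + u))) 2 volume :=
    fun n => (hF n).comp_measurePreserving hmp
  have hlim' : Tendsto (fun n => ∫⁻ y, ‖F n (glue i r (y + u)) - f (glue i r (y + u))‖ₑ ^ 2)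
      atTop (𝓝 0) := by
    refine hlim.congr fun n => ?_
    exact (lintegral_add_right_eq_self (fun y => ‖F n (glue i r y) - f (glue i r y)‖ₑ ^ 2) u).symm
  have hker : MemLp (S.kernel q) 2 volume := by
    obtain ⟨M, -, hM⟩ := norm_kernel_le h.loc h.side_pos
    exact memLp_two_of_bounded (integrable_kernel h.loc h.side_pos q) (hM q)
  have hth : MemLp S.theta 2 volume := by
    refine memLp_two_of_bounded S.integrable_theta (M := 1) fun x => ?_
    by_cases hx : x ∈ cube S.ℓ <;> simp [theta, hx]
  have h1 := tendsto_integral_mul hker hf' hF' hlim'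
  have h2 := tendsto_integral_mul hth hf' hF' hlim'
  have h3 : Tendsto (fun n => S.projQ (fun y => F n (glue i r (y + u))) q) atTop
      (𝓝 (S.projQ (fun y => f (glue i r (y + u))) q)) :=
    (hpt.const_mul _).sub ((h2.const_mul _).mul_const _)
  refine Tendsto.add ?_ ?_
  · exact ENNReal.Tendsto.const_mul (ENNReal.Tendsto.pow h1.enorm) (Or.inr ENNReal.ofReal_ne_top)
  · exact ENNReal.Tendsto.const_mul (ENNReal.Tendsto.pow h3.enorm) (Or.inr ENNReal.ofReal_ne_top)

/-- The averaged kinetic energy of particle `i` is at most its share of the Dirichlet energy. -/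
theorem lintegral_kineticDensity_le {S : BoxData} (h : S.Admissible) (hS : S.SymbolBound) {N : ℕ}
    (i : Fin N) {Ω : Set (Config N)} {f : Config N → ℂ} {G : Fin N × Fin 3 → Config N → ℂ}
    (hf : StronglyMeasurable f) (hG : IsH10 Ω f G) :
    ∫⁻ z, S.kineticDensity i f z ∂(volume.prod (volume.prod volume)) ≤
      ENNReal.ofReal (S.ℓ ^ 3) * ∑ k, ∫⁻ x, ‖G (i, k) x‖ₑ ^ 2 := by
  obtain ⟨hf2, hG2, happ⟩ := hG
  have hpos : ∀ n : ℕ, (0 : ℝ≥0∞) < 2⁻¹ ^ n := fun n => ENNReal.pow_pos (by simp) n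
  choose F hFs hFc _ hFf hFG using fun n => happ _ (hpos n)
  have hFm : ∀ n, StronglyMeasurable (F n) := fun n => (hFs n).continuous.stronglyMeasurable
  -- the errors are summable, hence almost all slices converge
  have hdm : ∀ n, Measurable fun x => ‖F n x - f x‖ₑ ^ 2 :=
    fun n => ((hFm n).sub hf).enorm.pow_const 2
  have herr : ∀ n, ∫⁻ x, ‖F n x - f x‖ₑ ^ 2 ≤ 2⁻¹ ^ n := fun n => by
    have h1 : ∫⁻ x, ‖F n x - f x‖ₑ ^ 2 = eLpNorm (fun x => f x - F n x) 2 volume ^ 2 := by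
      rw [eLpNorm_two_sq]
      exact lintegral_congr fun x => by rw [← enorm_neg, neg_sub]
    rw [h1]
    refine (pow_le_pow_left' (hFf n).le 2).trans ?_
    rw [← pow_mul]
    exact pow_le_pow_right_of_le_one' (by simp) (by omega)
  have hsum : ∫⁻ x, ∑' n, ‖F n x - f x‖ₑ ^ 2 ≠ ⊤ := by
    rw [lintegral_tsum fun n => (hdm n).aemeasurable]
    refine ne_top_of_le_ne_top ?_ (ENNReal.tsum_le_tsum herr)
    rw [ENNReal.tsum_geometric]
    simp
  have hsm : Measurable fun x => ∑' n, ‖F n x - f x‖ₑ ^ 2 := Measurable.tsum hdm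
  rw [lintegral_glue i hsm.aemeasurable] at hsum
  have hslice : ∀ᵐ r : Rest i, ∫⁻ y, ∑' n, ‖F n (glue i r y) - f (glue i r y)‖ₑ ^ 2 < ⊤ := by
    refine ae_lt_top ?_ hsum
    have h1 : Measurable fun z : Rest i × Space =>
        ∑' n, ‖F n (glue i z.1 z.2) - f (glue i z.1 z.2)‖ₑ ^ 2 := hsm.comp (measurable_glue i)
    exact h1.lintegral_prod_right'
  have hconv : ∀ᵐ r : Rest i, ∀ u, ∀ᵐ q,
      Tendsto (fun n => S.kineticDensity i (F n) (r, (u, q))) atTop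
        (𝓝 (S.kineticDensity i f (r, (u, q)))) := by
    filter_upwards [hslice, ae_memLp_glue i hf hf2] with r hr hfr u
    have hgr : Measurable (glue i r) := (continuous_glue i r).measurable
    have hdr : ∀ n, Measurable fun y => ‖F n (glue i r y) - f (glue i r y)‖ₑ ^ 2 :=
      fun n => (hdm n).comp hgr
    have hlim : Tendsto (fun n => ∫⁻ y, ‖F n (glue i r y) - f (glue i r y)‖ₑ ^ 2) atTop (𝓝 0) := by
      rw [lintegral_tsum fun n => (hdr n).aemeasurable] at hr
      exact ENNReal.tendsto_atTop_zero_of_tsum_ne_top hr.ne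
    have hpt : ∀ᵐ y, Tendsto (fun n => F n (glue i r y)) atTop (𝓝 (f (glue i r y))) := by
      filter_upwards [ae_lt_top (Measurable.tsum hdr) hr.ne] with y hy
      have h1 := ENNReal.tendsto_atTop_zero_of_tsum_ne_top hy.ne
      have h2 := (ENNReal.continuous_rpow_const (y := 1 / (2 : ℝ))).tendsto 0 |>.comp h1
      rw [tendsto_iff_edist_tendsto_0]
      refine (by simpa using h2 : Tendsto _ atTop (𝓝 (0 : ℝ≥0∞))).congr fun n => ?_
      simp only [Function.comp_apply, edist_eq_enorm_sub]
      rw [← ENNReal.rpow_natCast, ← ENNReal.rpow_mul]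
      norm_num
    have hpt' : ∀ᵐ q, Tendsto (fun n => F n (glue i r (q + u))) atTop (𝓝 (f (glue i r (q + u)))) :=
      (measurePreserving_add_right (volume : Measure Space) u).quasiMeasurePreserving.ae hpt
    have hFr : ∀ n, MemLp (fun y => F n (glue i r y)) 2 volume := fun n =>
      ((hFs n).continuous.comp (continuous_glue i r)).memLp_of_hasCompactSupport
        (hasCompactSupport_comp_glue i r (hFc n))
    filter_upwards [hpt'] with q hq
    exact tendsto_kineticDensity h i hfr hFr hlim hq
  -- Fatou's lemma
  have hDm : ∀ n, Measurable (S.kineticDensity i (F n)) :=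
    fun n => measurable_kineticDensity h i (hFm n)
  have hD := measurable_kineticDensity h i hf
  have hle : ∫⁻ z, S.kineticDensity i f z ∂(volume.prod (volume.prod volume)) ≤
      ∫⁻ z, liminf (fun n => S.kineticDensity i (F n) z) atTop
        ∂(volume.prod (volume.prod volume)) := by
    have hL : Measurable fun z => liminf (fun n => S.kineticDensity i (F n) z) atTop :=
      Measurable.liminf hDm
    rw [lintegral_prod _ hD.aemeasurable, lintegral_prod _ hL.aemeasurable]
    refine lintegral_mono_ae ?_
    filter_upwards [hconv] with r hr
    have hrm : Measurable fun w : Space × Space => (r, w) := by fun_prop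
    have hD2 : Measurable fun w : Space × Space => S.kineticDensity i f (r, w) := hD.comp hrm
    have hL2 : Measurable fun w : Space × Space =>
        liminf (fun n => S.kineticDensity i (F n) (r, w)) atTop := hL.comp hrm
    rw [lintegral_prod (fun w => S.kineticDensity i f (r, w)) hD2.aemeasurable,
      lintegral_prod (fun w => liminf (fun n => S.kineticDensity i (F n) (r, w)) atTop)
        hL2.aemeasurable]
    refine lintegral_mono fun u => lintegral_mono_ae ?_
    filter_upwards [hr u] with q hq
    exact hq.liminf_eq.ge
  refine hle.trans ((lintegral_liminf_le hDm).trans ?_)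
  have hbound : ∀ n, ∫⁻ z, S.kineticDensity i (F n) z ∂(volume.prod (volume.prod volume)) ≤
      ENNReal.ofReal (S.ℓ ^ 3) * ∑ k, (eLpNorm (G (i, k)) 2 volume + 2⁻¹ ^ n) ^ 2 := by
    intro n
    refine (lintegral_kineticDensity_le_of_contDiff h hS i (hFs n) (hFc n)).trans ?_
    gcongr with k
    rw [← eLpNorm_two_sq]
    gcongr
    set g : Config N → ℂ := fun x => fderiv ℝ (F n) x (EuclideanSpace.single (i, k) 1) with hg
    have hgm : AEStronglyMeasurable g volume :=
      (((hFs n).continuous_fderiv (by norm_num)).clm_apply continuous_const).aestronglyMeasurable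
    have h1 : g = G (i, k) - fun x => G (i, k) x - g x := by
      funext x; simp
    have h2 := eLpNorm_sub_le (p := 2) (hG2 (i, k)).aestronglyMeasurable
      ((hG2 (i, k)).aestronglyMeasurable.sub hgm) (by norm_num)
    have h3 : (G (i, k) - (G (i, k) - g)) = g := by abel
    rw [h3] at h2
    exact h2.trans (add_le_add le_rfl (hFG n (i, k)).le)
  have hlim : Tendsto (fun n : ℕ =>
      ENNReal.ofReal (S.ℓ ^ 3) * ∑ k : Fin 3, (eLpNorm (G (i, k)) 2 volume + 2⁻¹ ^ n) ^ 2) atTop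
      (𝓝 (ENNReal.ofReal (S.ℓ ^ 3) * ∑ k : Fin 3, ∫⁻ x, ‖G (i, k) x‖ₑ ^ 2)) := by
    refine ENNReal.Tendsto.const_mul (tendsto_finsetSum _ fun k _ => ?_)
      (Or.inr ENNReal.ofReal_ne_top)
    rw [← eLpNorm_two_sq]
    have h1 : Tendsto (fun n : ℕ => (2⁻¹ : ℝ≥0∞) ^ n) atTop (𝓝 0) :=
      ENNReal.tendsto_pow_atTop_nhds_zero_of_lt_one (by simp)
    have h2 := (tendsto_const_nhds (x := eLpNorm (G (i, k)) 2 volume)).add h1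
    rw [add_zero] at h2
    exact ENNReal.Tendsto.pow h2
  exact (liminf_le_liminf (Eventually.of_forall hbound)).trans hlim.liminf_eq.le

end BoxData

/-! ### Averaging the potential energy over all boxes -/

theorem measurableSet_openBox (N : ℕ) (L : ℝ) : MeasurableSet (openBox N L) := by
  have h : openBox N L = ⋂ p, {x : Config N | |x p| < L / 2} := by
    ext x; simp [openBox]
  rw [h]
  exact MeasurableSet.iInter fun p => measurableSet_lt (by fun_prop) measurable_const

/-- Functions in `H¹₀(Ω)` vanish outside of `Ω`. -/
theorem IsH10.ae_eq_zero {ι : Type} [Fintype ι] [DecidableEq ι] {Ω : Set (EuclideanSpace ℝ ι)}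
    {f : EuclideanSpace ℝ ι → ℂ} {G : ι → EuclideanSpace ℝ ι → ℂ} (hΩ : MeasurableSet Ω)
    (hf : StronglyMeasurable f) (h : IsH10 Ω f G) : ∀ᵐ x, x ∉ Ω → f x = 0 := by
  have h0 : ∫⁻ x in Ωᶜ, ‖f x‖ₑ ^ 2 = 0 := by
    refine le_antisymm (le_of_forall_pos_le_add fun ε hε => ?_) zero_le
    have hε' : 0 < min ε 1 := lt_min hε one_pos
    obtain ⟨φ, -, -, hφ, hfφ, -⟩ := h.2.2 _ hε'
    calc ∫⁻ x in Ωᶜ, ‖f x‖ₑ ^ 2 = ∫⁻ x in Ωᶜ, ‖f x - φ x‖ₑ ^ 2 := by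
          refine setLIntegral_congr_fun hΩ.compl fun x hx => ?_
          have : φ x = 0 := image_eq_zero_of_notMem_tsupport fun hx' => hx (hφ hx')
          simp only [this, sub_zero]
      _ ≤ ∫⁻ x, ‖f x - φ x‖ₑ ^ 2 := setLIntegral_le_lintegral _ _
      _ = eLpNorm (fun x => f x - φ x) 2 volume ^ 2 := (eLpNorm_two_sq _ _).symm
      _ ≤ min ε 1 ^ 2 := pow_le_pow_left' hfφ.le 2
      _ ≤ min ε 1 := by
          rw [sq]
          exact (mul_le_mul' le_rfl (min_le_right _ _)).trans (mul_one _).le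
      _ ≤ 0 + ε := by rw [zero_add]; exact min_le_left _ _
  have hm : Measurable fun x => ‖f x‖ₑ ^ 2 := hf.enorm.pow_const 2
  rw [lintegral_eq_zero_iff hm, EventuallyEq, ae_restrict_iff' hΩ.compl] at h0
  filter_upwards [h0] with x hx hxΩ
  simpa using hx hxΩ

theorem ofReal_integral_le_lintegral {α : Type*} [MeasurableSpace α] {μ : Measure α} {f : α → ℝ}
    (hf : Integrable f μ) : ENNReal.ofReal (∫ x, f x ∂μ) ≤ ∫⁻ x, ENNReal.ofReal (f x) ∂μ := by
  have h1 : ∫ x, f x ∂μ ≤ ∫ x, max (f x) 0 ∂μ :=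
    integral_mono hf hf.pos_part fun x => le_max_left _ _
  refine (ENNReal.ofReal_le_ofReal h1).trans (le_of_eq ?_)
  rw [ofReal_integral_eq_lintegral_ofReal hf.pos_part
    (Eventually.of_forall fun x => le_max_right _ _)]
  refine lintegral_congr fun x => ?_
  rcases le_total (f x) 0 with hx | hx
  · rw [max_eq_right hx, ENNReal.ofReal_zero, ENNReal.ofReal_of_nonpos hx]
  · rw [max_eq_left hx]

namespace BoxData

/-- The averaged localized pair interaction is the pair interaction. -/
theorem lintegral_pairEnergy_translate {S : BoxData} (h : S.Admissible) {N : ℕ}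
    {f : Config N → ℂ} (hf : StronglyMeasurable f) :
    ∫⁻ u, S.pairEnergy (fun x => f (x + diag u)) = ENNReal.ofReal (S.ℓ ^ 3) *
      ∫⁻ x : Config N, ENNReal.ofReal (pairSum (fun y z => S.v (y - z)) x) * ‖f x‖ₑ ^ 2 := by
  have hc := continuous_chiB h.loc
  have h1 : ∀ u, S.pairEnergy (fun x => f (x + diag u)) =
      ∫⁻ x : Config N, ENNReal.ofReal (pairSum S.w (x - diag u)) * ‖f x‖ₑ ^ 2 := by
    intro u
    rw [pairEnergy, ← lintegral_sub_right_eq_self (μ := volume) _ (diag u)]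
    simp only [sub_add_cancel]
  have hpair : ∀ (i j : Fin N), i ≠ j → AEMeasurable (fun z : Space × Config N =>
      ENNReal.ofReal (S.w (pos i (z.2 - diag z.1)) (pos j (z.2 - diag z.1))))
      (volume.prod volume) := by
    intro i j hij
    have hW : AEMeasurable (fun z : Space × Config N => S.W (pos i z.2 - pos j z.2))
        (volume.prod volume) :=
      (aestronglyMeasurable_W h).aemeasurable.comp_quasiMeasurePreserving
        ((quasiMeasurePreserving_pos_sub_pos hij).comp Measure.quasiMeasurePreserving_snd)
    have hp : ∀ m : Fin N, Measurable fun z : Space × Config N => S.chiB (pos m z.2 - z.1) :=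
      fun m => (hc.comp (((continuous_pos m).comp continuous_snd).sub continuous_fst)).measurable
    have hw : AEMeasurable (fun z : Space × Config N => S.chiB (pos i z.2 - z.1) *
        S.W (pos i z.2 - pos j z.2) * S.chiB (pos j z.2 - z.1)) (volume.prod volume) :=
      ((hp i).aemeasurable.mul hW).mul (hp j).aemeasurable
    simp only [pos_sub_diag, w, sub_sub_sub_cancel_right]
    exact hw.ennreal_ofReal
  have hmeas : AEMeasurable (fun z : Space × Config N =>
      ENNReal.ofReal (pairSum S.w (z.2 - diag z.1)) * ‖f z.2‖ₑ ^ 2) (volume.prod volume) := by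
    simp only [ofReal_pairSum (w_nonneg h)]
    refine AEMeasurable.mul ?_ (hf.enorm.pow_const 2 |>.comp measurable_snd).aemeasurable
    refine Finset.aemeasurable_fun_sum _ fun i _ => Finset.aemeasurable_fun_sum _ fun j hj => ?_
    exact hpair i j (Finset.mem_Ioi.1 hj).ne
  simp only [h1]
  rw [lintegral_lintegral_swap hmeas, ← lintegral_const_mul' _ _ ENNReal.ofReal_ne_top]
  refine lintegral_congr fun x => ?_
  have hu : ∀ i j : Fin N, Measurable fun u =>
      ENNReal.ofReal (S.w (pos i x - u) (pos j x - u)) := by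
    intro i j
    simp only [w, sub_sub_sub_cancel_right]
    have : Continuous fun u => S.chiB (pos i x - u) * S.W (pos i x - pos j x) *
        S.chiB (pos j x - u) := by fun_prop
    exact this.measurable.ennreal_ofReal
  rw [lintegral_mul_const' _ _ (by finiteness), ofReal_pairSum fun y z => h.nonneg _, ← mul_assoc]
  congr 1
  simp only [ofReal_pairSum (w_nonneg h), pos_sub_diag]
  rw [lintegral_finsetSum _ fun i _ => Finset.measurable_fun_sum _ fun j _ => hu i j,
    Finset.mul_sum]
  refine Finset.sum_congr rfl fun i _ => ?_
  rw [lintegral_finsetSum _ fun j _ => hu i j, Finset.mul_sum]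
  exact Finset.sum_congr rfl fun j _ => lintegral_w_translate h _ _

theorem backgroundEnergy_translate (S : BoxData) {N : ℕ} (f : Config N → ℂ) (u : Space) :
    S.backgroundEnergy (fun x => f (x + diag u)) =
      ∫ x, (∑ i : Fin N, S.background (pos i x - u)) * ‖f x‖ ^ 2 := by
  rw [backgroundEnergy, ← integral_sub_right_eq_self (μ := volume) _ (diag u)]
  simp only [sub_add_cancel, pos_sub_diag]

theorem integrable_background_prod {S : BoxData} (h : S.Admissible) {N : ℕ} (i : Fin N)
    {f : Config N → ℂ} (hf : StronglyMeasurable f) (hf2 : MemLp f 2 volume) :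
    Integrable (fun z : Space × Config N => S.background (pos i z.2 - z.1) * ‖f z.2‖ ^ 2)
      (volume.prod volume) := by
  have hp : Measurable fun z : Space × Config N => pos i z.2 - z.1 :=
    (((continuous_pos i).comp continuous_snd).sub continuous_fst).measurable
  have hb : Measurable fun z : Space × Config N => S.background (pos i z.2 - z.1) :=
    (measurable_background h).comp hp
  have hn : Measurable fun z : Space × Config N => ‖f z.2‖ ^ 2 :=
    (hf.measurable.comp measurable_snd).norm.pow_const 2
  have hF : Measurable fun z : Space × Config N =>
    S.background (pos i z.2 - z.1) * ‖f z.2‖ ^ 2 := hb.mul hn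
  refine (integrable_prod_iff' hF.aestronglyMeasurable).2 ⟨Eventually.of_forall fun x => ?_, ?_⟩
  · exact ((integrable_background h).comp_sub_left (pos i x)).mul_const (‖f x‖ ^ 2)
  · have h1 : ∀ x : Config N, ∫ u, ‖S.background (pos i x - u) * ‖f x‖ ^ 2‖ =
        (∫ u, ‖S.background u‖) * ‖f x‖ ^ 2 := fun x => by
      simp only [norm_mul, norm_pow, norm_norm, integral_mul_const]
      rw [integral_sub_left_eq_self (fun u => ‖S.background u‖) volume (pos i x)]
    simp only [h1]
    exact ((memLp_two_iff_integrable_sq_norm hf2.aestronglyMeasurable).1 hf2).const_mul _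

theorem integrable_backgroundEnergy_translate {S : BoxData} (h : S.Admissible) {N : ℕ}
    {f : Config N → ℂ} (hf : StronglyMeasurable f) (hf2 : MemLp f 2 volume) :
    Integrable fun u => S.backgroundEnergy (fun x => f (x + diag u)) := by
  simp only [backgroundEnergy_translate, Finset.sum_mul]
  exact (integrable_finsetSum Finset.univ fun i _ =>
    integrable_background_prod h i hf hf2).integral_prod_left

/-- Averaged over all boxes, the one-body potential is a multiple of the particle number. -/
theorem integral_backgroundEnergy_translate {S : BoxData} (h : S.Admissible) {N : ℕ}
    {f : Config N → ℂ} (hf : StronglyMeasurable f) (hf2 : MemLp f 2 volume) :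
    ∫ u, S.backgroundEnergy (fun x => f (x + diag u)) =
      S.ℓ ^ 3 * (∫ y, scatteringG S.v S.ω y) * N * ∫ x, ‖f x‖ ^ 2 := by
  simp only [backgroundEnergy_translate, Finset.sum_mul]
  have hI : Integrable (Function.uncurry fun (u : Space) (x : Config N) =>
      ∑ i : Fin N, S.background (pos i x - u) * ‖f x‖ ^ 2) (volume.prod volume) :=
    integrable_finsetSum Finset.univ fun i _ => integrable_background_prod h i hf hf2
  rw [integral_integral_swap hI, ← integral_const_mul]
  refine integral_congr_ae (Eventually.of_forall fun x => ?_)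
  simp only
  rw [integral_finsetSum _ fun i _ =>
    ((integrable_background h).comp_sub_left (pos i x)).mul_const _]
  simp only [integral_mul_const]
  simp only [fun i => integral_sub_left_eq_self S.background (volume : Measure Space) (pos i x),
    integral_background h, Finset.sum_const, Finset.card_univ, Fintype.card_fin, nsmul_eq_mul]
  ring

/-- Boxes that do not meet the support of `f` see no particles. -/
theorem backgroundEnergy_translate_eq_zero {S : BoxData} (h : S.Admissible) {N : ℕ} {L : ℝ}
    {f : Config N → ℂ} (hf : ∀ᵐ x, x ∉ openBox N L → f x = 0) {u : Space}
    (hu : u ∉ cube (L + S.ℓ)) : S.backgroundEnergy (fun x => f (x + diag u)) = 0 := by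
  rw [backgroundEnergy_translate]
  refine integral_eq_zero_of_ae ?_
  filter_upwards [hf] with x hx
  by_cases hxL : x ∈ openBox N L
  · refine mul_eq_zero_of_left (Finset.sum_eq_zero fun i _ => background_eq_zero h fun hi => ?_) _
    refine hu fun k => ?_
    have h1 : |x (i, k) - u k| ≤ S.ℓ / 2 := by simpa [pos] using hi k
    have h2 : |x (i, k)| < L / 2 := hxL (i, k)
    rw [abs_le] at h1 ⊢
    rw [abs_lt] at h2
    constructor <;> linarith
  · simp [hx hxL]

end BoxData

/-! ### The energy of one sector in a large box -/

namespace BoxData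

/-- The energy inequality of the box Hamiltonian, applied in the box translated by `u`. -/
theorem energy_translate_ge {S : BoxData} (h : S.Admissible) {t₀ : ℝ}
    (ht : ∀ t : ℝ, t < t₀ → (t : ℂ) ∉ graphSpectrum S.hamiltonianGraph) {N : ℕ} (Ψ : bosonic N)
    (u : Space) :
    ENNReal.ofReal (S.ρ * S.backgroundEnergy (fun x => wave Ψ (x + diag u)) + t₀ * ‖Ψ‖ ^ 2) ≤
      (∑ i, ∫⁻ r, ∫⁻ q, S.kineticDensity i (wave Ψ) (r, (u, q))) +
        S.pairEnergy (fun x => wave Ψ (x + diag u)) := by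
  obtain ⟨Ψ', hw, hn⟩ := exists_translate Ψ u
  have hm := stronglyMeasurable_wave Ψ
  have hmu : StronglyMeasurable fun x => wave Ψ (x + diag u) :=
    hm.comp_measurable (measurable_add_const _)
  have hm' := stronglyMeasurable_wave Ψ'
  have hk : ∀ i, S.kineticEnergy i (wave Ψ') =
      S.kineticEnergy i (fun x => wave Ψ (x + diag u)) := fun i =>
    lintegral_congr_ae ((actOn_fourierChiQ_congr h.loc i hm' hmu hw).mono fun x hx => by
      simp only [hx])
  have he : ∀ i, S.excitation i (wave Ψ') = S.excitation i (fun x => wave Ψ (x + diag u)) :=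
    fun i => lintegral_congr_ae ((S.actOn_projQ_congr i hm' hmu hw).mono fun x hx => by
      simp only [hx])
  have hp : S.pairEnergy (wave Ψ') = S.pairEnergy (fun x => wave Ψ (x + diag u)) :=
    lintegral_congr_ae (hw.mono fun x hx => by simp only [hx])
  have hb : S.backgroundEnergy (wave Ψ') = S.backgroundEnergy (fun x => wave Ψ (x + diag u)) :=
    integral_congr_ae (hw.mono fun x hx => by simp only [hx])
  have h1 := energy_ge_of_spectrum h ht Ψ'
  simp only [hk, he, hp, hb, hn] at h1
  refine h1.trans (le_of_eq ?_)
  congr 1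
  exact Finset.sum_congr rfl fun i _ => kineticEnergy_translate h i hm (memLp_wave Ψ) u

/-- The energy inequality of the box Hamiltonian, integrated over all boxes that meet
`[-L/2, L/2]³`. -/
theorem energy_sector_ge_of_isH10 {S : BoxData} (h : S.Admissible) (hS : S.SymbolBound) {t₀ : ℝ}
    (ht : ∀ t : ℝ, t < t₀ → (t : ℂ) ∉ graphSpectrum S.hamiltonianGraph) {L : ℝ} (hL : 0 < L)
    {N : ℕ} (Ψ : bosonic N) {G : Fin N × Fin 3 → Config N → ℂ}
    (hG : IsH10 (openBox N L) (wave Ψ) G) :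
    ENNReal.ofReal (S.ρ * (S.ℓ ^ 3 * (∫ y, scatteringG S.v S.ω y) * N * ‖Ψ‖ ^ 2) +
        (L + S.ℓ) ^ 3 * (t₀ * ‖Ψ‖ ^ 2)) ≤
      ENNReal.ofReal (S.ℓ ^ 3) * ((∑ k, ∫⁻ x, ‖G k x‖ₑ ^ 2) +
        ∫⁻ x : Config N, ENNReal.ofReal (pairSum (fun y z => S.v (y - z)) x) *
          ‖wave Ψ x‖ₑ ^ 2) := by
  have hm := stronglyMeasurable_wave Ψ
  have hLℓ : 0 ≤ L + S.ℓ := add_nonneg hL.le h.side_pos.le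
  set U := cube (L + S.ℓ) with hU
  have hUfin : volume U ≠ ⊤ := by rw [hU, volume_cube hLℓ]; exact ENNReal.ofReal_ne_top
  set F : Space → ℝ := fun u => S.backgroundEnergy (fun x => wave Ψ (x + diag u)) with hF
  have hFi : Integrable F := integrable_backgroundEnergy_translate h hm (memLp_wave Ψ)
  have hci : IntegrableOn (fun _ : Space => t₀ * ‖Ψ‖ ^ 2) U := integrableOn_const hUfin
  -- boxes outside of `U` do not meet the support, so that `F` may be integrated over all `u`
  have hFU : ∫ u in U, F u = S.ℓ ^ 3 * (∫ y, scatteringG S.v S.ω y) * N * ‖Ψ‖ ^ 2 := by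
    rw [setIntegral_eq_integral_of_forall_compl_eq_zero fun u hu =>
      backgroundEnergy_translate_eq_zero h (hG.ae_eq_zero (measurableSet_openBox N L) hm) hu,
      integral_backgroundEnergy_translate h hm (memLp_wave Ψ), integral_norm_sq_wave]
  have hint : ∫ u in U, (S.ρ * F u + t₀ * ‖Ψ‖ ^ 2) =
      S.ρ * (S.ℓ ^ 3 * (∫ y, scatteringG S.v S.ω y) * N * ‖Ψ‖ ^ 2) +
        (L + S.ℓ) ^ 3 * (t₀ * ‖Ψ‖ ^ 2) := by
    rw [integral_add (hFi.integrableOn.const_mul _) hci, integral_const_mul, hFU,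
      setIntegral_const, measureReal_def, hU, volume_cube hLℓ,
      ENNReal.toReal_ofReal (by positivity), smul_eq_mul]
  have hkm : ∀ i : Fin N, Measurable fun u =>
      ∫⁻ r, ∫⁻ q, S.kineticDensity i (wave Ψ) (r, (u, q)) :=
    fun i => measurable_kineticEnergy_translate h i hm
  calc _ = ENNReal.ofReal (∫ u in U, (S.ρ * F u + t₀ * ‖Ψ‖ ^ 2)) := by rw [hint]
    _ ≤ ∫⁻ u in U, ENNReal.ofReal (S.ρ * F u + t₀ * ‖Ψ‖ ^ 2) :=
      ofReal_integral_le_lintegral ((hFi.integrableOn.const_mul _).add hci)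
    _ ≤ ∫⁻ u, ENNReal.ofReal (S.ρ * F u + t₀ * ‖Ψ‖ ^ 2) := setLIntegral_le_lintegral _ _
    _ ≤ ∫⁻ u, ((∑ i, ∫⁻ r, ∫⁻ q, S.kineticDensity i (wave Ψ) (r, (u, q))) +
        S.pairEnergy (fun x => wave Ψ (x + diag u))) :=
      lintegral_mono fun u => energy_translate_ge h ht Ψ u
    _ = (∑ i, ∫⁻ u, ∫⁻ r, ∫⁻ q, S.kineticDensity i (wave Ψ) (r, (u, q))) +
        ∫⁻ u, S.pairEnergy (fun x => wave Ψ (x + diag u)) := by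
      rw [lintegral_add_left (Finset.measurable_fun_sum _ fun i _ => hkm i),
        lintegral_finsetSum _ fun i _ => hkm i]
    _ ≤ (∑ i, ENNReal.ofReal (S.ℓ ^ 3) * ∑ k, ∫⁻ x, ‖G (i, k) x‖ₑ ^ 2) +
        ENNReal.ofReal (S.ℓ ^ 3) * ∫⁻ x : Config N,
          ENNReal.ofReal (pairSum (fun y z => S.v (y - z)) x) * ‖wave Ψ x‖ₑ ^ 2 := by
      rw [lintegral_pairEnergy_translate h hm]
      gcongr with i
      rw [lintegral_kineticEnergy_translate h i hm]
      exact lintegral_kineticDensity_le h hS i hm hG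
    _ = _ := by rw [← Finset.mul_sum, mul_add, Fintype.sum_prod_type]

/-- The energy inequality in the sector of `N` particles, for the Dirichlet energy. -/
theorem energy_sector_ge {S : BoxData} (h : S.Admissible) (hS : S.SymbolBound) {t₀ : ℝ}
    (ht : ∀ t : ℝ, t < t₀ → (t : ℂ) ∉ graphSpectrum S.hamiltonianGraph) {L : ℝ} (hL : 0 < L)
    {N : ℕ} (Ψ : bosonic N) :
    ENNReal.ofReal (S.ρ * (S.ℓ ^ 3 * (∫ y, scatteringG S.v S.ω y) * N * ‖Ψ‖ ^ 2) +
        (L + S.ℓ) ^ 3 * (t₀ * ‖Ψ‖ ^ 2)) ≤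
      ENNReal.ofReal (S.ℓ ^ 3) * (dirichletEnergy (openBox N L) (wave Ψ) +
        ∫⁻ x : Config N, ENNReal.ofReal (pairSum (fun y z => S.v (y - z)) x) *
          ‖wave Ψ x‖ₑ ^ 2) := by
  have hℓ : ENNReal.ofReal (S.ℓ ^ 3) ≠ 0 := by
    have := h.side_pos
    exact (ENNReal.ofReal_pos.2 (by positivity)).ne'
  simp only [dirichletEnergy, ENNReal.iInf_add, ENNReal.mul_iInf_of_ne hℓ ENNReal.ofReal_ne_top]
  exact le_iInf₂ fun G hG => energy_sector_ge_of_isH10 h hS ht hL Ψ hG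

/-! ### The thermodynamic limit -/

/-- The energy in a large box is bounded below by the box energy times the number of boxes. -/
theorem mul_le_backgroundEnergy {S : BoxData} (h : S.Admissible) (hS : S.SymbolBound) {t₀ : ℝ}
    (ht : ∀ t : ℝ, t < t₀ → (t : ℂ) ∉ graphSpectrum S.hamiltonianGraph) {L : ℝ} (hL : 0 < L) :
    (((S.ℓ ^ 3)⁻¹ * ((L + S.ℓ) ^ 3 * t₀) : ℝ) : EReal) ≤
      BoseGas.backgroundEnergy S.v S.ω S.ρ L := by
  have hℓ := h.side_pos
  refine le_iInf fun Ψ => le_iInf fun hΨ0 => le_iInf fun hE => le_iInf fun hN => ?_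
  rw [EReal.coe_le_coe_iff]
  have hnorm : 0 < ‖Ψ‖ ^ 2 := by have := norm_pos_iff.2 hΨ0; positivity
  have hsumn : HasSum (fun N => ‖Ψ N‖ ^ 2) (‖Ψ‖ ^ 2) := by
    have h1 := lp.hasSum_norm (p := 2) (by norm_num) Ψ
    simpa using h1
  set e : ℕ → ℝ≥0∞ := fun N => dirichletEnergy (openBox N L) (wave (Ψ N)) +
    ∫⁻ x : Config N, ENNReal.ofReal (pairSum (fun y z => S.v (y - z)) x) *
      ‖wave (Ψ N) x‖ₑ ^ 2 with he
  have hE' : ∑' N, e N ≠ ⊤ := hE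
  have hsume : HasSum (fun N => (e N).toReal) (kineticPotential S.v L Ψ).toReal := by
    have h1 := (ENNReal.summable_toReal hE').hasSum
    rwa [← ENNReal.tsum_toReal_eq fun N => ENNReal.ne_top_of_tsum_ne_top hE' N] at h1
  have hpN : ∀ N : ℕ, ((N : ℝ≥0∞) * ‖Ψ N‖ₑ ^ 2).toReal = N * ‖Ψ N‖ ^ 2 := fun N => by simp
  have hsump : HasSum (fun N : ℕ => (N : ℝ) * ‖Ψ N‖ ^ 2) (particleNumber Ψ).toReal := by
    have hN' : ∑' N : ℕ, (N : ℝ≥0∞) * ‖Ψ N‖ₑ ^ 2 ≠ ⊤ := hN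
    have h1 := (ENNReal.summable_toReal hN').hasSum
    rw [← ENNReal.tsum_toReal_eq fun N => ENNReal.ne_top_of_tsum_ne_top hN' N] at h1
    simp only [hpN] at h1
    exact h1
  set g := ∫ y, scatteringG S.v S.ω y with hg
  have hN : ∀ N : ℕ, S.ρ * (S.ℓ ^ 3 * g) * (N * ‖Ψ N‖ ^ 2) +
      (L + S.ℓ) ^ 3 * t₀ * ‖Ψ N‖ ^ 2 ≤ S.ℓ ^ 3 * (e N).toReal := by
    intro N
    have h1 := energy_sector_ge h hS ht hL (Ψ N)
    have h2 : ENNReal.ofReal (S.ℓ ^ 3) * e N ≠ ⊤ :=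
      ENNReal.mul_ne_top ENNReal.ofReal_ne_top (ENNReal.ne_top_of_tsum_ne_top hE' N)
    have h3 := (ENNReal.ofReal_le_iff_le_toReal h2).1 h1
    rw [ENNReal.toReal_mul, ENNReal.toReal_ofReal (by positivity)] at h3
    refine le_trans (le_of_eq ?_) h3
    ring
  have hsum := hasSum_le hN ((hsump.mul_left _).add (hsumn.mul_left _)) (hsume.mul_left _)
  rw [le_div_iff₀ hnorm, inv_mul_eq_div, div_mul_eq_mul_div, div_le_iff₀ (by positivity)]
  linarith

theorem boxEnergyDensity_le {S : BoxData} (h : S.Admissible) (hS : S.SymbolBound) :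
    boxEnergyDensity S ≤ backgroundEnergyDensity S.v S.ω S.ρ := by
  have hℓ := h.side_pos
  have hℓ3 : 0 < (S.ℓ ^ 3)⁻¹ := by positivity
  have hle0 : boxEnergy S ≤ ((0 : ℝ) : EReal) :=
    iInf₂_le (0 : ℝ) (zero_mem_graphSpectrum h)
  -- the box energy is a real number unless the spectrum is unbounded below
  rcases eq_or_ne (boxEnergy S) ⊥ with hbot | hbot
  · rw [boxEnergyDensity, hbot, EReal.coe_mul_bot_of_pos hℓ3]
    exact bot_le
  obtain ⟨t₀, ht₀⟩ : ∃ t₀ : ℝ, (t₀ : EReal) = boxEnergy S :=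
    ⟨_, EReal.coe_toReal (ne_top_of_le_ne_top (EReal.coe_ne_top 0) hle0) hbot⟩
  have ht : ∀ t : ℝ, t < t₀ → (t : ℂ) ∉ graphSpectrum S.hamiltonianGraph := by
    intro t htt hmem
    have h1 : boxEnergy S ≤ (t : EReal) := iInf₂_le t hmem
    rw [← ht₀, EReal.coe_le_coe_iff] at h1
    exact absurd htt (not_lt.2 h1)
  have hlim : Tendsto (fun L : ℝ => (((S.ℓ ^ 3)⁻¹ * t₀ * (1 + S.ℓ / L) ^ 3 : ℝ) : EReal)) atTop
      (𝓝 (((S.ℓ ^ 3)⁻¹ * t₀ : ℝ) : EReal)) := by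
    refine (continuous_coe_real_ereal.tendsto _).comp ?_
    have h1 : Tendsto (fun L : ℝ => S.ℓ / L) atTop (𝓝 0) := tendsto_const_nhds.div_atTop tendsto_id
    have h2 := ((h1.const_add 1).pow 3).const_mul ((S.ℓ ^ 3)⁻¹ * t₀)
    simpa using h2
  have hev : ∀ᶠ L : ℝ in atTop, (((S.ℓ ^ 3)⁻¹ * t₀ * (1 + S.ℓ / L) ^ 3 : ℝ) : EReal) ≤
      (((L ^ 3)⁻¹ : ℝ) : EReal) * BoseGas.backgroundEnergy S.v S.ω S.ρ L := by
    filter_upwards [eventually_gt_atTop 0] with L hL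
    have h1 : (S.ℓ ^ 3)⁻¹ * t₀ * (1 + S.ℓ / L) ^ 3 =
        (L ^ 3)⁻¹ * ((S.ℓ ^ 3)⁻¹ * ((L + S.ℓ) ^ 3 * t₀)) := by
      field_simp
    rw [h1, EReal.coe_mul]
    exact mul_le_mul_of_nonneg_left (mul_le_backgroundEnergy h hS ht hL)
      (EReal.coe_nonneg.2 (by positivity))
  rw [boxEnergyDensity, ← ht₀, ← EReal.coe_mul, ← hlim.liminf_eq]
  exact liminf_le_liminf hev

end BoxData

/-! ### The range of the potential and the size of the box -/

/-- The range of the potential is at most `D` times the side length of the box. -/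
theorem range_le_mul_boxLength {K D R ρ a : ℝ} (hK : 0 < K) (hD : 0 < D) (hρ : 0 < ρ) (ha : 0 < a)
    (h : ρ * a * R ^ 2 ≤ (K * D) ^ 2) : R ≤ D * boxLength K ρ a := by
  have hρa : 0 < ρ * a := mul_pos hρ ha
  have hs := Real.sqrt_pos.2 hρa
  have hℓ : boxLength K ρ a = K / √(ρ * a) := by
    rw [boxLength, Real.rpow_neg hρa.le, ← Real.sqrt_eq_rpow, div_eq_mul_inv]
  have h1 : (√(ρ * a) * R) ^ 2 ≤ (K * D) ^ 2 := by
    rw [mul_pow, Real.sq_sqrt hρa.le]; exact h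
  have h2 := abs_le_of_sq_le_sq' h1 (by positivity)
  rw [hℓ, ← mul_div_assoc, le_div_iff₀ hs]
  linarith [h2.2]

theorem boxLength_pos {K ρ a : ℝ} (hK : 0 < K) (hρ : 0 < ρ) (ha : 0 < a) : 0 < boxLength K ρ a :=
  mul_pos hK (Real.rpow_pos_of_pos (mul_pos hρ ha) _)

theorem integrable_scatteringG {v ω : Space → ℝ} {R : ℝ} (hv : IsPotential v R)
    (hω : IsScatteringSolution v ω) : Integrable (scatteringG v ω) := by
  refine IntegrableOn.integrable_of_forall_notMem_eq_zero (s := Metric.closedBall 0 R)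
    (hω.locallyIntegrable_mul.integrableOn_isCompact (isCompact_closedBall _ _)) fun x hx => ?_
  rw [scatteringG, hv.range x (by simpa using hx), zero_mul]

end BoseGas

theorem mainTheorem6 :
    ∃ b₀ : ℝ, 0 < b₀ ∧ ∀ χ : BoseGas.Space → ℝ, BoseGas.IsLocalization χ →
      ∃ C₀ : ℝ, 0 < C₀ ∧ ∀ b c : ℝ, 0 < b → b ≤ b₀ → C₀ ≤ c →
        ∀ K D : ℝ, 0 < K → 0 < D →
          (∀ x : BoseGas.Space, ‖x‖ ≤ D → |BoseGas.selfConv χ x - 1| ≤ 1 / 2) →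
        ∀ (v : BoseGas.Space → ℝ) (R : ℝ), BoseGas.IsPotential v R →
        ∀ ω : BoseGas.Space → ℝ, BoseGas.IsScatteringSolution v ω →
        ∀ R' a : ℝ, R < R' → a = BoseGas.scatteringLength v R' → 0 < a →
        ∀ ρ : ℝ, 0 < ρ → ρ * a * R ^ 2 ≤ (K * D) ^ 2 →
          BoseGas.boxEnergyDensity
              { χ := χ, v := v, ω := ω, ℓ := BoseGas.boxLength K ρ a, b := b, c := c, ρ := ρ } ≤
            BoseGas.backgroundEnergyDensity v ω ρ := by
  refine ⟨1 / 2, by norm_num, fun χ hχ => ?_⟩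
  obtain ⟨C₀, hC₀, hsym⟩ := hχ.multiplier_unit_le
  refine ⟨C₀, hC₀, ?_⟩
  intro b c hb hb₀ hc K D hK hD hconv v R hv ω hω R' a _ _ ha ρ hρ hR
  have hℓ := BoseGas.boxLength_pos hK hρ ha
  refine BoseGas.BoxData.boxEnergyDensity_le (S := ⟨χ, v, ω, BoseGas.boxLength K ρ a, b, c, ρ⟩)
    ⟨hχ, hℓ, hb.le, hv.nonneg, hv.integrable, BoseGas.integrable_scatteringG hv hω, fun x hx => ?_⟩
    fun p => hsym b c p hb.le hb₀ hc
  have hxR : ‖x‖ ≤ R := not_lt.1 fun h => hx (hv.range x h)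
  have hxD : ‖(BoseGas.boxLength K ρ a)⁻¹ • x‖ ≤ D := by
    rw [norm_smul, norm_inv, Real.norm_of_nonneg hℓ.le, inv_mul_le_iff₀ hℓ, mul_comm]
    exact hxR.trans (BoseGas.range_le_mul_boxLength hK hD hρ ha hR)
  change 1 / 2 ≤ BoseGas.selfConv χ ((BoseGas.boxLength K ρ a)⁻¹ • x)
  have := (abs_le.1 (hconv _ hxD)).1
  linarith
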